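/- **Conventions.** $\mathbb N=\{1,2,\dots\}$. For a finite multiset $A$ of positive integers let $\Sigma(A)$ be the sum of its elements, $\chi(A)_n$ the multiplicity of $n$ in $A$, and $z^A=\prod_{n\in A}z_n$. Order the multisets by $\Sigma$ and, among multisets with equal $\Sigma$, put $A$ before $B$ if the first entry in which $\chi(A),\chi(B)$ differ is smaller in $\chi(A)$; $M_i$ is the $i$-th multiset, so $M_1=\emptyset$, $M_2=\{1\}$, $M_3=\{2\}$, $M_4=\{1,1\}$. A *graphon* is a symmetric measurable $W:[0,1)^2\to[0,1]$. For a graph $H$ with vertices $v_1,\dots,v_n$, $$\tau(H,W)=\int_{[0,1)^{n}}\prod_{v_iv_j\in E(H)}W(x_i,x_j)\prod_{v_iv_j\notin E(H)}(1-W(x_i,x_j))\,dx .$$ A *bounding sequence* is $P=(p_j,l_j,u_j)_{j\in\mathbb N}$ where $p_j$ is a real polynomial in finitely many of the variables $z_1,z_2,\dots$ with values in $[0,1]$ and first partial derivatives in $[-1,1]$ on $[0,1]^{\mathbb N}$, the coefficient $\pi_{j,i}$ of $z^{M_i}$ in $p_j$ satisfies $|\pi_{j,i}|\le 2^{-2^i}/9$,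 and $0\le l_j\le u_j\le1$. Two polynomials are *$\varepsilon$-close* if on $[0,1]^{\mathbb N}$ their values differ by at most $\varepsilon$ and so do all their first partial derivatives. Write $\langle x\rangle$ for the $k\in\mathbb N$ with $x-\lfloor x\rfloor\in[1-2^{-k+1},1-2^{-k})$; $\pi^{\pm}$ are the positive and negative parts of $\pi$. **The graphon $W_F$ of $P$.** It is symmetric. On $[0,2/3)^2\setminus[1/3,2/3)^2$ it is $1$ if $x,y\in[1/6,1/3)$ and $\langle3x\rangle=\langle3y\rangle$, or if (up to swapping $x,y$) $x\in[1/3,2/3)$, $y\in[1/6,1/3)$ and $M_{\langle3x\rangle}$ is $\{\min M_{\langle3y\rangle}\}$ or $M_{\langle3y\rangle}$ with one copy of its minimum removed; otherwise it is $0$ there. For $x\in[2/3,1)$ it is $9\cdot2^{2\langle3y\rangle}\pi^+_{\langle3x\rangle,\langle3y\rangle}$ if $y\in[0,1/3)$ and $9\cdot2^{2\langle3y\rangle}\pi^-_{\langle3x\rangle,\langle3y\rangle}$ if $y\in[1/3,2/3)$. If $\langle3x\rangle=\langle3y\rangle$, it is $1-u_{\langle3x\rangle}$ on $[1/3,2/3)^2$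 and $l_{\langle3x\rangle}$ on $[2/3,1)^2$; if $\langle3x\rangle\ne\langle3y\rangle$ it is $0$ on these two squares. **The graphon $W_0$.** Fix any rule that assigns to every graphon $W$ a graphon $\mathcal U(W)$ such that $\mathcal U(W)\big(\tfrac{6+x}{13},\tfrac{6+y}{13}\big)=W(x,y)$ for all $x,y\in[0,1)$ (for instance a rule with all $\mathcal U(W)$ finitely forcible, as provided by the universality theorem for finitely forcible graphons), and put $W_0=\mathcal U(W_F)$. For $Z\in\{A,\dots,G\}$ let $\iota^0_Z(x)=(k+x)/13$, where $k=0,\dots,6$ for $Z=A,\dots,G$. **The graphon $W_P(z)$, $z\in[0,1]^{\mathbb N}$.** Split $[0,1)$ into consecutive half-open intervals $A,B,C,D_A,\dots,D_G,E,F,Q,R$, where $Q$ has length $12/25$ and all others $1/25$; $\iota_X:[0,1)\to X$ is the increasing linear bijection. $W_P(z)$ is symmetric, and its value at $(\iota_X(x),\iota_Y(y))$ is as follows (it is $0$ wherever nothing is said). Put $p=p_{\langle3x\rangle}(z)$, $v_k=2^{k}(3y-1)+2$, $w_k=2^{k}(3y-2)+2$. * $A\times Y$, $Y\in\{A,B,C,D_A,\dots,D_G,E\}$: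 $1$ if $\lfloor3x\rfloor=\lfloor3y\rfloor$. $B\times Y$, $Y\in\{B,C,D_A,\dots,D_G,E\}$: $1$ if $\lfloor3x\rfloor=\lfloor3y\rfloor$ and $\langle3x\rangle=\langle3y\rangle$. * $C\times C$, when $\langle3x\rangle=\langle3y\rangle$: $z^{M_{\langle3x\rangle}}$ on $[0,\frac13)^2\cup[\frac13,\frac23)^2$ and $1-z^{M_{\langle3x\rangle}}$ on $[0,\frac13)\times[\frac13,\frac23)$ and $[\frac13,\frac23)\times[0,\frac13)$. * $C\times D_A$ (resp. $C\times D_B$): $1$ if $\langle3x\rangle=\langle3y\rangle$, $x\in[0,\frac13)$ and $y\in[\frac13,\frac23)$ (resp. $y\in[\frac23,1)$). $C\times D_C$: $1$ on $[0,\frac16)^2$. $C\times D_G$: $W_F(x,y)$ on $[0,\frac13)\times[0,\frac23)$ and on $[0,\frac23)\times[\frac23,1)$. * $C\times E$, with $k=\langle3x\rangle$: $1$ in the four cases: $x,y\in[0,\frac13)$, $0\le v_k\le p$; $x\in[0,\frac13)$, $y\in[\frac13,\frac23)$, $0\le w_k\le1-p$; $x\in[\frac13,\frac23)$, $y\in[0,\frac13)$,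 $p\le v_k\le1$; $x,y\in[\frac13,\frac23)$, $1-p\le w_k\le1$. * $D_Z\times D_{Z'}$: $W_0(\iota^0_Z(x),\iota^0_{Z'}(y))$. $D_G\times E$, when $\langle3x\rangle=\langle3y\rangle=k$ and $y\in[0,\frac13)$: $1$ if $x\in[\frac13,\frac23)$ and $v_k\le u_k$, or $x\in[\frac23,1)$ and $v_k\le l_k$. * $X\times F$, $X\in\{A,B,D_A,\dots,D_G,F\}$: $1$ if $x+y\ge1$. * $X\times Q$, $X\in\{A,B,C,D_A,\dots,D_G,E,F\}$: $\frac1{12}\big(12-\sum_{Z}\int_0^1W_P(z)(\iota_X(x),\iota_Z(t))\,dt\big)$, the sum over the same twelve parts. $Q\times Q$, $Q\times R$: $1$. $A\times R,B\times R,C\times R,D_A\times R,\dots,D_G\times R,E\times R,F\times R$: $\frac1{25},\frac2{25},\dots,\frac{12}{25}$, respectively. The *$L_1$-distance* of bounding sequences $P,P'$ is $\sup_{z\in[0,1]^{\mathbb N}}\int_{[0,1)^2}|W_P(z)(x,y)-W_{P'}(z)(x,y)|\,dx\,dy$. **Lemma.** For every finite graph $H$ there exist a countable set $\mathcal H$,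 a constant $c_H\in(0,1)$ and constants $\beta_{H',i}$ ($H'\in\mathcal H$, $i\in\mathbb N$), depending only on $H$ (not on $\mathcal U$), such that $\sum_{H'\in\mathcal H}\beta_{H',i}$ is finite for every $i$ and at most $c_H^{\Sigma(M_i)}$ for all but finitely many $i$, and such that for every bounding sequence $P$ there are polynomials $q_{P,H'}(z)=\sum_{i}\alpha_{P,H',i}z^{M_i}$, $H'\in\mathcal H$, with the following properties. 1. $\tau(H,W_P(z))=\sum_{H'\in\mathcal H}q_{P,H'}(z)$ (a convergent sum) for every $z\in[0,1]^{\mathbb N}$ with $p_j(z)\in[l_j,u_j]$ for all $j\in\mathbb N$. 2. $|\alpha_{P,H',i}|\le\beta_{H',i}$ for all $H'\in\mathcal H$ and $i\in\mathbb N$. 3. For every $P$, every $H'\in\mathcal H$ and every $\varepsilon>0$ there are an integer $k_{P,H'}$ and a real $\varepsilon_{P,H'}>0$ such that, if $P'$ is a bounding sequence that agrees with $P$ on the first $k_{P,H'}$ elements and has $L_1$-distance at most $\varepsilon_{P,H'}$ from $P$, then $q_{P,H'}$ and $q_{P',H'}$ are $\varepsilon$-close. -/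

import Mathlib

open MeasureTheory

noncomputable section

namespace GraphonFamily

/-! ### Finite multisets of positive integers and their enumeration

A finite multiset of positive integers is given by its multiplicity vector, an element
of `ℕ+ →₀ ℕ`.  These are also the exponent vectors of the monomials of
`MvPolynomial ℕ+ ℝ`. -/

/-- The sum `Σ(A)` of the elements of the multiset `A`. -/
def weight (A : ℕ+ →₀ ℕ) : ℕ := A.sum fun n e => (n : ℕ) * e

/-- The strict order on multisets: first compare the sums, then the first entry in which the
multiplicity vectors differ. -/
def Precedes (A B : ℕ+ →₀ ℕ) : Prop :=
  weight A < weight B ∨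
    (weight A = weight B ∧ ∃ n : ℕ+, (∀ m < n, A m = B m) ∧ A n < B n)

/-- The number of multisets strictly before `A`. -/
def position (A : ℕ+ →₀ ℕ) : ℕ := Set.ncard {B | Precedes B A}

theorem Precedes.trans {A B C : ℕ+ →₀ ℕ} (h : Precedes A B) (h' : Precedes B C) :
    Precedes A C := by
  rcases h with h | ⟨h, n, hn, hn'⟩
  · rcases h' with h' | ⟨h', -⟩
    · exact Or.inl (h.trans h')
    · exact Or.inl (h' ▸ h)
  · rcases h' with h' | ⟨h', m, hm, hm'⟩
    · exact Or.inl (h ▸ h')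
    · refine Or.inr ⟨h.trans h', ?_⟩
      rcases lt_trichotomy n m with hlt | rfl | hlt
      · exact ⟨n, fun k hk => (hn k hk).trans (hm k (hk.trans hlt)), (hm n hlt) ▸ hn'⟩
      · exact ⟨n, fun k hk => (hn k hk).trans (hm k hk), hn'.trans hm'⟩
      · exact ⟨m, fun k hk => (hn k (hk.trans hlt)).trans (hm k hk), (hn m hlt) ▸ hm'⟩

theorem not_precedes_self (A : ℕ+ →₀ ℕ) : ¬ Precedes A A := by
  rintro (h | ⟨-, n, -, h⟩)
  · exact lt_irrefl _ h
  · exact lt_irrefl _ h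

theorem precedes_or_of_ne {A B : ℕ+ →₀ ℕ} (h : A ≠ B) : Precedes A B ∨ Precedes B A := by
  rcases lt_trichotomy (weight A) (weight B) with hw | hw | hw
  · exact Or.inl (Or.inl hw)
  · have hex : ∃ n : ℕ+, A n ≠ B n := by
      by_contra hcon
      push Not at hcon
      exact h (Finsupp.ext hcon)
    let n := WellFounded.min (wellFounded_lt (α := ℕ+)) {n | A n ≠ B n} hex
    have hn : A n ≠ B n := WellFounded.min_mem (wellFounded_lt (α := ℕ+)) {n | A n ≠ B n} hex
    have hmin : ∀ m < n, A m = B m := by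
      intro m hm
      by_contra hne
      exact WellFounded.not_lt_min (wellFounded_lt (α := ℕ+)) {n | A n ≠ B n} hne hm
    rcases lt_or_gt_of_ne hn with hlt | hlt
    · exact Or.inl (Or.inr ⟨hw, n, hmin, hlt⟩)
    · exact Or.inr (Or.inr ⟨hw.symm, n, fun m hm => (hmin m hm).symm, hlt⟩)
  · exact Or.inr (Or.inl hw)

theorem finite_weight_le (w : ℕ) : {A : ℕ+ →₀ ℕ | weight A ≤ w}.Finite := by
  have hterm : ∀ A : ℕ+ →₀ ℕ, ∀ n : ℕ+, (n : ℕ) * A n ≤ weight A := by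
    intro A n
    by_cases hn : n ∈ A.support
    · exact Finset.single_le_sum (f := fun n : ℕ+ => (n : ℕ) * A n)
        (fun _ _ => Nat.zero_le _) hn
    · simp [Finsupp.notMem_support_iff.mp hn]
  refine (Set.finite_Iic (Finsupp.indicator (Finset.Icc 1 (Nat.toPNat' w))
    (fun _ _ => w))).subset ?_
  intro A hA n
  have h1 := (hterm A n).trans hA
  by_cases h0 : A n = 0
  · rw [h0]; exact Nat.zero_le _
  · have h2 : (n : ℕ) ≤ w := (Nat.le_mul_of_pos_right _ (Nat.pos_of_ne_zero h0)).trans h1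
    have h3 : A n ≤ w := (Nat.le_mul_of_pos_left _ n.pos).trans h1
    have h4 : n ∈ Finset.Icc 1 (Nat.toPNat' w) := by
      rw [Finset.mem_Icc]
      refine ⟨one_le, ?_⟩
      have hw : 0 < w := lt_of_lt_of_le n.pos h2
      rw [← PNat.coe_le_coe, Nat.toPNat'_coe, if_pos hw]
      exact h2
    rw [Finsupp.indicator_of_mem h4]
    exact h3

theorem finite_precedes (A : ℕ+ →₀ ℕ) : {B | Precedes B A}.Finite := by
  refine (finite_weight_le (weight A)).subset ?_
  rintro B (h | ⟨h, -⟩)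
  · exact h.le
  · exact h.le

theorem position_lt {A B : ℕ+ →₀ ℕ} (h : Precedes A B) : position A < position B := by
  refine Set.ncard_lt_ncard ⟨fun C hC => Precedes.trans hC h, fun hsub => ?_⟩
    (finite_precedes B)
  exact not_precedes_self A (hsub h)

theorem position_injective : Function.Injective position := by
  intro A B h
  by_contra hne
  rcases precedes_or_of_ne hne with h' | h'
  · exact absurd (position_lt h') (by omega)
  · exact absurd (position_lt h') (by omega)

theorem position_surjective : Function.Surjective position := by
  have hdown : ∀ A : ℕ+ →₀ ℕ, ∀ r < position A, ∃ B, position B = r := by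
    intro A r hr
    have himg : position '' {B | Precedes B A} = Set.Iio (position A) := by
      refine Set.eq_of_subset_of_ncard_le ?_ ?_ (Set.finite_Iio _)
      · rintro _ ⟨B, hB, rfl⟩
        exact position_lt hB
      · rw [Set.ncard_image_of_injective _ position_injective]
        have : (Set.Iio (position A)).ncard = position A := by
          rw [← Finset.coe_Iio, Set.ncard_coe_finset, Nat.card_Iio]
        rw [this]
        exact le_rfl
    have hr' : r ∈ position '' {B | Precedes B A} := by rw [himg]; exact hr
    obtain ⟨B, -, hB⟩ := hr'
    exact ⟨B, hB⟩
  intro r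
  have hinf : (Set.range position).Infinite := Set.infinite_range_of_injective position_injective
  obtain ⟨_, ⟨A, rfl⟩, hA⟩ := hinf.exists_gt r
  exact hdown A r hA

theorem position_bijective : Function.Bijective position :=
  ⟨position_injective, position_surjective⟩

/-- `M i` is the `i`-th multiset, `i = 1, 2, …`: the one with exactly `i - 1` predecessors. -/
def M (i : ℕ+) : ℕ+ →₀ ℕ :=
  (Equiv.ofBijective position position_bijective).symm i.natPred

theorem position_M (i : ℕ+) : position (M i) = i.natPred :=
  (Equiv.ofBijective position position_bijective).apply_symm_apply i.natPred

/-! ### Polynomials and bounding sequences -/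

/-- The cube `[0,1]^ℕ`. -/
def cube : Set (ℕ+ → ℝ) := {z | ∀ n, z n ∈ Set.Icc (0 : ℝ) 1}

/-- The value `z^A`. -/
def monomialValue (A : ℕ+ →₀ ℕ) (z : ℕ+ → ℝ) : ℝ := A.prod fun n e => z n ^ e

/-- Two polynomials are `ε`-close if their values and the values of all their first partial
derivatives differ by at most `ε` on the cube. -/
def EpsClose (ε : ℝ) (q q' : MvPolynomial ℕ+ ℝ) : Prop :=
  ∀ z ∈ cube, |MvPolynomial.eval z q - MvPolynomial.eval z q'| ≤ ε ∧
    ∀ n : ℕ+, |MvPolynomial.eval z (MvPolynomial.pderiv n q) -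
      MvPolynomial.eval z (MvPolynomial.pderiv n q')| ≤ ε

/-- Bounding sequences `(p_i, l_i, u_i)`, `i = 1, 2, …`. -/
structure BoundingSequence where
  p : ℕ+ → MvPolynomial ℕ+ ℝ
  l : ℕ+ → ℝ
  u : ℕ+ → ℝ
  p_mem : ∀ i, ∀ z ∈ cube, MvPolynomial.eval z (p i) ∈ Set.Icc (0 : ℝ) 1
  coeff_le : ∀ i j, |MvPolynomial.coeff (M j) (p i)| ≤ ((2 : ℝ) ^ (2 ^ (j : ℕ)))⁻¹ / 9
  pderiv_le : ∀ i n, ∀ z ∈ cube,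
    |MvPolynomial.eval z (MvPolynomial.pderiv n (p i))| ≤ 1
  l_mem : ∀ i, l i ∈ Set.Icc (0 : ℝ) 1
  u_mem : ∀ i, u i ∈ Set.Icc (0 : ℝ) 1
  l_le_u : ∀ i, l i ≤ u i

/-- `z` satisfies the constraints `p_j(z) ∈ [l_j, u_j]`. -/
def Feasible (P : BoundingSequence) (z : ℕ+ → ℝ) : Prop :=
  ∀ j, MvPolynomial.eval z (P.p j) ∈ Set.Icc (P.l j) (P.u j)

/-- `P` and `P'` agree on the first `k` elements. -/
def AgreeUpTo (k : ℕ) (P P' : BoundingSequence) : Prop :=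
  ∀ i : ℕ+, (i : ℕ) ≤ k → P.p i = P'.p i ∧ P.l i = P'.l i ∧ P.u i = P'.u i

/-! ### Graphons -/

/-- A graphon: a symmetric measurable function from `[0,1)²` to `[0,1]`.  Only the values on
`[0,1)²` matter. -/
structure IsGraphon (W : ℝ → ℝ → ℝ) : Prop where
  meas : Measurable fun s : Set.Ico (0 : ℝ) 1 × Set.Ico (0 : ℝ) 1 => W s.1 s.2
  symm : ∀ x ∈ Set.Ico (0 : ℝ) 1, ∀ y ∈ Set.Ico (0 : ℝ) 1, W x y = W y x
  mem : ∀ x ∈ Set.Ico (0 : ℝ) 1, ∀ y ∈ Set.Ico (0 : ℝ) 1, W x y ∈ Set.Icc (0 : ℝ) 1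

open Classical in
/-- The labelled density `τ(H, W)`: the probability that the `W`-random graph on the vertices
of `H` is `H`. -/
def tau {n : ℕ} (H : SimpleGraph (Fin n)) (W : ℝ → ℝ → ℝ) : ℝ :=
  ∫ x in Set.univ.pi (fun _ : Fin n => Set.Ico (0 : ℝ) 1),
    ∏ e : Fin n × Fin n with e.1 < e.2,
      if H.Adj e.1 e.2 then W (x e.1) (x e.2) else 1 - W (x e.1) (x e.2)

/-! ### Dyadic coordinates -/

/-- `⟨x⟩`: the unique positive integer `k` such that the fractional part of `x` lies in
`[1 - 2^{-k+1}, 1 - 2^{-k})`. -/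
def coord (x : ℝ) : ℕ+ := Nat.succPNat ⌊-Real.logb 2 (1 - Int.fract x)⌋₊

theorem coord_spec (x : ℝ) :
    1 - 2 * ((2 : ℝ) ^ (coord x : ℕ))⁻¹ ≤ Int.fract x ∧
      Int.fract x < 1 - ((2 : ℝ) ^ (coord x : ℕ))⁻¹ := by
  set t := 1 - Int.fract x with ht
  have h0 : 0 < t := by linarith [Int.fract_lt_one x]
  have h1 : t ≤ 1 := by linarith [Int.fract_nonneg x]
  have hl : 0 ≤ -Real.logb 2 t := by
    have := Real.logb_nonpos (b := 2) (by norm_num) h0.le h1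
    linarith
  set m := ⌊-Real.logb 2 t⌋₊ with hm
  have hc : ((coord x : ℕ+) : ℕ) = m + 1 := by simp [coord, hm, ht]
  have ha : (m : ℝ) ≤ -Real.logb 2 t := Nat.floor_le hl
  have hb : -Real.logb 2 t < (m : ℝ) + 1 := Nat.lt_floor_add_one _
  have ha' : t ≤ ((2 : ℝ) ^ m)⁻¹ := by
    have : Real.logb 2 t ≤ -(m : ℝ) := by linarith
    rw [Real.logb_le_iff_le_rpow (by norm_num) h0, Real.rpow_neg (by norm_num),
      Real.rpow_natCast] at this
    exact this
  have hb' : ((2 : ℝ) ^ (m + 1))⁻¹ < t := by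
    have : -((m + 1 : ℕ) : ℝ) < Real.logb 2 t := by push_cast; linarith
    rw [Real.lt_logb_iff_rpow_lt (by norm_num) h0, Real.rpow_neg (by norm_num),
      Real.rpow_natCast] at this
    exact this
  rw [hc]
  have hpow : 2 * ((2 : ℝ) ^ (m + 1))⁻¹ = ((2 : ℝ) ^ m)⁻¹ := by
    rw [pow_succ]; field_simp
  constructor
  · rw [hpow]; linarith
  · linarith

/-! ### The graphon `W_F` encoding a bounding sequence -/

/-- `B` is nonempty and `A` is either `B` without one copy of `min B`, or `{min B}`. -/
def IsMinFactor (A B : ℕ+ →₀ ℕ) : Prop :=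
  ∃ m ∈ B.support, (∀ n ∈ B.support, m ≤ n) ∧
    (A = B - Finsupp.single m 1 ∨ A = Finsupp.single m 1)

/-- The positive part of the coefficient of `z^{M_j}` in `p_i`. -/
def coeffPos (P : BoundingSequence) (i j : ℕ+) : ℝ :=
  max (MvPolynomial.coeff (M j) (P.p i)) 0

/-- The negative part of the coefficient of `z^{M_j}` in `p_i`. -/
def coeffNeg (P : BoundingSequence) (i j : ℕ+) : ℝ :=
  max (-MvPolynomial.coeff (M j) (P.p i)) 0

open Classical in
/-- The part of `W_F` on `[0,2/3)² \ [1/3,2/3)²`. -/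
def WFstructure (x y : ℝ) : ℝ :=
  if (x ∈ Set.Ico (1 / 6 : ℝ) (1 / 3) ∧ y ∈ Set.Ico (1 / 6 : ℝ) (1 / 3) ∧
        coord (3 * x) = coord (3 * y)) ∨
      (x ∈ Set.Ico (1 / 3 : ℝ) (2 / 3) ∧ y ∈ Set.Ico (1 / 6 : ℝ) (1 / 3) ∧
        IsMinFactor (M (coord (3 * x))) (M (coord (3 * y)))) ∨
      (y ∈ Set.Ico (1 / 3 : ℝ) (2 / 3) ∧ x ∈ Set.Ico (1 / 6 : ℝ) (1 / 3) ∧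
        IsMinFactor (M (coord (3 * y))) (M (coord (3 * x))))
  then 1 else 0

open Classical in
/-- The graphon `W_F`; the floors `⌊3x⌋`, `⌊3y⌋` (which are `0`, `1` or `2` for points of
`[0,1)`) tell in which third the two coordinates lie. -/
def WF (P : BoundingSequence) (x y : ℝ) : ℝ :=
  if ⌊3 * x⌋ = 2 ∧ ⌊3 * y⌋ = 0 then
    9 * 2 ^ (2 * (coord (3 * y) : ℕ)) * coeffPos P (coord (3 * x)) (coord (3 * y))
  else if ⌊3 * x⌋ = 2 ∧ ⌊3 * y⌋ = 1 then
    9 * 2 ^ (2 * (coord (3 * y) : ℕ)) * coeffNeg P (coord (3 * x)) (coord (3 * y))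
  else if ⌊3 * x⌋ = 0 ∧ ⌊3 * y⌋ = 2 then
    9 * 2 ^ (2 * (coord (3 * x) : ℕ)) * coeffPos P (coord (3 * y)) (coord (3 * x))
  else if ⌊3 * x⌋ = 1 ∧ ⌊3 * y⌋ = 2 then
    9 * 2 ^ (2 * (coord (3 * x) : ℕ)) * coeffNeg P (coord (3 * y)) (coord (3 * x))
  else if ⌊3 * x⌋ = 1 ∧ ⌊3 * y⌋ = 1 then
    if coord (3 * x) = coord (3 * y) then 1 - P.u (coord (3 * x)) else 0
  else if ⌊3 * x⌋ = 2 ∧ ⌊3 * y⌋ = 2 then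
    if coord (3 * x) = coord (3 * y) then P.l (coord (3 * x)) else 0
  else WFstructure x y

/-- An embedding of graphons into larger graphons: to every graphon `W` it assigns a graphon
`U W` in which `W` sits, linearly rescaled, on the seventh of the consecutive parts
`A, …, G = [k/13, (k+1)/13)`, `k = 0, …, 6`.  The assignment of a finitely forcible
graphon `W_0` to `W_F` given by the universality theorem for finitely forcible graphons is
of this form; finite forcibility is not required here. -/
def IsUniversalEmbedding (U : (ℝ → ℝ → ℝ) → ℝ → ℝ → ℝ) : Prop :=
  ∀ W, IsGraphon W → IsGraphon (U W) ∧
    ∀ x ∈ Set.Ico (0 : ℝ) 1, ∀ y ∈ Set.Ico (0 : ℝ) 1,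
      U W ((6 + x) / 13) ((6 + y) / 13) = W x y

/-! ### The graphon `W_P(z)` -/

/-- The parts `A, B, C, D_A, …, D_G, E, F, Q, R`; `D 0, …, D 6` stand for
`D_A, …, D_G`. -/
inductive GPart where
  | A | B | C
  | D (k : Fin 7)
  | E | F | Q | R

/-- The left end of a part. -/
def GPart.left : GPart → ℝ
  | .A => 0
  | .B => 1 / 25
  | .C => 2 / 25
  | .D k => (3 + ((k : ℕ) : ℝ)) / 25
  | .E => 10 / 25
  | .F => 11 / 25
  | .Q => 12 / 25
  | .R => 24 / 25

/-- The length of a part. -/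
def GPart.size : GPart → ℝ
  | .Q => 12 / 25
  | _ => 1 / 25

/-- The linear map `ι_X` from `[0,1)` to the part `X`. -/
def GPart.iota (X : GPart) (x : ℝ) : ℝ := X.left + X.size * x

/-- The part containing the point `s` of `[0,1)`. -/
def partOf (s : ℝ) : GPart :=
  if s < 1 / 25 then .A
  else if s < 2 / 25 then .B
  else if s < 3 / 25 then .C
  else if s < 4 / 25 then .D 0
  else if s < 5 / 25 then .D 1
  else if s < 6 / 25 then .D 2
  else if s < 7 / 25 then .D 3
  else if s < 8 / 25 then .D 4
  else if s < 9 / 25 then .D 5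
  else if s < 10 / 25 then .D 6
  else if s < 11 / 25 then .E
  else if s < 12 / 25 then .F
  else if s < 24 / 25 then .Q
  else .R

/-- The relative coordinate of `s` in its part, i.e. `ι_X⁻¹(s)`. -/
def relCoord (s : ℝ) : ℝ := (s - (partOf s).left) / (partOf s).size

theorem partOf_iota (X : GPart) (x : ℝ) (hx : x ∈ Set.Ico (0 : ℝ) 1) :
    partOf (X.iota x) = X ∧ relCoord (X.iota x) = x := by
  obtain ⟨h0, h1⟩ := hx
  have h : partOf (X.iota x) = X := by
    obtain ⟨s, hs⟩ : ∃ s, s = GPart.iota X x := ⟨_, rfl⟩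
    rw [← hs]
    cases X with
    | D k =>
      have h2 : s = (3 + ((k : ℕ) : ℝ)) / 25 + 1 / 25 * x := hs
      clear hs
      unfold partOf
      fin_cases k <;> norm_num only [Nat.cast_ofNat, Nat.cast_zero, Nat.cast_one] at h2 <;>
        (repeat refine (if_neg (by linarith)).trans ?_) <;> exact if_pos (by linarith)
    | _ =>
      simp only [GPart.iota, GPart.left, GPart.size] at hs
      unfold partOf
      (repeat refine (if_neg (by linarith)).trans ?_) <;>
        first | rfl | exact if_pos (by linarith)
  refine ⟨h, ?_⟩
  have hs : X.size ≠ 0 := by cases X <;> norm_num [GPart.size]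
  rw [relCoord, h, GPart.iota]
  field_simp
  ring

open Classical in
/-- The tiles `A×A, …, A×E`. -/
def tileA (x y : ℝ) : ℝ := if ⌊3 * x⌋ = ⌊3 * y⌋ then 1 else 0

open Classical in
/-- The tiles `B×B, …, B×E`. -/
def tileB (x y : ℝ) : ℝ :=
  if ⌊3 * x⌋ = ⌊3 * y⌋ ∧ coord (3 * x) = coord (3 * y) then 1 else 0

open Classical in
/-- The half-graphon, on the tiles `X×F`. -/
def tileHalf (x y : ℝ) : ℝ := if 1 ≤ x + y then 1 else 0

open Classical in
/-- The tile `C×C`. -/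
def tileCC (z : ℕ+ → ℝ) (x y : ℝ) : ℝ :=
  if coord (3 * x) = coord (3 * y) then
    if (⌊3 * x⌋ = 0 ∧ ⌊3 * y⌋ = 0) ∨ (⌊3 * x⌋ = 1 ∧ ⌊3 * y⌋ = 1) then
      monomialValue (M (coord (3 * x))) z
    else if (⌊3 * x⌋ = 0 ∧ ⌊3 * y⌋ = 1) ∨ (⌊3 * x⌋ = 1 ∧ ⌊3 * y⌋ = 0) then
      1 - monomialValue (M (coord (3 * x))) z
    else 0
  else 0

open Classical in
/-- The tiles `C×D_A, …, C×D_G`. -/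
def tileCD (P : BoundingSequence) (k : Fin 7) (x y : ℝ) : ℝ :=
  if k = 0 then
    if ⌊3 * x⌋ = 0 ∧ ⌊3 * y⌋ = 1 ∧ coord (3 * x) = coord (3 * y) then 1 else 0
  else if k = 1 then
    if ⌊3 * x⌋ = 0 ∧ ⌊3 * y⌋ = 2 ∧ coord (3 * x) = coord (3 * y) then 1 else 0
  else if k = 2 then
    if x ∈ Set.Ico (0 : ℝ) (1 / 6) ∧ y ∈ Set.Ico (0 : ℝ) (1 / 6) then 1 else 0
  else if k = 6 then
    if (x ∈ Set.Ico (0 : ℝ) (1 / 3) ∧ y ∈ Set.Ico (0 : ℝ) (2 / 3)) ∨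
        (x ∈ Set.Ico (0 : ℝ) (2 / 3) ∧ y ∈ Set.Ico (2 / 3 : ℝ) 1) then WF P x y else 0
  else 0

open Classical in
/-- The tile `C×E`. -/
def tileCE (P : BoundingSequence) (z : ℕ+ → ℝ) (x y : ℝ) : ℝ :=
  let k := coord (3 * x)
  let p := MvPolynomial.eval z (P.p k)
  let v := (2 : ℝ) ^ (k : ℕ) * (3 * y - 1) + 2
  let w := (2 : ℝ) ^ (k : ℕ) * (3 * y - 2) + 2
  if (⌊3 * x⌋ = 0 ∧ ⌊3 * y⌋ = 0 ∧ 0 ≤ v ∧ v ≤ p) ∨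
      (⌊3 * x⌋ = 0 ∧ ⌊3 * y⌋ = 1 ∧ 0 ≤ w ∧ w ≤ 1 - p) ∨
      (⌊3 * x⌋ = 1 ∧ ⌊3 * y⌋ = 0 ∧ v ≤ 1 ∧ p ≤ v) ∨
      (⌊3 * x⌋ = 1 ∧ ⌊3 * y⌋ = 1 ∧ w ≤ 1 ∧ 1 - p ≤ w)
  then 1 else 0

open Classical in
/-- The tile `D_G×E`. -/
def tileDGE (P : BoundingSequence) (x y : ℝ) : ℝ :=
  let k := coord (3 * y)
  let v := (2 : ℝ) ^ (k : ℕ) * (3 * y - 1) + 2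
  if ⌊3 * y⌋ = 0 ∧ coord (3 * x) = k ∧
      ((⌊3 * x⌋ = 1 ∧ v ≤ P.u k) ∨ (⌊3 * x⌋ = 2 ∧ v ≤ P.l k))
  then 1 else 0

/-- The values of `W_P(z)` on the tiles `X×Y`, in relative coordinates, where `X` precedes or
equals `Y` and neither of them is `Q` or `R`. -/
def upperTile (U : (ℝ → ℝ → ℝ) → ℝ → ℝ → ℝ) (P : BoundingSequence) (z : ℕ+ → ℝ) :
    GPart → GPart → ℝ → ℝ → ℝ
  | .A, .F => tileHalf
  | .A, _ => tileA
  | .B, .F => tileHalf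
  | .B, _ => tileB
  | .C, .C => tileCC z
  | .C, .D k => tileCD P k
  | .C, .E => tileCE P z
  | .D j, .D k => fun x y =>
      U (WF P) ((((j : ℕ) : ℝ) + x) / 13) ((((k : ℕ) : ℝ) + y) / 13)
  | .D j, .E => fun x y => if j = 6 then tileDGE P x y else 0
  | .D _, .F => tileHalf
  | .F, .F => tileHalf
  | _, _ => fun _ _ => 0

/-- The values of `W_P(z)` on the tiles `X×Y`, `X, Y ∈ {A, B, C, D_A, …, D_G, E, F}`. -/
def innerTile (U : (ℝ → ℝ → ℝ) → ℝ → ℝ → ℝ) (P : BoundingSequence) (z : ℕ+ → ℝ)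
    (X Y : GPart) (x y : ℝ) : ℝ :=
  if X.left ≤ Y.left then upperTile U P z X Y x y else upperTile U P z Y X y x

/-- `∫_{[0,1)} W_P(ι_X(x), ι_Z(t)) dt`. -/
def relDeg (U : (ℝ → ℝ → ℝ) → ℝ → ℝ → ℝ) (P : BoundingSequence) (z : ℕ+ → ℝ)
    (X Z : GPart) (x : ℝ) : ℝ :=
  ∫ t in Set.Ico (0 : ℝ) 1, innerTile U P z X Z x t

/-- The value of `W_P(z)` at `(ι_X(x), ι_Q(y))`, for `X ∈ {A, B, C, D_A, …, D_G, E, F}`. -/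
def tileQ (U : (ℝ → ℝ → ℝ) → ℝ → ℝ → ℝ) (P : BoundingSequence) (z : ℕ+ → ℝ)
    (X : GPart) (x : ℝ) : ℝ :=
  (1 / 12) * (12 - (relDeg U P z X .A x + relDeg U P z X .B x + relDeg U P z X .C x +
    (∑ k : Fin 7, relDeg U P z X (.D k) x) + relDeg U P z X .E x + relDeg U P z X .F x))

/-- The value of `W_P(z)` on the tile `X×R`: `1/25, …, 12/25` for the twelve parts
`A, …, F`, then `1` for `Q` and `0` for `R`. -/
def tileR : GPart → ℝ
  | .Q => 1
  | .R => 0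
  | X => X.left + 1 / 25

/-- The values of `W_P(z)` on all tiles, in relative coordinates. -/
def tile (U : (ℝ → ℝ → ℝ) → ℝ → ℝ → ℝ) (P : BoundingSequence) (z : ℕ+ → ℝ) :
    GPart → GPart → ℝ → ℝ → ℝ
  | X, .R => fun _ _ => tileR X
  | .R, Y => fun _ _ => tileR Y
  | .Q, .Q => fun _ _ => 1
  | X, .Q => fun x _ => tileQ U P z X x
  | .Q, Y => fun _ y => tileQ U P z Y y
  | X, Y => innerTile U P z X Y

/-- The graphon `W_P(z)`, with `U (WF P)` in the role of `W_0`. -/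
def WP (U : (ℝ → ℝ → ℝ) → ℝ → ℝ → ℝ) (P : BoundingSequence) (z : ℕ+ → ℝ) (s t : ℝ) : ℝ :=
  tile U P z (partOf s) (partOf t) (relCoord s) (relCoord t)

/-- The `L_1`-distance of two bounding sequences. -/
def l1Dist (U : (ℝ → ℝ → ℝ) → ℝ → ℝ → ℝ) (P P' : BoundingSequence) : ℝ :=
  ⨆ z : cube, ∫ s in Set.Ico (0 : ℝ) 1 ×ˢ Set.Ico (0 : ℝ) 1,
    |WP U P z s.1 s.2 - WP U P' z s.1 s.2|

end GraphonFamily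

end

noncomputable section

namespace GraphonFamily

/-! The unit interval is cut into countably many cells: the dyadic classes of the first two thirds
of `C`, those of `E` further cut by level at the lower bound, the threshold and the upper bound, and
one remaining cell. The index set `ℋ` consists of the configurations `Fin n → Cell`, and the
integral defining `tau` is the sum over configurations of the integrals over the corresponding boxes
(`hasSum_contribution`). It must be shown that each box contributes a polynomial in `z`.

Up to countably many points, `z` enters the values of the graphon only through the tiles `C×C` and
`C×E`, and there only between cells where the value is the constant polynomial 0 or 1, `z^{M_k}` or
`1 - z^{M_k}` (`WP_special`). The tiles `X×Q` are free of `z` because the degrees into `C` and `E`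
are balanced: a row of `C×C` contains `z^{M_k}` and `1 - z^{M_k}` on sets of equal length, and a row
of `C×E` has thresholds `p_k` and `1 - p_k` (`relDeg_CC`, `relDeg_CE`, `relDeg_EC`). All other
factors are therefore evaluated at the reference point `z = 0` (`WP_indep`), which need not be
feasible.

The cells also move with `z`, but only at the threshold in `E`. Feasibility puts the threshold
between the bounds, and within this range no non-special factor sees the level of a point
(`WP_congr_left`). Hence the `z`-free factors have an integral over the box of cells equal to a
product of length ratios, which are polynomials in `z`, times their integral over fixed hulls
(`integral_freeFactor`).

For the bounds, `wnorm` is a submultiplicative norm on polynomials with weight `ρ ^ Σ(A)`. A cell of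
index `k` has length of order `2^{-k}`, while the special factors charged to it have norm at most
`(3ρ^k)^n`; with `ρ^(n+1) = 2` each cell contributes at most `3^n ρ^{-k}`, a summable quantity
independent of the bounding sequence (`wnorm_contribution_le`). The weight in the norm gives the
decay of the coefficients.

Finally, the polynomial part of a contribution involves finitely many elements of the bounding
sequence, and its scalar part, an integral of edge factors, is Lipschitz in the `L_1`-distance
(`abs_freeIntegral_sub_le`). This gives the stability assertion. -/

instance : MeasurableSpace ℕ+ := ⊤

instance : MeasurableSpace GPart := ⊤

instance : DiscreteMeasurableSpace ℕ+ := ⟨fun _ => trivial⟩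

instance : DiscreteMeasurableSpace GPart := ⟨fun _ => trivial⟩

/-! ### The dyadic coordinate -/

theorem coord_eq_iff (x : ℝ) (k : ℕ+) :
    coord x = k ↔ 1 - 2 * ((2 : ℝ) ^ (k : ℕ))⁻¹ ≤ Int.fract x ∧
      Int.fract x < 1 - ((2 : ℝ) ^ (k : ℕ))⁻¹ := by
  have hlt : ∀ i j : ℕ+, i < j → 2 * ((2 : ℝ) ^ (j : ℕ))⁻¹ ≤ ((2 : ℝ) ^ (i : ℕ))⁻¹ := by
    intro i j hij
    have h1 : (i : ℕ) + 1 ≤ j := hij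
    have h2 : (2 : ℝ) ^ ((i : ℕ) + 1) ≤ 2 ^ (j : ℕ) := pow_le_pow_right₀ (by norm_num) h1
    have h3 : ((2 : ℝ) ^ (j : ℕ))⁻¹ ≤ ((2 : ℝ) ^ ((i : ℕ) + 1))⁻¹ :=
      inv_anti₀ (by positivity) h2
    calc 2 * ((2 : ℝ) ^ (j : ℕ))⁻¹ ≤ 2 * ((2 : ℝ) ^ ((i : ℕ) + 1))⁻¹ := by linarith
      _ = _ := by rw [pow_succ]; field_simp
  constructor
  · rintro rfl
    exact coord_spec x
  · rintro ⟨h1, h2⟩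
    obtain ⟨h3, h4⟩ := coord_spec x
    rcases lt_trichotomy (coord x) k with h | h | h
    · have := hlt _ _ h
      linarith
    · exact h
    · have := hlt _ _ h
      linarith

theorem measurable_coord : Measurable coord := by
  refine measurable_to_countable' fun k => ?_
  have : coord ⁻¹' {k} = {x | 1 - 2 * ((2 : ℝ) ^ (k : ℕ))⁻¹ ≤ Int.fract x} ∩
      {x | Int.fract x < 1 - ((2 : ℝ) ^ (k : ℕ))⁻¹} := by
    ext x
    exact coord_eq_iff x k
  rw [this]
  exact (measurableSet_le measurable_const measurable_fract).inter
    (measurableSet_lt measurable_fract measurable_const)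

theorem measurable_partOf : Measurable partOf := by
  unfold partOf
  repeat refine Measurable.ite measurableSet_Iio measurable_const ?_
  exact measurable_const

theorem left_injective : Function.Injective GPart.left := by
  intro X Y h
  have hX := (partOf_iota X 0 ⟨le_rfl, one_pos⟩).1
  have hY := (partOf_iota Y 0 ⟨le_rfl, one_pos⟩).1
  simp only [GPart.iota, mul_zero, add_zero] at hX hY
  rw [← hX, ← hY, h]

instance : Countable GPart := by
  have h2 : ∀ X : GPart, ∃ n : ℕ, X.left = n / 25 := by
    intro X
    cases X with
    | A => exact ⟨0, by norm_num [GPart.left]⟩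
    | B => exact ⟨1, by norm_num [GPart.left]⟩
    | C => exact ⟨2, by norm_num [GPart.left]⟩
    | D k => exact ⟨3 + k, by push_cast; rfl⟩
    | E => exact ⟨10, by norm_num [GPart.left]⟩
    | F => exact ⟨11, by norm_num [GPart.left]⟩
    | Q => exact ⟨12, by norm_num [GPart.left]⟩
    | R => exact ⟨24, by norm_num [GPart.left]⟩
  choose f hf using h2
  refine Function.Injective.countable (f := f) fun X Y hXY => left_injective ?_
  rw [hf, hf, hXY]

theorem measurable_relCoord : Measurable relCoord := by
  unfold relCoord
  exact (measurable_id.sub ((measurable_of_countable GPart.left).comp measurable_partOf)).div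
    ((measurable_of_countable GPart.size).comp measurable_partOf)

theorem relCoord_mem {s : ℝ} (hs : s ∈ Set.Ico (0 : ℝ) 1) :
    relCoord s ∈ Set.Ico (0 : ℝ) 1 ∧ (partOf s).iota (relCoord s) = s := by
  obtain ⟨h0, h1⟩ := hs
  have hsz : 0 < (partOf s).size := by cases partOf s <;> norm_num [GPart.size]
  have h : (partOf s).left ≤ s ∧ s < (partOf s).left + (partOf s).size := by
    unfold partOf
    have key : ∀ {c : Prop} [Decidable c] {X Y : GPart},
        (c → X.left ≤ s ∧ s < X.left + X.size) → (¬ c → Y.left ≤ s ∧ s < Y.left + Y.size) →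
        (ite c X Y).left ≤ s ∧ s < (ite c X Y).left + (ite c X Y).size := by
      intro c _ X Y hX hY
      by_cases hc : c
      · rw [if_pos hc]; exact hX hc
      · rw [if_neg hc]; exact hY hc
    refine key (fun _ => ⟨?_, ?_⟩) fun _ => ?_
    pick_goal 3
    iterate 12
      refine key (fun _ => ⟨?_, ?_⟩) fun _ => ?_
      pick_goal 3
    · norm_num [GPart.left, GPart.size]
      constructor <;> linarith
    all_goals
      norm_num [GPart.left, GPart.size]
      linarith
  refine ⟨⟨div_nonneg (by linarith) hsz.le, ?_⟩, ?_⟩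
  · rw [relCoord, div_lt_one hsz]; linarith
  · rw [relCoord, GPart.iota]; field_simp; ring

/-! ### The graphon `W_F` -/

/-! ### Sums of multisets against their positions, and the decay of coefficients. -/

theorem natPred_add (i : ℕ+) : i.natPred + 1 = (i : ℕ) := PNat.natPred_add_one i

theorem weight_single (n : ℕ+) (e : ℕ) : weight (Finsupp.single n e) = n * e := by
  simp [weight]

theorem weight_add (A B : ℕ+ →₀ ℕ) : weight (A + B) = weight A + weight B := by
  unfold weight
  exact Finsupp.sum_add_index' (by simp) (by intros; ring)

/-- The multisets consisting of `i` ones, for `i` below the sum of `A`, have smaller sum and so all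
precede `A`. -/
theorem weight_le_position (A : ℕ+ →₀ ℕ) : weight A ≤ position A := by
  have hinj : Set.InjOn (fun i : ℕ => Finsupp.single (1 : ℕ+) i) (Set.Iio (weight A)) :=
    fun i _ j _ h => Finsupp.single_injective _ h
  have h1 : ((fun i : ℕ => Finsupp.single (1 : ℕ+) i) '' Set.Iio (weight A)).ncard = weight A := by
    rw [hinj.ncard_image, ← Finset.coe_Iio, Set.ncard_coe_finset, Nat.card_Iio]
  rw [← h1]
  refine Set.ncard_le_ncard ?_ (finite_precedes A)
  rintro _ ⟨i, hi, rfl⟩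
  refine Or.inl ?_
  rw [weight_single]
  simpa using hi

theorem weight_M_lt (i : ℕ+) : weight (M i) < i := by
  have h := weight_le_position (M i)
  rw [position_M] at h
  have := natPred_add i
  omega

/-- The doubly exponential decay of the coefficients beats `2^{2k}` because `2k ≤ 2^k`. It is used
twice: to keep the entries of `WF` at most 1, and to bound the weighted norm of every `p_k`. -/
theorem coeff_bound (k : ℕ) (hk : 1 ≤ k) :
    (2 : ℝ) ^ (2 * k) * ((2 : ℝ) ^ (2 ^ k))⁻¹ ≤ 1 := by
  have h : 2 * k ≤ 2 ^ k := by
    induction k, hk using Nat.le_induction with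
    | base => norm_num
    | succ m hm ih =>
      rw [pow_succ]
      have : 2 ≤ 2 ^ m := by
        calc 2 = 2 ^ 1 := rfl
          _ ≤ 2 ^ m := Nat.pow_le_pow_right (by norm_num) hm
      omega
  rw [← div_eq_mul_inv, div_le_one (by positivity)]
  exact pow_le_pow_right₀ (by norm_num) h

theorem WF_coeff_mem {a : ℝ} (k : ℕ+) (h : |a| ≤ ((2 : ℝ) ^ (2 ^ (k : ℕ)))⁻¹ / 9) :
    9 * 2 ^ (2 * (k : ℕ)) * max a 0 ∈ Set.Icc (0 : ℝ) 1 := by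
  have h1 : max a 0 ≤ ((2 : ℝ) ^ (2 ^ (k : ℕ)))⁻¹ / 9 :=
    max_le ((le_abs_self a).trans h) (by positivity)
  refine ⟨by positivity, ?_⟩
  calc 9 * 2 ^ (2 * (k : ℕ)) * max a 0
      ≤ 9 * 2 ^ (2 * (k : ℕ)) * (((2 : ℝ) ^ (2 ^ (k : ℕ)))⁻¹ / 9) := by gcongr
    _ = (2 : ℝ) ^ (2 * (k : ℕ)) * ((2 : ℝ) ^ (2 ^ (k : ℕ)))⁻¹ := by ring
    _ ≤ 1 := coeff_bound k k.pos

theorem WF_mem (P : BoundingSequence) (x y : ℝ) : WF P x y ∈ Set.Icc (0 : ℝ) 1 := by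
  have hl := P.l_mem
  have hu := P.u_mem
  have hpos : ∀ i j : ℕ+, 9 * 2 ^ (2 * (j : ℕ)) * coeffPos P i j ∈ Set.Icc (0 : ℝ) 1 :=
    fun i j => WF_coeff_mem j (P.coeff_le i j)
  have hneg : ∀ i j : ℕ+, 9 * 2 ^ (2 * (j : ℕ)) * coeffNeg P i j ∈ Set.Icc (0 : ℝ) 1 :=
    fun i j => WF_coeff_mem j (by rw [abs_neg]; exact P.coeff_le i j)
  unfold WF WFstructure
  split_ifs
  all_goals first
    | exact hpos _ _
    | exact hneg _ _
    | exact hl _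
    | exact ⟨sub_nonneg.mpr (hu _).2, sub_le_self _ (hu _).1⟩
    | norm_num

theorem WFstructure_symm (x y : ℝ) : WFstructure x y = WFstructure y x := by
  classical
  unfold WFstructure
  refine if_congr ?_ rfl rfl
  constructor
  · rintro (⟨h1, h2, h3⟩ | h | h)
    · exact Or.inl ⟨h2, h1, h3.symm⟩
    · exact Or.inr (Or.inr h)
    · exact Or.inr (Or.inl h)
  · rintro (⟨h1, h2, h3⟩ | h | h)
    · exact Or.inl ⟨h2, h1, h3.symm⟩
    · exact Or.inr (Or.inr h)
    · exact Or.inr (Or.inl h)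

theorem WF_symm (P : BoundingSequence) (x y : ℝ) : WF P x y = WF P y x := by
  unfold WF
  rw [WFstructure_symm x y]
  have h3 : ∀ a : ℤ, a = 0 ∨ a = 1 ∨ a = 2 ∨ (a ≠ 0 ∧ a ≠ 1 ∧ a ≠ 2) := by
    intro a
    omega
  rcases h3 ⌊3 * x⌋ with h | h | h | ⟨h, h', h''⟩ <;>
    rcases h3 ⌊3 * y⌋ with k | k | k | ⟨k, k', k''⟩ <;> simp [*] <;>
    by_cases hc : coord (3 * x) = coord (3 * y) <;>
      first | (simp [hc]; done) | simp [hc, Ne.symm hc]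

theorem measurable_third : Measurable fun x : ℝ => ⌊3 * x⌋ :=
  Int.measurable_floor.comp (measurable_const.mul measurable_id)

theorem measurable_coord_third : Measurable fun x : ℝ => coord (3 * x) :=
  measurable_coord.comp (measurable_const.mul measurable_id)

/-- A function of the thirds and the dyadic coordinates of two points is measurable. -/
theorem measurable_of_third_coord {β : Type*} [MeasurableSpace β] (f : ℤ → ℤ → ℕ+ → ℕ+ → β) :
    Measurable fun s : ℝ × ℝ => f ⌊3 * s.1⌋ ⌊3 * s.2⌋ (coord (3 * s.1)) (coord (3 * s.2)) := by
  have h : Measurable fun s : ℝ × ℝ =>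
      ((⌊3 * s.1⌋, ⌊3 * s.2⌋), (coord (3 * s.1), coord (3 * s.2))) :=
    ((measurable_third.comp measurable_fst).prodMk (measurable_third.comp measurable_snd)).prodMk
      ((measurable_coord_third.comp measurable_fst).prodMk
        (measurable_coord_third.comp measurable_snd))
  exact (measurable_of_countable
    (fun q : (ℤ × ℤ) × (ℕ+ × ℕ+) => f q.1.1 q.1.2 q.2.1 q.2.2)).comp h

theorem measurableSet_of_third_coord (p : ℤ → ℤ → ℕ+ → ℕ+ → Prop) :
    MeasurableSet {s : ℝ × ℝ | p ⌊3 * s.1⌋ ⌊3 * s.2⌋ (coord (3 * s.1)) (coord (3 * s.2))} :=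
  measurableSet_setOfPred.mpr (measurable_of_third_coord p)

theorem measurable_WFstructure : Measurable (Function.uncurry WFstructure) := by
  unfold WFstructure Function.uncurry
  have h1 : ∀ a b : ℝ, MeasurableSet {s : ℝ × ℝ | s.1 ∈ Set.Ico a b} :=
    fun a b => measurable_fst measurableSet_Ico
  have h2 : ∀ a b : ℝ, MeasurableSet {s : ℝ × ℝ | s.2 ∈ Set.Ico a b} :=
    fun a b => measurable_snd measurableSet_Ico
  refine Measurable.ite ?_ measurable_const measurable_const
  refine MeasurableSet.union ?_ (MeasurableSet.union ?_ ?_)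
  · exact (h1 _ _).inter ((h2 _ _).inter
      (measurableSet_of_third_coord fun _ _ k l => k = l))
  · exact (h1 _ _).inter ((h2 _ _).inter
      (measurableSet_of_third_coord fun _ _ k l => IsMinFactor (M k) (M l)))
  · exact (h2 _ _).inter ((h1 _ _).inter
      (measurableSet_of_third_coord fun _ _ k l => IsMinFactor (M l) (M k)))

theorem measurable_WF (P : BoundingSequence) : Measurable (Function.uncurry (WF P)) := by
  unfold WF Function.uncurry
  refine Measurable.ite (measurableSet_of_third_coord fun a b _ _ => a = 2 ∧ b = 0)
    (measurable_of_third_coord fun _ _ k l => 9 * 2 ^ (2 * (l : ℕ)) * coeffPos P k l) ?_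
  refine Measurable.ite (measurableSet_of_third_coord fun a b _ _ => a = 2 ∧ b = 1)
    (measurable_of_third_coord fun _ _ k l => 9 * 2 ^ (2 * (l : ℕ)) * coeffNeg P k l) ?_
  refine Measurable.ite (measurableSet_of_third_coord fun a b _ _ => a = 0 ∧ b = 2)
    (measurable_of_third_coord fun _ _ k l => 9 * 2 ^ (2 * (k : ℕ)) * coeffPos P l k) ?_
  refine Measurable.ite (measurableSet_of_third_coord fun a b _ _ => a = 1 ∧ b = 2)
    (measurable_of_third_coord fun _ _ k l => 9 * 2 ^ (2 * (k : ℕ)) * coeffNeg P l k) ?_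
  refine Measurable.ite (measurableSet_of_third_coord fun a b _ _ => a = 1 ∧ b = 1)
    (measurable_of_third_coord fun _ _ k l => if k = l then 1 - P.u k else 0) ?_
  exact Measurable.ite (measurableSet_of_third_coord fun a b _ _ => a = 2 ∧ b = 2)
    (measurable_of_third_coord fun _ _ k l => if k = l then P.l k else 0) measurable_WFstructure

theorem isGraphon_WF (P : BoundingSequence) : IsGraphon (WF P) where
  meas := (measurable_WF P).comp
    ((measurable_subtype_coe.comp measurable_fst).prodMk
      (measurable_subtype_coe.comp measurable_snd))
  symm x _ y _ := WF_symm P x y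
  mem x _ y _ := WF_mem P x y

/-! ### Measurability, range and symmetry of `W_P(z)` -/

/-- A symmetric measurable function from the plane to `[0,1]`. -/
structure IsPlaneGraphon (W : ℝ → ℝ → ℝ) : Prop where
  meas : Measurable (Function.uncurry W)
  symm : ∀ x y, W x y = W y x
  mem : ∀ x y, W x y ∈ Set.Icc (0 : ℝ) 1

theorem measurable_tileA : Measurable (Function.uncurry tileA) := by
  unfold tileA Function.uncurry
  exact measurable_of_third_coord fun a b _ _ => if a = b then (1 : ℝ) else 0

theorem measurable_tileB : Measurable (Function.uncurry tileB) := by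
  unfold tileB Function.uncurry
  exact measurable_of_third_coord fun a b k l => if a = b ∧ k = l then (1 : ℝ) else 0

theorem measurable_tileHalf : Measurable (Function.uncurry tileHalf) := by
  unfold tileHalf Function.uncurry
  exact Measurable.ite (measurableSet_le measurable_const (measurable_fst.add measurable_snd))
    measurable_const measurable_const

open Classical in
theorem measurable_tileCC (z : ℕ+ → ℝ) : Measurable (Function.uncurry (tileCC z)) := by
  unfold tileCC Function.uncurry
  exact measurable_of_third_coord fun a b k l =>
    if k = l then
      if (a = 0 ∧ b = 0) ∨ (a = 1 ∧ b = 1) then monomialValue (M k) z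
      else if (a = 0 ∧ b = 1) ∨ (a = 1 ∧ b = 0) then 1 - monomialValue (M k) z
      else 0
    else 0

theorem measurable_tileCD (P : BoundingSequence) (k : Fin 7) :
    Measurable (Function.uncurry (tileCD P k)) := by
  have h1 : ∀ a b : ℝ, MeasurableSet {s : ℝ × ℝ | s.1 ∈ Set.Ico a b} :=
    fun a b => measurable_fst measurableSet_Ico
  have h2 : ∀ a b : ℝ, MeasurableSet {s : ℝ × ℝ | s.2 ∈ Set.Ico a b} :=
    fun a b => measurable_snd measurableSet_Ico
  unfold tileCD Function.uncurry
  refine Measurable.ite (MeasurableSet.const _) (measurable_of_third_coord fun a b k l =>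
    if a = 0 ∧ b = 1 ∧ k = l then (1 : ℝ) else 0) ?_
  refine Measurable.ite (MeasurableSet.const _) (measurable_of_third_coord fun a b k l =>
    if a = 0 ∧ b = 2 ∧ k = l then (1 : ℝ) else 0) ?_
  refine Measurable.ite (MeasurableSet.const _) (Measurable.ite ((h1 _ _).inter (h2 _ _))
    measurable_const measurable_const) ?_
  exact Measurable.ite (MeasurableSet.const _) (Measurable.ite
    (((h1 _ _).inter (h2 _ _)).union ((h1 _ _).inter (h2 _ _))) (measurable_WF P)
    measurable_const) measurable_const

theorem measurable_tileCE (P : BoundingSequence) (z : ℕ+ → ℝ) :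
    Measurable (Function.uncurry (tileCE P z)) := by
  have hp : Measurable fun s : ℝ × ℝ => MvPolynomial.eval z (P.p (coord (3 * s.1))) :=
    measurable_of_third_coord fun _ _ k _ => MvPolynomial.eval z (P.p k)
  have h2 : Measurable fun s : ℝ × ℝ => (2 : ℝ) ^ (coord (3 * s.1) : ℕ) :=
    measurable_of_third_coord fun _ _ k _ => (2 : ℝ) ^ (k : ℕ)
  have hv : ∀ c : ℝ, Measurable fun s : ℝ × ℝ =>
      (2 : ℝ) ^ (coord (3 * s.1) : ℕ) * (3 * s.2 - c) + 2 := fun c =>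
    (h2.mul ((measurable_const.mul measurable_snd).sub measurable_const)).add measurable_const
  have hf : ∀ i j : ℤ, MeasurableSet {s : ℝ × ℝ | ⌊3 * s.1⌋ = i ∧ ⌊3 * s.2⌋ = j} := fun i j =>
    measurableSet_of_third_coord fun a b _ _ => a = i ∧ b = j
  unfold tileCE Function.uncurry
  refine Measurable.ite ?_ measurable_const measurable_const
  simp only [← and_assoc]
  exact (((hf 0 0).inter (measurableSet_le measurable_const (hv 1))).inter
      (measurableSet_le (hv 1) hp)).union
    ((((hf 0 1).inter (measurableSet_le measurable_const (hv 2))).inter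
      (measurableSet_le (hv 2) (measurable_const.sub hp))).union
    ((((hf 1 0).inter (measurableSet_le (hv 1) measurable_const)).inter
      (measurableSet_le hp (hv 1))).union
    (((hf 1 1).inter (measurableSet_le (hv 2) measurable_const)).inter
      (measurableSet_le (measurable_const.sub hp) (hv 2)))))

theorem measurable_tileDGE (P : BoundingSequence) :
    Measurable (Function.uncurry (tileDGE P)) := by
  have h2 : Measurable fun s : ℝ × ℝ => (2 : ℝ) ^ (coord (3 * s.2) : ℕ) :=
    measurable_of_third_coord fun _ _ _ k => (2 : ℝ) ^ (k : ℕ)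
  have hv : Measurable fun s : ℝ × ℝ =>
      (2 : ℝ) ^ (coord (3 * s.2) : ℕ) * (3 * s.2 - 1) + 2 :=
    (h2.mul ((measurable_const.mul measurable_snd).sub measurable_const)).add measurable_const
  have hu : Measurable fun s : ℝ × ℝ => P.u (coord (3 * s.2)) :=
    measurable_of_third_coord fun _ _ _ k => P.u k
  have hl : Measurable fun s : ℝ × ℝ => P.l (coord (3 * s.2)) :=
    measurable_of_third_coord fun _ _ _ k => P.l k
  have hf : ∀ i : ℤ, MeasurableSet {s : ℝ × ℝ | ⌊3 * s.1⌋ = i} := fun i =>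
    measurableSet_of_third_coord fun a _ _ _ => a = i
  unfold tileDGE Function.uncurry
  refine Measurable.ite ?_ measurable_const measurable_const
  exact (measurableSet_of_third_coord fun _ b _ _ => b = 0).inter
    ((measurableSet_of_third_coord fun _ _ k l => k = l).inter
      (((hf 1).inter (measurableSet_le hv hu)).union ((hf 2).inter (measurableSet_le hv hl))))

theorem measurable_upperTile {U : (ℝ → ℝ → ℝ) → ℝ → ℝ → ℝ} {P : BoundingSequence}
    (hU : IsPlaneGraphon (U (WF P))) (z : ℕ+ → ℝ) (X Y : GPart) :
    Measurable (Function.uncurry (upperTile U P z X Y)) := by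
  have h0 : Measurable (Function.uncurry fun _ _ : ℝ => (0 : ℝ)) := measurable_const
  have hD : ∀ j k : Fin 7, Measurable (Function.uncurry fun x y : ℝ =>
      U (WF P) ((((j : ℕ) : ℝ) + x) / 13) ((((k : ℕ) : ℝ) + y) / 13)) := fun j k =>
    hU.meas.comp (((measurable_const.add measurable_fst).div_const _).prodMk
      ((measurable_const.add measurable_snd).div_const _))
  have hDE : ∀ j : Fin 7, Measurable (Function.uncurry fun x y : ℝ =>
      if j = 6 then tileDGE P x y else 0) := fun j =>
    Measurable.ite (MeasurableSet.const _) (measurable_tileDGE P) measurable_const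
  cases X <;> cases Y <;> first
    | exact h0
    | exact measurable_tileHalf
    | exact measurable_tileA
    | exact measurable_tileB
    | exact measurable_tileCC z
    | exact measurable_tileCD P _
    | exact measurable_tileCE P z
    | exact hD _ _
    | exact hDE _

theorem monomialValue_mem (A : ℕ+ →₀ ℕ) {z : ℕ+ → ℝ} (hz : z ∈ cube) :
    monomialValue A z ∈ Set.Icc (0 : ℝ) 1 :=
  ⟨Finset.prod_nonneg fun n _ => pow_nonneg (hz n).1 _,
    Finset.prod_le_one (fun n _ => pow_nonneg (hz n).1 _)
      fun n _ => pow_le_one₀ (hz n).1 (hz n).2⟩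

theorem upperTile_mem {U : (ℝ → ℝ → ℝ) → ℝ → ℝ → ℝ} {P : BoundingSequence}
    (hU : IsPlaneGraphon (U (WF P))) {z : ℕ+ → ℝ} (hz : z ∈ cube) (X Y : GPart) (x y : ℝ) :
    upperTile U P z X Y x y ∈ Set.Icc (0 : ℝ) 1 := by
  have h0 : (0 : ℝ) ∈ Set.Icc (0 : ℝ) 1 := by norm_num
  have h1 : (1 : ℝ) ∈ Set.Icc (0 : ℝ) 1 := by norm_num
  have hite : ∀ {c : Prop} {_ : Decidable c} {a b : ℝ}, a ∈ Set.Icc (0 : ℝ) 1 →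
      b ∈ Set.Icc (0 : ℝ) 1 → (if c then a else b) ∈ Set.Icc (0 : ℝ) 1 := by
    intro c _ a b ha hb
    split_ifs
    · exact ha
    · exact hb
  have hA : tileA x y ∈ Set.Icc (0 : ℝ) 1 := hite h1 h0
  have hB : tileB x y ∈ Set.Icc (0 : ℝ) 1 := hite h1 h0
  have hH : tileHalf x y ∈ Set.Icc (0 : ℝ) 1 := hite h1 h0
  have hCC : tileCC z x y ∈ Set.Icc (0 : ℝ) 1 := by
    have hm := monomialValue_mem (M (coord (3 * x))) hz
    exact hite (hite hm (hite ⟨sub_nonneg.mpr hm.2, sub_le_self _ hm.1⟩ h0)) h0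
  have hCD : ∀ k, tileCD P k x y ∈ Set.Icc (0 : ℝ) 1 := fun k =>
    hite (hite h1 h0) (hite (hite h1 h0) (hite (hite h1 h0)
      (hite (hite (WF_mem P x y) h0) h0)))
  have hCE : tileCE P z x y ∈ Set.Icc (0 : ℝ) 1 := hite h1 h0
  have hDE : ∀ j : Fin 7, (if j = 6 then tileDGE P x y else 0) ∈ Set.Icc (0 : ℝ) 1 :=
    fun j => hite (hite h1 h0) h0
  cases X <;> cases Y <;> first
    | exact h0
    | exact hH
    | exact hA
    | exact hB
    | exact hCC
    | exact hCD _
    | exact hCE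
    | exact hU.mem _ _
    | exact hDE _

theorem measurable_innerTile {U : (ℝ → ℝ → ℝ) → ℝ → ℝ → ℝ} {P : BoundingSequence}
    (hU : IsPlaneGraphon (U (WF P))) (z : ℕ+ → ℝ) (X Y : GPart) :
    Measurable (Function.uncurry (innerTile U P z X Y)) := by
  unfold innerTile
  by_cases h : X.left ≤ Y.left
  · simp only [if_pos h]
    exact measurable_upperTile hU z X Y
  · simp only [if_neg h]
    exact (measurable_upperTile hU z Y X).comp measurable_swap

theorem innerTile_mem {U : (ℝ → ℝ → ℝ) → ℝ → ℝ → ℝ} {P : BoundingSequence}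
    (hU : IsPlaneGraphon (U (WF P))) {z : ℕ+ → ℝ} (hz : z ∈ cube) (X Y : GPart) (x y : ℝ) :
    innerTile U P z X Y x y ∈ Set.Icc (0 : ℝ) 1 := by
  unfold innerTile
  split_ifs
  · exact upperTile_mem hU hz X Y x y
  · exact upperTile_mem hU hz Y X y x

theorem tileCC_symm (z : ℕ+ → ℝ) (x y : ℝ) : tileCC z x y = tileCC z y x := by
  unfold tileCC
  by_cases hc : coord (3 * x) = coord (3 * y)
  · rw [if_pos hc, if_pos hc.symm, hc]
    congr 1
    · simp only [and_comm]
    · simp only [and_comm, or_comm]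
  · rw [if_neg hc, if_neg (Ne.symm hc)]

theorem upperTile_diag_symm {U : (ℝ → ℝ → ℝ) → ℝ → ℝ → ℝ} {P : BoundingSequence}
    (hU : IsPlaneGraphon (U (WF P))) (z : ℕ+ → ℝ) (X : GPart) (x y : ℝ) :
    upperTile U P z X X x y = upperTile U P z X X y x := by
  cases X with
  | A => exact if_congr eq_comm rfl rfl
  | B => exact if_congr (and_congr eq_comm eq_comm) rfl rfl
  | C => exact tileCC_symm z x y
  | D k => exact hU.symm _ _
  | F => exact if_congr (by rw [add_comm]) rfl rfl
  | _ => rfl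

theorem innerTile_symm {U : (ℝ → ℝ → ℝ) → ℝ → ℝ → ℝ} {P : BoundingSequence}
    (hU : IsPlaneGraphon (U (WF P))) (z : ℕ+ → ℝ) (X Y : GPart) (x y : ℝ) :
    innerTile U P z X Y x y = innerTile U P z Y X y x := by
  unfold innerTile
  rcases lt_trichotomy X.left Y.left with h | h | h
  · rw [if_pos h.le, if_neg (not_le.mpr h)]
  · obtain rfl := left_injective h
    rw [if_pos le_rfl, if_pos le_rfl]
    exact upperTile_diag_symm hU z X x y
  · rw [if_pos h.le, if_neg (not_le.mpr h)]

theorem measurable_relDeg {U : (ℝ → ℝ → ℝ) → ℝ → ℝ → ℝ} {P : BoundingSequence}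
    (hU : IsPlaneGraphon (U (WF P))) (z : ℕ+ → ℝ) (X Z : GPart) :
    Measurable (relDeg U P z X Z) :=
  (StronglyMeasurable.integral_prod_right
    (measurable_innerTile hU z X Z).stronglyMeasurable).measurable

theorem setIntegral_unit_mem {f : ℝ → ℝ} (hf : ∀ x, f x ∈ Set.Icc (0 : ℝ) 1) :
    ∫ t in Set.Ico (0 : ℝ) 1, f t ∈ Set.Icc (0 : ℝ) 1 := by
  refine ⟨integral_nonneg fun x => (hf x).1, ?_⟩
  have h := norm_setIntegral_le_of_norm_le_const (μ := volume) (s := Set.Ico (0 : ℝ) 1) (f := f)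
    (C := 1) (by simp) fun x _ => by
      rw [Real.norm_eq_abs, abs_of_nonneg (hf x).1]; exact (hf x).2
  have h2 : volume.real (Set.Ico (0 : ℝ) 1) = 1 := by simp
  rw [h2, mul_one] at h
  exact (Real.le_norm_self _).trans h

theorem relDeg_mem {U : (ℝ → ℝ → ℝ) → ℝ → ℝ → ℝ} {P : BoundingSequence}
    (hU : IsPlaneGraphon (U (WF P))) {z : ℕ+ → ℝ} (hz : z ∈ cube) (X Z : GPart) (x : ℝ) :
    relDeg U P z X Z x ∈ Set.Icc (0 : ℝ) 1 :=
  setIntegral_unit_mem fun t => innerTile_mem hU hz X Z x t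

theorem measurable_tileQ {U : (ℝ → ℝ → ℝ) → ℝ → ℝ → ℝ} {P : BoundingSequence}
    (hU : IsPlaneGraphon (U (WF P))) (z : ℕ+ → ℝ) (X : GPart) :
    Measurable (tileQ U P z X) := by
  have h := measurable_relDeg hU z X
  unfold tileQ
  exact measurable_const.mul (measurable_const.sub ((((((h _).add (h _)).add (h _)).add
    (Finset.measurable_sum _ fun k _ => h _)).add (h _)).add (h _)))

theorem tileQ_mem {U : (ℝ → ℝ → ℝ) → ℝ → ℝ → ℝ} {P : BoundingSequence}
    (hU : IsPlaneGraphon (U (WF P))) {z : ℕ+ → ℝ} (hz : z ∈ cube) (X : GPart) (x : ℝ) :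
    tileQ U P z X x ∈ Set.Icc (0 : ℝ) 1 := by
  have h := fun Z => relDeg_mem hU hz X Z x
  have hs : ∑ k : Fin 7, relDeg U P z X (.D k) x ∈ Set.Icc (0 : ℝ) 7 := by
    refine ⟨Finset.sum_nonneg fun k _ => (h _).1, ?_⟩
    calc ∑ k : Fin 7, relDeg U P z X (.D k) x ≤ ∑ _k : Fin 7, (1 : ℝ) :=
          Finset.sum_le_sum fun k _ => (h _).2
      _ = 7 := by norm_num
  have hA := h .A
  have hB := h .B
  have hC := h .C
  have hE := h .E
  have hF := h .F
  simp only [Set.mem_Icc] at *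
  unfold tileQ
  constructor <;> linarith

theorem tileR_mem (X : GPart) : tileR X ∈ Set.Icc (0 : ℝ) 1 := by
  cases X with
  | D k =>
    have h : ((k : ℕ) : ℝ) ≤ 6 := by exact_mod_cast Nat.lt_succ_iff.mp k.2
    have h0 : (0 : ℝ) ≤ ((k : ℕ) : ℝ) := Nat.cast_nonneg _
    simp only [tileR, GPart.left, Set.mem_Icc]
    constructor <;> linarith
  | _ => norm_num [tileR, GPart.left]

theorem tile_R_right (U : (ℝ → ℝ → ℝ) → ℝ → ℝ → ℝ) (P : BoundingSequence) (z : ℕ+ → ℝ)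
    (X : GPart) : tile U P z X .R = fun _ _ => tileR X := by
  cases X <;> rfl

theorem tile_R_left (U : (ℝ → ℝ → ℝ) → ℝ → ℝ → ℝ) (P : BoundingSequence) (z : ℕ+ → ℝ)
    (Y : GPart) : tile U P z .R Y = fun _ _ => tileR Y := by
  cases Y <;> rfl

/-- The shape of a tile depends on its position only. -/
theorem tile_cases (X Y : GPart) :
    (∃ c ∈ Set.Icc (0 : ℝ) 1, ∀ U P z, tile U P z X Y = fun _ _ => c) ∨
    (Y = .Q ∧ ∀ U P z, tile U P z X Y = fun x _ => tileQ U P z X x) ∨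
    (X = .Q ∧ ∀ U P z, tile U P z X Y = fun _ y => tileQ U P z Y y) ∨
    (∀ U P z, tile U P z X Y = innerTile U P z X Y) := by
  cases Y with
  | R => exact Or.inl ⟨_, tileR_mem X, fun U P z => tile_R_right U P z X⟩
  | Q =>
    cases X with
    | R => exact Or.inl ⟨_, tileR_mem .Q, fun U P z => tile_R_left U P z .Q⟩
    | Q => exact Or.inl ⟨1, ⟨zero_le_one, le_rfl⟩, fun _ _ _ => rfl⟩
    | _ => exact Or.inr (Or.inl ⟨rfl, fun _ _ _ => rfl⟩)
  | _ =>
    cases X with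
    | R => exact Or.inl ⟨_, tileR_mem _, fun U P z => tile_R_left U P z _⟩
    | Q => exact Or.inr (Or.inr (Or.inl ⟨rfl, fun _ _ _ => rfl⟩))
    | _ => exact Or.inr (Or.inr (Or.inr fun _ _ _ => rfl))

theorem measurable_tile {U : (ℝ → ℝ → ℝ) → ℝ → ℝ → ℝ} {P : BoundingSequence}
    (hU : IsPlaneGraphon (U (WF P))) (z : ℕ+ → ℝ) (X Y : GPart) :
    Measurable (Function.uncurry (tile U P z X Y)) := by
  rcases tile_cases X Y with ⟨c, -, h⟩ | ⟨-, h⟩ | ⟨-, h⟩ | h <;> rw [h]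
  · exact measurable_const
  · exact (measurable_tileQ hU z X).comp measurable_fst
  · exact (measurable_tileQ hU z Y).comp measurable_snd
  · exact measurable_innerTile hU z _ _

theorem tile_mem {U : (ℝ → ℝ → ℝ) → ℝ → ℝ → ℝ} {P : BoundingSequence}
    (hU : IsPlaneGraphon (U (WF P))) {z : ℕ+ → ℝ} (hz : z ∈ cube) (X Y : GPart) (x y : ℝ) :
    tile U P z X Y x y ∈ Set.Icc (0 : ℝ) 1 := by
  rcases tile_cases X Y with ⟨c, hc, h⟩ | ⟨-, h⟩ | ⟨-, h⟩ | h <;> rw [h]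
  · exact hc
  · exact tileQ_mem hU hz _ _
  · exact tileQ_mem hU hz _ _
  · exact innerTile_mem hU hz _ _ _ _

theorem tile_symm {U : (ℝ → ℝ → ℝ) → ℝ → ℝ → ℝ} {P : BoundingSequence}
    (hU : IsPlaneGraphon (U (WF P))) (z : ℕ+ → ℝ) (X Y : GPart) (x y : ℝ) :
    tile U P z X Y x y = tile U P z Y X y x := by
  cases X <;> cases Y <;> first
    | rfl
    | exact innerTile_symm hU z _ _ _ _

theorem isPlaneGraphon_WP {U : (ℝ → ℝ → ℝ) → ℝ → ℝ → ℝ} {P : BoundingSequence}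
    (hU : IsPlaneGraphon (U (WF P))) {z : ℕ+ → ℝ} (hz : z ∈ cube) :
    IsPlaneGraphon (WP U P z) where
  meas := by
    have h : Measurable fun q : (GPart × GPart) × (ℝ × ℝ) =>
        tile U P z q.1.1 q.1.2 q.2.1 q.2.2 :=
      measurable_from_prod_countable_right fun q => measurable_tile hU z q.1 q.2
    exact h.comp (((measurable_partOf.comp measurable_fst).prodMk
      (measurable_partOf.comp measurable_snd)).prodMk
      ((measurable_relCoord.comp measurable_fst).prodMk
        (measurable_relCoord.comp measurable_snd)))
  symm s t := tile_symm hU z _ _ _ _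
  mem s t := tile_mem hU hz _ _ _ _

/-! ### Truncating the embedding outside the unit square -/

open Classical in
/-- The embedding `U`, with all graphons set to `0` outside `[0,1)²`. -/
def truncate (U : (ℝ → ℝ → ℝ) → ℝ → ℝ → ℝ) (W : ℝ → ℝ → ℝ) (x y : ℝ) : ℝ :=
  if x ∈ Set.Ico (0 : ℝ) 1 ∧ y ∈ Set.Ico (0 : ℝ) 1 then U W x y else 0

/-- A graphon is controlled on the unit square only; extending by zero along the measurable
embedding of the square gives a function with the same properties on the whole plane, so that no
membership conditions need to be carried along. -/
theorem isPlaneGraphon_truncate {U : (ℝ → ℝ → ℝ) → ℝ → ℝ → ℝ} {W : ℝ → ℝ → ℝ}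
    (h : IsGraphon (U W)) : IsPlaneGraphon (truncate U W) where
  meas := by
    classical
    have hE : MeasurableEmbedding fun s : Set.Ico (0 : ℝ) 1 × Set.Ico (0 : ℝ) 1 =>
        ((s.1 : ℝ), (s.2 : ℝ)) :=
      (MeasurableEmbedding.subtype_coe measurableSet_Ico).prodMap
        (MeasurableEmbedding.subtype_coe measurableSet_Ico)
    have hm := hE.measurable_extend h.meas (measurable_const (a := (0 : ℝ)))
    convert hm using 1
    funext s
    by_cases hs : s.1 ∈ Set.Ico (0 : ℝ) 1 ∧ s.2 ∈ Set.Ico (0 : ℝ) 1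
    · have := hE.injective.extend_apply (fun s : Set.Ico (0 : ℝ) 1 × Set.Ico (0 : ℝ) 1 =>
        U W s.1 s.2) (fun _ => 0) (⟨s.1, hs.1⟩, ⟨s.2, hs.2⟩)
      exact (if_pos hs).trans this.symm
    · refine (if_neg hs).trans (Function.extend_apply' (f := fun s : Set.Ico (0 : ℝ) 1 ×
        Set.Ico (0 : ℝ) 1 => ((s.1 : ℝ), (s.2 : ℝ))) _ (fun _ => (0 : ℝ)) _ ?_).symm
      rintro ⟨a, rfl⟩
      exact hs ⟨a.1.2, a.2.2⟩
  symm x y := by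
    unfold truncate
    by_cases hs : x ∈ Set.Ico (0 : ℝ) 1 ∧ y ∈ Set.Ico (0 : ℝ) 1
    · rw [if_pos hs, if_pos hs.symm]
      exact h.symm x hs.1 y hs.2
    · rw [if_neg hs, if_neg fun h' => hs h'.symm]
  mem x y := by
    unfold truncate
    split_ifs with hs
    · exact h.mem x hs.1 y hs.2
    · norm_num

/-- The rescaled arguments `(k + x) / 13` with `k ≤ 6` stay in the unit square, so the truncation is
invisible to the tiles. -/
theorem innerTile_truncate (U : (ℝ → ℝ → ℝ) → ℝ → ℝ → ℝ) (P : BoundingSequence) (z : ℕ+ → ℝ)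
    (X Y : GPart) {x y : ℝ} (hx : x ∈ Set.Ico (0 : ℝ) 1) (hy : y ∈ Set.Ico (0 : ℝ) 1) :
    innerTile (truncate U) P z X Y x y = innerTile U P z X Y x y := by
  have hk : ∀ (k : Fin 7) {x : ℝ}, x ∈ Set.Ico (0 : ℝ) 1 →
      (((k : ℕ) : ℝ) + x) / 13 ∈ Set.Ico (0 : ℝ) 1 := by
    intro k x hx
    have h : ((k : ℕ) : ℝ) ≤ 6 := by exact_mod_cast Nat.lt_succ_iff.mp k.2
    have h0 : (0 : ℝ) ≤ ((k : ℕ) : ℝ) := Nat.cast_nonneg _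
    obtain ⟨h1, h2⟩ := hx
    constructor <;> linarith
  have hup : ∀ (X Y : GPart) {x y : ℝ}, x ∈ Set.Ico (0 : ℝ) 1 → y ∈ Set.Ico (0 : ℝ) 1 →
      upperTile (truncate U) P z X Y x y = upperTile U P z X Y x y := by
    intro X Y x y hx hy
    cases X <;> cases Y <;> first
      | rfl
      | exact if_pos ⟨hk _ hx, hk _ hy⟩
  unfold innerTile
  rw [hup X Y hx hy, hup Y X hy hx]

theorem tileQ_truncate (U : (ℝ → ℝ → ℝ) → ℝ → ℝ → ℝ) (P : BoundingSequence) (z : ℕ+ → ℝ)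
    (X : GPart) {x : ℝ} (hx : x ∈ Set.Ico (0 : ℝ) 1) :
    tileQ (truncate U) P z X x = tileQ U P z X x := by
  have h : ∀ Z, relDeg (truncate U) P z X Z x = relDeg U P z X Z x := fun Z =>
    setIntegral_congr_fun measurableSet_Ico fun t ht => innerTile_truncate U P z X Z hx ht
  simp only [tileQ, h]

theorem WP_truncate (U : (ℝ → ℝ → ℝ) → ℝ → ℝ → ℝ) (P : BoundingSequence) (z : ℕ+ → ℝ)
    {s t : ℝ} (hs : s ∈ Set.Ico (0 : ℝ) 1) (ht : t ∈ Set.Ico (0 : ℝ) 1) :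
    WP (truncate U) P z s t = WP U P z s t := by
  have hx := (relCoord_mem hs).1
  have hy := (relCoord_mem ht).1
  unfold WP
  rcases tile_cases (partOf s) (partOf t) with ⟨c, -, h⟩ | ⟨-, h⟩ | ⟨-, h⟩ | h <;> rw [h, h]
  · exact tileQ_truncate U P z _ hx
  · exact tileQ_truncate U P z _ hy
  · exact innerTile_truncate U P z _ _ hx hy

theorem tau_truncate {n : ℕ} (H : SimpleGraph (Fin n)) (U : (ℝ → ℝ → ℝ) → ℝ → ℝ → ℝ)
    (P : BoundingSequence) (z : ℕ+ → ℝ) :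
    tau H (WP (truncate U) P z) = tau H (WP U P z) := by
  unfold tau
  refine setIntegral_congr_fun (MeasurableSet.univ_pi fun _ => measurableSet_Ico) fun x hx => ?_
  refine Finset.prod_congr rfl fun e _ => ?_
  rw [WP_truncate U P z (hx e.1 trivial) (hx e.2 trivial)]

theorem l1Dist_truncate (U : (ℝ → ℝ → ℝ) → ℝ → ℝ → ℝ) (P P' : BoundingSequence) :
    l1Dist (truncate U) P P' = l1Dist U P P' := by
  unfold l1Dist
  refine iSup_congr fun z => setIntegral_congr_fun (measurableSet_Ico.prod measurableSet_Ico)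
    fun s hs => ?_
  simp only [WP_truncate U _ z hs.1 hs.2]

/-! ### Levels within the dyadic classes -/

/-- The relative position of `y` within its dyadic class, a number in `[0,1)`. -/
def level (y : ℝ) : ℝ := 2 ^ (coord (3 * y) : ℕ) * (Int.fract (3 * y) - 1) + 2

theorem level_mem (y : ℝ) : level y ∈ Set.Ico (0 : ℝ) 1 := by
  obtain ⟨h1, h2⟩ := coord_spec (3 * y)
  have hp : (0 : ℝ) < 2 ^ (coord (3 * y) : ℕ) := by positivity
  have hm := mul_inv_cancel₀ hp.ne'
  constructor
  · have := mul_le_mul_of_nonneg_left h1 hp.le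
    unfold level
    nlinarith
  · have := mul_lt_mul_of_pos_left h2 hp
    unfold level
    nlinarith

theorem measurable_level : Measurable level := by
  unfold level
  exact (((measurable_of_countable fun k : ℕ+ => (2 : ℝ) ^ (k : ℕ)).comp
    measurable_coord_third).mul ((measurable_fract.comp
      (measurable_const.mul measurable_id)).sub measurable_const)).add measurable_const

/-- The point of level `a` in the `k`-th dyadic class of the third with index `i`. -/
def levelPoint (i : ℤ) (k : ℕ+) (a : ℝ) : ℝ := (i + 1 + (a - 2) / 2 ^ (k : ℕ)) / 3

theorem levelPoint_level (y : ℝ) : levelPoint ⌊3 * y⌋ (coord (3 * y)) (level y) = y := by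
  have hp : (2 : ℝ) ^ (coord (3 * y) : ℕ) ≠ 0 := by positivity
  have h := Int.floor_add_fract (3 * y)
  unfold levelPoint level
  rw [add_sub_cancel_right, mul_div_cancel_left₀ _ hp]
  linarith

/-- With `levelPoint_level`, this makes the triple (third, dyadic class, level) a coordinate system
on the line. -/
theorem levelPoint_spec (i : ℤ) (k : ℕ+) {a : ℝ} (ha : a ∈ Set.Ico (0 : ℝ) 1) :
    ⌊3 * levelPoint i k a⌋ = i ∧ coord (3 * levelPoint i k a) = k ∧
      level (levelPoint i k a) = a := by
  obtain ⟨h0, h1⟩ := ha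
  have hp : (0 : ℝ) < 2 ^ (k : ℕ) := by positivity
  have hp2 : (2 : ℝ) ≤ 2 ^ (k : ℕ) := by
    calc (2 : ℝ) = 2 ^ 1 := by norm_num
      _ ≤ 2 ^ (k : ℕ) := pow_le_pow_right₀ (by norm_num) k.pos
  have hi : 3 * levelPoint i k a = i + (1 + (a - 2) / 2 ^ (k : ℕ)) := by
    unfold levelPoint; ring
  have hlow : -1 ≤ (a - 2) / 2 ^ (k : ℕ) := by
    rw [le_div_iff₀ hp]; linarith
  have hup : (a - 2) / 2 ^ (k : ℕ) < 0 := div_neg_of_neg_of_pos (by linarith) hp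
  have hfl : ⌊3 * levelPoint i k a⌋ = i := by
    rw [Int.floor_eq_iff, hi]
    constructor <;> linarith
  have hfr : Int.fract (3 * levelPoint i k a) = 1 + (a - 2) / 2 ^ (k : ℕ) := by
    rw [← Int.self_sub_floor, hfl, hi]; ring
  have hc : coord (3 * levelPoint i k a) = k := by
    rw [coord_eq_iff, hfr, div_eq_mul_inv]
    have hinv : (0 : ℝ) < ((2 : ℝ) ^ (k : ℕ))⁻¹ := by positivity
    constructor <;> nlinarith
  refine ⟨hfl, hc, ?_⟩
  rw [level, hc, hfr]
  field_simp
  ring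

/-- The points of the third with index `i` in the `k`-th dyadic class with level
in `[a, b)`. -/
def levelSet (i : ℤ) (k : ℕ+) (a b : ℝ) : Set ℝ :=
  {y | ⌊3 * y⌋ = i ∧ coord (3 * y) = k ∧ a ≤ level y ∧ level y < b}

theorem levelPoint_lt_iff (i : ℤ) (k : ℕ+) (a b : ℝ) :
    levelPoint i k a < levelPoint i k b ↔ a < b := by
  have hp : (0 : ℝ) < 2 ^ (k : ℕ) := by positivity
  unfold levelPoint
  rw [div_lt_div_iff_of_pos_right (by norm_num), add_lt_add_iff_left,
    div_lt_div_iff_of_pos_right hp, sub_lt_sub_iff_right]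

theorem levelPoint_le_iff (i : ℤ) (k : ℕ+) (a b : ℝ) :
    levelPoint i k a ≤ levelPoint i k b ↔ a ≤ b := by
  rw [← not_lt, levelPoint_lt_iff, not_lt]

/-- For fixed third and class, `levelPoint` is increasing and affine in the level. The lengths of
all cells are read off from this. -/
theorem levelSet_eq_Ico (i : ℤ) (k : ℕ+) {a b : ℝ} (ha : 0 ≤ a) (hb : b ≤ 1) :
    levelSet i k a b = Set.Ico (levelPoint i k a) (levelPoint i k b) := by
  have hp : (2 : ℝ) ^ (k : ℕ) ≠ 0 := by positivity
  ext y
  constructor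
  · rintro ⟨rfl, rfl, h1, h2⟩
    have hy := levelPoint_level y
    have h3 := (levelPoint_le_iff ⌊3 * y⌋ (coord (3 * y)) _ _).mpr h1
    have h4 := (levelPoint_lt_iff ⌊3 * y⌋ (coord (3 * y)) _ _).mpr h2
    rw [hy] at h3 h4
    exact ⟨h3, h4⟩
  · rintro ⟨h1, h2⟩
    obtain ⟨c, rfl⟩ : ∃ c, y = levelPoint i k c := by
      refine ⟨2 ^ (k : ℕ) * (3 * y - i - 1) + 2, ?_⟩
      unfold levelPoint
      field_simp
      ring
    rw [levelPoint_le_iff] at h1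
    rw [levelPoint_lt_iff] at h2
    obtain ⟨h3, h4, h5⟩ := levelPoint_spec i k ⟨ha.trans h1, h2.trans_le hb⟩
    exact ⟨h3, h4, h5.symm ▸ h1, h5.symm ▸ h2⟩

theorem levelSet_subset {i : ℤ} (hi : i = 0 ∨ i = 1) (k : ℕ+) (a b : ℝ) :
    levelSet i k a b ⊆ Set.Ico (0 : ℝ) 1 := by
  rintro y ⟨h, -⟩
  rw [Int.floor_eq_iff] at h
  rcases hi with rfl | rfl <;> norm_num at h <;> constructor <;> linarith

theorem measurableSet_levelSet (i : ℤ) (k : ℕ+) (a b : ℝ) : MeasurableSet (levelSet i k a b) :=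
  (measurable_third (measurableSet_singleton i)).inter
    ((measurable_coord_third (measurableSet_singleton k)).inter
      ((measurableSet_le measurable_const measurable_level).inter
        (measurableSet_lt measurable_level measurable_const)))

theorem volume_levelSet (i : ℤ) (k : ℕ+) {a b : ℝ} (ha : 0 ≤ a) (hab : a ≤ b) (hb : b ≤ 1) :
    volume.real (levelSet i k a b) = (b - a) / (3 * 2 ^ (k : ℕ)) := by
  rw [levelSet_eq_Ico i k ha hb, Real.volume_real_Ico_of_le ((levelPoint_le_iff _ _ _ _).mpr hab)]
  unfold levelPoint
  field_simp
  ring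

/-- The index of a third, as an integer. -/
def third (b : Bool) : ℤ := if b then 1 else 0

theorem third_cases (b : Bool) : third b = 0 ∨ third b = 1 := by
  cases b <;> simp [third]

theorem third_inj {a b : Bool} : third a = third b ↔ a = b := by
  cases a <;> cases b <;> simp [third]

theorem eq_zero_or_one_iff (i : ℤ) : (i = 0 ∨ i = 1) ↔ ∃ b, i = third b := by
  simp [third]

/-! ### The tile `C×E` -/

/-- The polynomial giving the threshold for the level in `E`: `p_k` in the first third and
`1 - p_k` in the second third. -/
def threshold (P : BoundingSequence) (θ : Bool) (k : ℕ+) : MvPolynomial ℕ+ ℝ :=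
  if θ then 1 - P.p k else P.p k

theorem threshold_mem (P : BoundingSequence) (θ : Bool) (k : ℕ+) {z : ℕ+ → ℝ} (hz : z ∈ cube) :
    MvPolynomial.eval z (threshold P θ k) ∈ Set.Icc (0 : ℝ) 1 := by
  obtain ⟨h0, h1⟩ := P.p_mem k z hz
  cases θ
  · exact ⟨h0, h1⟩
  · simp only [threshold, if_true, map_sub, map_one]
    constructor <;> linarith

/-- No threshold is attained at `y`. -/
structure Generic (P : BoundingSequence) (z : ℕ+ → ℝ) (y : ℝ) : Prop where
  ne_zero : level y ≠ 0
  ne_threshold : ∀ θ, level y ≠ MvPolynomial.eval z (threshold P θ (coord (3 * y)))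
  ne_l : level y ≠ P.l (coord (3 * y))
  ne_u : level y ≠ P.u (coord (3 * y))

/-- Each of the countably many dyadic classes has at most five exceptional levels. -/
theorem countable_not_generic (P : BoundingSequence) (z : ℕ+ → ℝ) :
    {y | ¬ Generic P z y}.Countable := by
  have h : {y | ¬ Generic P z y} ⊆ ⋃ i : ℤ, ⋃ k : ℕ+,
      levelPoint i k '' {0, MvPolynomial.eval z (threshold P false k),
        MvPolynomial.eval z (threshold P true k), P.l k, P.u k} := by
    intro y hy
    simp only [Set.mem_iUnion]
    refine ⟨⌊3 * y⌋, coord (3 * y), level y, ?_, levelPoint_level y⟩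
    by_contra hcon
    simp only [Set.mem_insert_iff, Set.mem_singleton_iff, not_or] at hcon
    obtain ⟨h0, h1, h2, h3, h4⟩ := hcon
    exact hy ⟨h0, fun θ => by cases θ <;> assumption, h3, h4⟩
  refine Set.Countable.mono h ?_
  exact Set.countable_iUnion fun i => Set.countable_iUnion fun k =>
    (Set.Finite.countable (by simp)).image _

/-- The class of a point in the `k`-th class whose level is strictly inside. -/
theorem coord_eq_of_level {y : ℝ} {k : ℕ+} {i : ℤ} (hy : level y ≠ 0)
    (h0 : 0 ≤ (2 : ℝ) ^ (k : ℕ) * (3 * y - (i + 1)) + 2)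
    (h1 : (2 : ℝ) ^ (k : ℕ) * (3 * y - (i + 1)) + 2 ≤ 1) : coord (3 * y) = k := by
  set a := (2 : ℝ) ^ (k : ℕ) * (3 * y - (i + 1)) + 2 with ha
  have hp : (2 : ℝ) ^ (k : ℕ) ≠ 0 := by positivity
  have hya : y = levelPoint i k a := by
    rw [ha]
    unfold levelPoint
    field_simp
    ring
  rcases h1.lt_or_eq with h | h
  · rw [hya]
    exact (levelPoint_spec i k ⟨h0, h⟩).2.1
  · exfalso
    -- Level 1 of class `k` is level 0 of class `k + 1`. This coincidence is why generic points must
    -- have nonzero level.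
    have hya' : y = levelPoint i (k + 1) 0 := by
      rw [hya, h]
      unfold levelPoint
      rw [PNat.add_coe, PNat.one_coe, pow_succ]
      field_simp
      ring
    exact hy (hya' ▸ (levelPoint_spec i (k + 1) ⟨le_rfl, one_pos⟩).2.2)

theorem level_eq {y : ℝ} {i : ℤ} (hi : ⌊3 * y⌋ = i) :
    (2 : ℝ) ^ (coord (3 * y) : ℕ) * (3 * y - (i + 1)) + 2 = level y := by
  rw [level, ← Int.self_sub_floor, hi]
  ring

open Classical in
-- The definition of the tile uses only the class of `x`. Its inequalities confine the rescaled
-- variable to `[0,1]`, which forces `y` into the same class when its level is nonzero; the rescaled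
-- variable is then the level of `y`.
theorem tileCE_eq (P : BoundingSequence) {z : ℕ+ → ℝ} (hz : z ∈ cube) {x y : ℝ} {b θ : Bool}
    (hx : ⌊3 * x⌋ = third b) (hy : ⌊3 * y⌋ = third θ) (hl : level y ≠ 0) :
    tileCE P z x y = if coord (3 * x) = coord (3 * y) ∧
      ((b = false ∧ level y ≤ MvPolynomial.eval z (threshold P θ (coord (3 * y)))) ∨
        (b = true ∧ MvPolynomial.eval z (threshold P θ (coord (3 * y))) ≤ level y))
      then 1 else 0 := by
  have hlev := level_mem y
  have hpz := P.p_mem (coord (3 * x)) z hz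
  unfold tileCE
  refine if_congr ?_ rfl rfl
  by_cases hc : coord (3 * x) = coord (3 * y)
  · rw [hc]
    have hl0 : θ = false → (2 : ℝ) ^ (coord (3 * y) : ℕ) * (3 * y - 1) + 2 = level y := by
      rintro rfl
      rw [← level_eq hy]
      norm_num [third]
    have hl1 : θ = true → (2 : ℝ) ^ (coord (3 * y) : ℕ) * (3 * y - 2) + 2 = level y := by
      rintro rfl
      rw [← level_eq hy]
      norm_num [third]
    rw [hx, hy]
    cases b <;> cases θ <;> simp [third, threshold, hl0, hl1, hlev.1, hlev.2.le]
  · constructor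
    · intro h
      exfalso
      have key : ∀ i : ℤ, 0 ≤ (2 : ℝ) ^ (coord (3 * x) : ℕ) * (3 * y - (i + 1)) + 2 →
          (2 : ℝ) ^ (coord (3 * x) : ℕ) * (3 * y - (i + 1)) + 2 ≤ 1 → False :=
        fun i h0 h1 => hc (coord_eq_of_level hl h0 h1).symm
      have key0 := key 0
      have key1 := key 1
      norm_num at key0 key1
      obtain ⟨hp0, hp1⟩ := hpz
      rcases h with ⟨-, -, h0, h1⟩ | ⟨-, -, h0, h1⟩ | ⟨-, -, h1, h0⟩ | ⟨-, -, h1, h0⟩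
      · linarith [key0 h0]
      · linarith [key1 h0]
      · linarith [key0 (by linarith)]
      · linarith [key1 (by linarith)]
    · exact fun h => absurd h.1 hc

theorem tileCE_eq_zero_left (P : BoundingSequence) (z : ℕ+ → ℝ) {x : ℝ} (y : ℝ)
    (hx : ¬ ∃ b, ⌊3 * x⌋ = third b) : tileCE P z x y = 0 := by
  rw [← eq_zero_or_one_iff, not_or] at hx
  unfold tileCE
  simp [hx.1, hx.2]

theorem tileCE_eq_zero_right (P : BoundingSequence) (z : ℕ+ → ℝ) (x : ℝ) {y : ℝ}
    (hy : ¬ ∃ b, ⌊3 * y⌋ = third b) : tileCE P z x y = 0 := by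
  rw [← eq_zero_or_one_iff, not_or] at hy
  unfold tileCE
  simp [hy.1, hy.2]

/-! ### The relative degrees do not depend on `z` -/

theorem integral_two_indicators {A B : Set ℝ} (hA : MeasurableSet A) (hB : MeasurableSet B)
    (hA1 : A ⊆ Set.Ico (0 : ℝ) 1) (hB1 : B ⊆ Set.Ico (0 : ℝ) 1) (a b : ℝ) :
    ∫ t in Set.Ico (0 : ℝ) 1, (A.indicator (fun _ => a) t + B.indicator (fun _ => b) t) =
      a * volume.real A + b * volume.real B := by
  have key : ∀ {A : Set ℝ} (a : ℝ), MeasurableSet A →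
      IntegrableOn (A.indicator fun _ => a) (Set.Ico (0 : ℝ) 1) := fun a hA =>
    (integrable_const a).indicator hA
  have key2 : ∀ {A : Set ℝ} (a : ℝ), MeasurableSet A → A ⊆ Set.Ico (0 : ℝ) 1 →
      ∫ t in Set.Ico (0 : ℝ) 1, A.indicator (fun _ => a) t = a * volume.real A := by
    intro A a hA hA1
    rw [setIntegral_indicator hA, Set.inter_eq_right.mpr hA1, setIntegral_const, smul_eq_mul,
      mul_comm]
  rw [integral_add (key a hA) (key b hB), key2 a hA hA1, key2 b hB hB1]

theorem mem_levelSet_unit (i : ℤ) (k : ℕ+) (t : ℝ) :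
    t ∈ levelSet i k 0 1 ↔ ⌊3 * t⌋ = i ∧ coord (3 * t) = k :=
  ⟨fun h => ⟨h.1, h.2.1⟩, fun h => ⟨h.1, h.2, (level_mem t).1, (level_mem t).2⟩⟩

/-- A row takes the values `m` and `1 - m` on the two copies of its class, which have equal length,
so `m` cancels. -/
theorem relDeg_CC (U : (ℝ → ℝ → ℝ) → ℝ → ℝ → ℝ) (P : BoundingSequence) (z : ℕ+ → ℝ) {x : ℝ} :
    relDeg U P z .C .C x =
      if ⌊3 * x⌋ = 0 ∨ ⌊3 * x⌋ = 1 then 1 / (3 * 2 ^ (coord (3 * x) : ℕ)) else 0 := by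
  classical
  set k := coord (3 * x) with hk
  have hint : ∀ a b : ℝ, ∫ t in Set.Ico (0 : ℝ) 1, ((levelSet 0 k 0 1).indicator (fun _ => a) t +
      (levelSet 1 k 0 1).indicator (fun _ => b) t) = (a + b) / (3 * 2 ^ (k : ℕ)) := by
    intro a b
    rw [integral_two_indicators (measurableSet_levelSet _ _ _ _) (measurableSet_levelSet _ _ _ _)
      (levelSet_subset (Or.inl rfl) _ _ _) (levelSet_subset (Or.inr rfl) _ _ _),
      volume_levelSet _ _ le_rfl zero_le_one le_rfl, volume_levelSet _ _ le_rfl zero_le_one le_rfl]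
    ring
  have hfun : ∀ t, innerTile U P z .C .C x t = tileCC z x t := fun t => if_pos le_rfl
  unfold relDeg
  simp only [hfun]
  set m := monomialValue (M k) z with hm
  by_cases h0 : ⌊3 * x⌋ = 0
  · rw [if_pos (Or.inl h0)]
    have := hint m (1 - m)
    rw [show m + (1 - m) = 1 by ring] at this
    rw [← this]
    refine integral_congr_ae (Filter.Eventually.of_forall fun t => ?_)
    simp only [Set.indicator_apply, mem_levelSet_unit, tileCC, h0, ← hk, ← hm]
    by_cases hc : coord (3 * t) = k
    · rcases eq_or_ne ⌊3 * t⌋ 0 with h | h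
      · simp [hc, h]
      · by_cases h' : ⌊3 * t⌋ = 1 <;> simp [hc, h, h']
    · simp [hc, Ne.symm hc]
  · by_cases h1 : ⌊3 * x⌋ = 1
    · rw [if_pos (Or.inr h1)]
      have := hint (1 - m) m
      rw [show (1 - m) + m = 1 by ring] at this
      rw [← this]
      refine integral_congr_ae (Filter.Eventually.of_forall fun t => ?_)
      simp only [Set.indicator_apply, mem_levelSet_unit, tileCC, h1, ← hk, ← hm]
      by_cases hc : coord (3 * t) = k
      · rcases eq_or_ne ⌊3 * t⌋ 0 with h | h
        · simp [hc, h]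
        · by_cases h' : ⌊3 * t⌋ = 1 <;> simp [hc, h, h']
      · simp [hc, Ne.symm hc]
    · simp [tileCC, h0, h1]

/-- A point in the first two thirds of `E` is joined to exactly one of the two copies of its class
in `C`, decided by the side of the threshold on which it lies; both copies have the same length. At
the threshold itself it would be joined to both, hence the genericity. -/
theorem relDeg_EC (U : (ℝ → ℝ → ℝ) → ℝ → ℝ → ℝ) (P : BoundingSequence) {z : ℕ+ → ℝ}
    (hz : z ∈ cube) {y : ℝ} (hy : Generic P z y) :
    relDeg U P z .E .C y =
      if ⌊3 * y⌋ = 0 ∨ ⌊3 * y⌋ = 1 then 1 / (3 * 2 ^ (coord (3 * y) : ℕ)) else 0 := by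
  classical
  have hfun : ∀ t, innerTile U P z .E .C y t = tileCE P z t y := fun t =>
    if_neg (by norm_num [GPart.left])
  unfold relDeg
  simp only [hfun]
  by_cases h : ⌊3 * y⌋ = 0 ∨ ⌊3 * y⌋ = 1
  · rw [if_pos h]
    obtain ⟨θ, hθ⟩ := (eq_zero_or_one_iff _).mp h
    set k := coord (3 * y) with hk
    set c := MvPolynomial.eval z (threshold P θ k) with hc
    have hne : level y ≠ c := hy.ne_threshold θ
    set b : Bool := decide (c < level y) with hb
    -- The boolean `b` records the copy that is seen. The empty second summand only brings the
    -- function into the form required by `integral_two_indicators`.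
    have hval : ∀ t, tileCE P z t y = (levelSet (third b) k 0 1).indicator (fun _ => 1) t +
        (∅ : Set ℝ).indicator (fun _ => 1) t := by
      intro t
      by_cases ht : ∃ b', ⌊3 * t⌋ = third b'
      · obtain ⟨b', hb'⟩ := ht
        rw [tileCE_eq P hz hb' hθ hy.ne_zero]
        simp only [Set.indicator_apply, mem_levelSet_unit, hb', ← hk, ← hc]
        rcases lt_or_gt_of_ne hne with hlt | hlt
        · have hb2 : b = false := by simp [hb, hlt.le]
          cases b' <;> simp [hb2, hlt.le, hlt.not_ge, third]
        · have hb2 : b = true := by simp [hb, hlt]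
          cases b' <;> simp [hb2, hlt.le, hlt.not_ge, third]
      · rw [tileCE_eq_zero_left P z y ht]
        have : ¬ ⌊3 * t⌋ = third b := fun h => ht ⟨b, h⟩
        simp [mem_levelSet_unit, this]
    simp only [hval]
    rw [integral_two_indicators (measurableSet_levelSet _ _ _ _) MeasurableSet.empty
      (levelSet_subset (third_cases b) _ _ _) (Set.empty_subset _),
      volume_levelSet _ _ le_rfl zero_le_one le_rfl]
    simp
  · rw [if_neg h]
    rw [eq_zero_or_one_iff] at h
    simp [tileCE_eq_zero_right P z _ h]

/-- The thresholds in the two thirds of `E` are `p` and `1 - p`. The lengths below them, and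
likewise those above them, add up to that of one full class, whatever `p` is. -/
theorem relDeg_CE (U : (ℝ → ℝ → ℝ) → ℝ → ℝ → ℝ) (P : BoundingSequence) {z : ℕ+ → ℝ}
    (hz : z ∈ cube) (x : ℝ) :
    relDeg U P z .C .E x =
      if ⌊3 * x⌋ = 0 ∨ ⌊3 * x⌋ = 1 then 1 / (3 * 2 ^ (coord (3 * x) : ℕ)) else 0 := by
  classical
  have hfun : ∀ t, innerTile U P z .C .E x t = tileCE P z x t := fun t =>
    if_pos (by norm_num [GPart.left])
  unfold relDeg
  simp only [hfun]
  by_cases h : ⌊3 * x⌋ = 0 ∨ ⌊3 * x⌋ = 1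
  · rw [if_pos h]
    obtain ⟨b, hb⟩ := (eq_zero_or_one_iff _).mp h
    set k := coord (3 * x) with hk
    set c : Bool → ℝ := fun θ => MvPolynomial.eval z (threshold P θ k) with hc
    have hcm : ∀ θ, c θ ∈ Set.Icc (0 : ℝ) 1 := fun θ => threshold_mem P θ k hz
    have hc1 : c true = 1 - c false := by simp [hc, threshold]
    set lo : Bool → ℝ := fun θ => if b then c θ else 0 with hlo
    set hi : Bool → ℝ := fun θ => if b then 1 else c θ with hhi
    have hlo0 : ∀ θ, 0 ≤ lo θ := fun θ => by
      simp only [hlo]; split_ifs <;> simp [(hcm θ).1]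
    have hhi1 : ∀ θ, hi θ ≤ 1 := fun θ => by
      simp only [hhi]; split_ifs <;> simp [(hcm θ).2]
    have hlohi : ∀ θ, lo θ ≤ hi θ := fun θ => by
      simp only [hlo, hhi]; split_ifs <;> simp [(hcm θ).1, (hcm θ).2]
    have hval : ∀ᵐ t ∂volume.restrict (Set.Ico (0 : ℝ) 1), tileCE P z x t =
        (levelSet (third false) k (lo false) (hi false)).indicator (fun _ => 1) t +
        (levelSet (third true) k (lo true) (hi true)).indicator (fun _ => 1) t := by
      have hnull := (countable_not_generic P z).ae_notMem (volume.restrict (Set.Ico (0 : ℝ) 1))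
      filter_upwards [hnull] with t ht
      have ht : Generic P z t := not_not.mp ht
      by_cases hθ : ∃ θ, ⌊3 * t⌋ = third θ
      · obtain ⟨θ, hθ⟩ := hθ
        rw [tileCE_eq P hz hb hθ ht.ne_zero]
        have hlev := level_mem t
        by_cases hkt : coord (3 * t) = k
        · have hne := ht.ne_threshold θ
          rw [hkt] at hne
          have hne : level t ≠ c θ := hne
          have hle : level t ≤ c θ ↔ level t < c θ := ⟨fun h => lt_of_le_of_ne h hne, le_of_lt⟩
          have hval : MvPolynomial.eval z (threshold P θ (coord (3 * t))) = c θ := by rw [hkt]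
          simp only [hval, hle]
          cases θ <;> cases b <;>
            simp [Set.indicator_apply, levelSet, hθ, hkt, third_inj, hlo, hhi, hlev.1, hlev.2, ← hk]
        · simp [levelSet, hkt, ← hk, Ne.symm hkt]
      · rw [tileCE_eq_zero_right P z x hθ]
        push Not at hθ
        simp [levelSet, hθ]
    rw [integral_congr_ae hval, integral_two_indicators (measurableSet_levelSet _ _ _ _)
      (measurableSet_levelSet _ _ _ _) (levelSet_subset (third_cases _) _ _ _)
      (levelSet_subset (third_cases _) _ _ _),
      volume_levelSet _ _ (hlo0 _) (hlohi _) (hhi1 _),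
      volume_levelSet _ _ (hlo0 _) (hlohi _) (hhi1 _)]
    have hsum : (hi false - lo false) + (hi true - lo true) = 1 := by
      simp only [hlo, hhi, hc1]
      split_ifs <;> ring
    rw [one_mul, one_mul, ← add_div, hsum]
  · rw [if_neg h]
    rw [eq_zero_or_one_iff] at h
    simp [tileCE_eq_zero_left P z _ h]

/-! ### Dependence of `W_P(z)` on `z` -/

/-- Only the degrees `C` to `C`, `C` to `E` and `E` to `C` involve `z`, and these have closed forms
without it. Consequently the balancing tiles `X×Q` carry no dependence on `z`. -/
theorem relDeg_indep (U : (ℝ → ℝ → ℝ) → ℝ → ℝ → ℝ) (P : BoundingSequence) {z z' : ℕ+ → ℝ}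
    (hz : z ∈ cube) (hz' : z' ∈ cube) (X Z : GPart) {x : ℝ}
    (hx : X = .E → Generic P z x ∧ Generic P z' x) :
    relDeg U P z X Z x = relDeg U P z' X Z x := by
  cases X with
  | C =>
    cases Z with
    | C => rw [relDeg_CC, relDeg_CC]
    | E => rw [relDeg_CE U P hz, relDeg_CE U P hz']
    | _ => rfl
  | E =>
    cases Z with
    | C => rw [relDeg_EC U P hz (hx rfl).1, relDeg_EC U P hz' (hx rfl).2]
    | _ => rfl
  | _ => cases Z <;> rfl

theorem tileQ_indep (U : (ℝ → ℝ → ℝ) → ℝ → ℝ → ℝ) (P : BoundingSequence) {z z' : ℕ+ → ℝ}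
    (hz : z ∈ cube) (hz' : z' ∈ cube) (X : GPart) {x : ℝ}
    (hx : X = .E → Generic P z x ∧ Generic P z' x) :
    tileQ U P z X x = tileQ U P z' X x := by
  simp only [tileQ, fun Z => relDeg_indep U P hz hz' X Z hx]

/-- The pairs of points at which the value of `W_P(z)` encodes the values `z^{M_k}` or
`p_k(z)`. -/
def SpecialAt (X Y : GPart) (x y : ℝ) : Prop :=
  ((X = .C ∧ (Y = .C ∨ Y = .E)) ∨ (X = .E ∧ Y = .C)) ∧
    (∃ b, ⌊3 * x⌋ = third b) ∧ ∃ b, ⌊3 * y⌋ = third b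

theorem SpecialAt.symm {X Y : GPart} {x y : ℝ} (h : SpecialAt X Y x y) : SpecialAt Y X y x := by
  obtain ⟨h, hx, hy⟩ := h
  refine ⟨?_, hy, hx⟩
  rcases h with ⟨rfl, rfl | rfl⟩ | ⟨rfl, rfl⟩
  · exact Or.inl ⟨rfl, Or.inl rfl⟩
  · exact Or.inr ⟨rfl, rfl⟩
  · exact Or.inl ⟨rfl, Or.inr rfl⟩

theorem tileCC_eq_zero (z : ℕ+ → ℝ) {x y : ℝ}
    (h : ¬ ((∃ b, ⌊3 * x⌋ = third b) ∧ ∃ b, ⌊3 * y⌋ = third b)) : tileCC z x y = 0 := by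
  rw [← eq_zero_or_one_iff, ← eq_zero_or_one_iff] at h
  unfold tileCC
  rw [if_neg (c := _ ∨ _) (by tauto), if_neg (c := _ ∨ _) (by tauto)]
  simp

theorem tileCE_eq_zero (P : BoundingSequence) (z : ℕ+ → ℝ) {x y : ℝ}
    (h : ¬ ((∃ b, ⌊3 * x⌋ = third b) ∧ ∃ b, ⌊3 * y⌋ = third b)) : tileCE P z x y = 0 := by
  rw [not_and_or] at h
  rcases h with h | h
  · exact tileCE_eq_zero_left P z y h
  · exact tileCE_eq_zero_right P z x h

theorem upperTile_indep (U : (ℝ → ℝ → ℝ) → ℝ → ℝ → ℝ) (P : BoundingSequence) (z z' : ℕ+ → ℝ)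
    {X Y : GPart} {x y : ℝ} (h : ¬ SpecialAt X Y x y) :
    upperTile U P z X Y x y = upperTile U P z' X Y x y := by
  cases X with
  | C =>
    cases Y with
    | C =>
      have h' : ¬ ((∃ b, ⌊3 * x⌋ = third b) ∧ ∃ b, ⌊3 * y⌋ = third b) :=
        fun h' => h ⟨Or.inl ⟨rfl, Or.inl rfl⟩, h'⟩
      exact (tileCC_eq_zero z h').trans (tileCC_eq_zero z' h').symm
    | E =>
      have h' : ¬ ((∃ b, ⌊3 * x⌋ = third b) ∧ ∃ b, ⌊3 * y⌋ = third b) :=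
        fun h' => h ⟨Or.inl ⟨rfl, Or.inr rfl⟩, h'⟩
      exact (tileCE_eq_zero P z h').trans (tileCE_eq_zero P z' h').symm
    | _ => rfl
  | _ => cases Y <;> rfl

/-- Outside the special pairs, the values of `W_P(z)` do not depend on `z`. -/
theorem WP_indep (U : (ℝ → ℝ → ℝ) → ℝ → ℝ → ℝ) (P : BoundingSequence) {z z' : ℕ+ → ℝ}
    (hz : z ∈ cube) (hz' : z' ∈ cube) {s t : ℝ}
    (hs : Generic P z (relCoord s) ∧ Generic P z' (relCoord s))
    (ht : Generic P z (relCoord t) ∧ Generic P z' (relCoord t))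
    (h : ¬ SpecialAt (partOf s) (partOf t) (relCoord s) (relCoord t)) :
    WP U P z s t = WP U P z' s t := by
  unfold WP
  rcases tile_cases (partOf s) (partOf t) with ⟨c, -, h'⟩ | ⟨-, h'⟩ | ⟨-, h'⟩ | h' <;> rw [h', h']
  · exact tileQ_indep U P hz hz' _ fun _ => hs
  · exact tileQ_indep U P hz hz' _ fun _ => ht
  · unfold innerTile
    rw [upperTile_indep U P z z' h, upperTile_indep U P z z' fun h' => h h'.symm]

/-- The points `y` and `y'` of `[0,1)` lie in the same part of the same dyadic class, strictly
between the bounds `l_k` and `u_k` in the first third. -/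
structure SameClass (P : BoundingSequence) (y y' : ℝ) : Prop where
  floor_eq : ⌊3 * y⌋ = ⌊3 * y'⌋
  coord_eq : coord (3 * y) = coord (3 * y')
  level_mem : ⌊3 * y⌋ = 0 → level y ∈ Set.Ioo (P.l (coord (3 * y))) (P.u (coord (3 * y)))
  level_mem' : ⌊3 * y⌋ = 0 → level y' ∈ Set.Ioo (P.l (coord (3 * y))) (P.u (coord (3 * y)))

/-- In the first third the level is compared only with `l_k` and `u_k`, and both points lie strictly
between them; elsewhere the tile vanishes. -/
theorem tileDGE_congr {P : BoundingSequence} {y y' : ℝ} (h : SameClass P y y') (x : ℝ) :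
    tileDGE P x y = tileDGE P x y' := by
  unfold tileDGE
  refine if_congr ?_ rfl rfl
  rw [← h.floor_eq, ← h.coord_eq]
  by_cases h0 : ⌊3 * y⌋ = 0
  · have h1 := level_eq h0
    have h2 := level_eq (h.floor_eq.symm.trans h0)
    rw [← h.coord_eq] at h2
    norm_num only [Int.cast_zero, zero_add] at h1 h2
    rw [h1, h2]
    obtain ⟨h3, h4⟩ := h.level_mem h0
    obtain ⟨h5, h6⟩ := h.level_mem' h0
    simp [h4.le, h6.le, h3.not_ge, h5.not_ge]
  · simp [h0]

theorem upperTile_congr_right (U : (ℝ → ℝ → ℝ) → ℝ → ℝ → ℝ) {P : BoundingSequence}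
    (z : ℕ+ → ℝ) {y y' : ℝ} (h : SameClass P y y') {X : GPart} {x : ℝ}
    (hX : X = .C → ¬ ((∃ b, ⌊3 * x⌋ = third b) ∧ ∃ b, ⌊3 * y⌋ = third b)) :
    upperTile U P z X .E x y = upperTile U P z X .E x y' := by
  cases X with
  | A => exact if_congr (by rw [h.floor_eq]) rfl rfl
  | B => exact if_congr (by rw [h.floor_eq, h.coord_eq]) rfl rfl
  | C =>
    have h1 := hX rfl
    have h2 := h1
    rw [h.floor_eq] at h2
    exact (tileCE_eq_zero P z h1).trans (tileCE_eq_zero P z h2).symm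
  | D j =>
    change (if j = 6 then tileDGE P x y else 0) = if j = 6 then tileDGE P x y' else 0
    rw [tileDGE_congr h]
  | _ => rfl

theorem innerTile_congr_left (U : (ℝ → ℝ → ℝ) → ℝ → ℝ → ℝ) {P : BoundingSequence}
    (z : ℕ+ → ℝ) {y y' : ℝ} (h : SameClass P y y') {X : GPart} {x : ℝ}
    (hX : X = .C → ¬ ((∃ b, ⌊3 * x⌋ = third b) ∧ ∃ b, ⌊3 * y⌋ = third b)) :
    innerTile U P z .E X y x = innerTile U P z .E X y' x := by
  unfold innerTile
  rw [upperTile_congr_right U z h hX]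
  have : upperTile U P z .E X y x = upperTile U P z .E X y' x := by cases X <;> rfl
  rw [this]

/-- Crossing the threshold changes the row towards `C` but not its integral, so the tile `E×Q` is
unaffected as well. -/
theorem relDeg_congr (U : (ℝ → ℝ → ℝ) → ℝ → ℝ → ℝ) {P : BoundingSequence} {z : ℕ+ → ℝ}
    (hz : z ∈ cube) {y y' : ℝ} (h : SameClass P y y') (hy : Generic P z y)
    (hy' : Generic P z y') (Z : GPart) :
    relDeg U P z .E Z y = relDeg U P z .E Z y' := by
  by_cases hZ : Z = .C
  · rw [hZ, relDeg_EC U P hz hy, relDeg_EC U P hz hy', h.floor_eq, h.coord_eq]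
  · unfold relDeg
    congr 1
    funext t
    exact innerTile_congr_left U z h fun h' => absurd h' hZ

/-- `W_P(z)` does not change when a point moves within its class in `E`. -/
theorem WP_congr_left (U : (ℝ → ℝ → ℝ) → ℝ → ℝ → ℝ) {P : BoundingSequence} {z : ℕ+ → ℝ}
    (hz : z ∈ cube) {s s' t : ℝ} (hs : partOf s = .E) (hs' : partOf s' = .E)
    (h : SameClass P (relCoord s) (relCoord s')) (hg : Generic P z (relCoord s))
    (hg' : Generic P z (relCoord s'))
    (hsp : ¬ SpecialAt (partOf s) (partOf t) (relCoord s) (relCoord t)) :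
    WP U P z s t = WP U P z s' t := by
  unfold WP
  rw [hs, hs']
  rw [hs] at hsp
  rcases tile_cases .E (partOf t) with ⟨c, -, h'⟩ | ⟨-, h'⟩ | ⟨h'', h'⟩ | h' <;> rw [h']
  · simp only [tileQ, relDeg_congr U hz h hg hg']
  · refine innerTile_congr_left U z h fun hC h' => hsp ⟨Or.inr ⟨rfl, hC⟩, h'.2, h'.1⟩

/-! ### Cells -/

/-- The cells into which the unit interval is split: the dyadic classes of the first two
thirds of `C` and of `E`, the latter further split into four by the level; the remaining
points form one more cell. -/
inductive Cell where
  | C (b : Bool) (k : ℕ+)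
  | E (θ : Bool) (k : ℕ+) (j : Fin 4)
  | rest

instance : Countable Cell := by
  let f : Cell → Option ((Bool × ℕ+) ⊕ (Bool × ℕ+ × Fin 4)) := fun c =>
    match c with
    | .C b k => some (.inl (b, k))
    | .E θ k j => some (.inr (θ, k, j))
    | .rest => none
  refine Function.Injective.countable (f := f) ?_
  rintro (_ | _ | _) (_ | _ | _) h <;> simp_all [f]

/-- The tile `D_G×E` tests levels in the first third of `E` only, so in the second third the trivial
bounds 0 and 1 suffice, and the outer two of the four cells are then empty. -/
def lowerBound (P : BoundingSequence) (θ : Bool) (k : ℕ+) : ℝ := if θ then 0 else P.l k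

def upperBound (P : BoundingSequence) (θ : Bool) (k : ℕ+) : ℝ := if θ then 1 else P.u k

theorem lowerBound_nonneg (P : BoundingSequence) (θ : Bool) (k : ℕ+) : 0 ≤ lowerBound P θ k := by
  unfold lowerBound
  split_ifs
  · exact le_rfl
  · exact (P.l_mem k).1

theorem upperBound_le_one (P : BoundingSequence) (θ : Bool) (k : ℕ+) : upperBound P θ k ≤ 1 := by
  unfold upperBound
  split_ifs
  · exact le_rfl
  · exact (P.u_mem k).2

theorem lowerBound_le_upperBound (P : BoundingSequence) (θ : Bool) (k : ℕ+) :
    lowerBound P θ k ≤ upperBound P θ k := by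
  unfold lowerBound upperBound
  split_ifs
  · exact zero_le_one
  · exact P.l_le_u k

/-- This is where feasibility enters: it gives the ordering of the cuts on which the partition into
cells, and its containment in the hulls, rest. -/
theorem threshold_mem_bounds {P : BoundingSequence} {z : ℕ+ → ℝ} (hz : z ∈ cube)
    (hf : Feasible P z) (θ : Bool) (k : ℕ+) : MvPolynomial.eval z (threshold P θ k) ∈
      Set.Icc (lowerBound P θ k) (upperBound P θ k) := by
  cases θ
  · exact hf k
  · exact threshold_mem P true k hz

/-- The points of the part `X` with relative coordinate in the third with index `b`, in the
`k`-th dyadic class and with level in `[a, c)`. -/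
def region (X : GPart) (b : Bool) (k : ℕ+) (a c : ℝ) : Set ℝ :=
  {s | s ∈ Set.Ico (0 : ℝ) 1 ∧ partOf s = X ∧ relCoord s ∈ levelSet (third b) k a c}

theorem measurableSet_region (X : GPart) (b : Bool) (k : ℕ+) (a c : ℝ) :
    MeasurableSet (region X b k a c) :=
  measurableSet_Ico.inter ((measurable_partOf (measurableSet_singleton X)).inter
    (measurable_relCoord (measurableSet_levelSet _ _ _ _)))

theorem region_eq_Ico {X : GPart} (hX : X = .C ∨ X = .E) (b : Bool) (k : ℕ+) {a c : ℝ}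
    (ha : 0 ≤ a) (hc : c ≤ 1) : region X b k a c =
      Set.Ico (X.iota (levelPoint (third b) k a)) (X.iota (levelPoint (third b) k c)) := by
  have hsz : X.size = 1 / 25 := by rcases hX with rfl | rfl <;> rfl
  have hleft : 0 ≤ X.left ∧ X.left ≤ 24 / 25 := by
    rcases hX with rfl | rfl <;> norm_num [GPart.left]
  ext s
  constructor
  · rintro ⟨h1, rfl, h3⟩
    have hs := (relCoord_mem h1).2
    rw [levelSet_eq_Ico _ _ ha hc] at h3
    rw [← hs]
    rw [hs]
    simp only [GPart.iota, hsz, Set.mem_Ico] at hs h3 ⊢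
    constructor <;> linarith [h3.1, h3.2]
  · rintro ⟨h1, h2⟩
    simp only [GPart.iota, hsz] at h1 h2
    have hmem : (s - X.left) * 25 ∈ levelSet (third b) k a c := by
      rw [levelSet_eq_Ico _ _ ha hc]
      constructor <;> linarith
    have h01 := levelSet_subset (third_cases b) k a c hmem
    have hs : s = X.iota ((s - X.left) * 25) := by
      rw [GPart.iota, hsz]; ring
    obtain ⟨hp, hr⟩ := partOf_iota X _ h01
    rw [← hs] at hp hr
    refine ⟨?_, hp, hr.symm ▸ hmem⟩
    obtain ⟨h3, h4⟩ := h01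
    constructor <;> linarith

theorem volume_region {X : GPart} (hX : X = .C ∨ X = .E) (b : Bool) (k : ℕ+) {a c : ℝ}
    (ha : 0 ≤ a) (hac : a ≤ c) (hc : c ≤ 1) :
    volume.real (region X b k a c) = (c - a) / (75 * 2 ^ (k : ℕ)) := by
  have hsz : X.size = 1 / 25 := by rcases hX with rfl | rfl <;> rfl
  have hle := (levelPoint_le_iff (third b) k a c).mpr hac
  rw [region_eq_Ico hX b k ha hc, Real.volume_real_Ico_of_le (by
    simp only [GPart.iota, hsz]; linarith)]
  simp only [GPart.iota, hsz, levelPoint]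
  field_simp
  ring

/-- The lower and upper ends of the range of levels of a cell. -/
def cellLevels (P : BoundingSequence) (z : ℕ+ → ℝ) (θ : Bool) (k : ℕ+) : Fin 4 → ℝ × ℝ :=
  ![(0, lowerBound P θ k),
    (lowerBound P θ k, MvPolynomial.eval z (threshold P θ k)),
    (MvPolynomial.eval z (threshold P θ k), upperBound P θ k),
    (upperBound P θ k, 1)]

/-- The ranges of levels after removing the division at the threshold. -/
def hullLevels (P : BoundingSequence) (θ : Bool) (k : ℕ+) : Fin 4 → ℝ × ℝ :=
  ![(0, lowerBound P θ k),
    (lowerBound P θ k, upperBound P θ k),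
    (lowerBound P θ k, upperBound P θ k),
    (upperBound P θ k, 1)]

/-- The points of the unit interval outside the first two thirds of `C` and of `E`. -/
def restSet : Set ℝ :=
  {s | s ∈ Set.Ico (0 : ℝ) 1 ∧
    ¬ ((partOf s = .C ∨ partOf s = .E) ∧ ∃ b, ⌊3 * relCoord s⌋ = third b)}

/-- The only boundary that moves with `z` is the threshold, common to the cells of `E` with `j = 1`
and `j = 2`. -/
def cellSet (P : BoundingSequence) (z : ℕ+ → ℝ) : Cell → Set ℝ
  | .C b k => region .C b k 0 1
  | .E θ k j => region .E θ k (cellLevels P z θ k j).1 (cellLevels P z θ k j).2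
  | .rest => restSet

/-- A set containing the cell that does not depend on `z`. -/
def hullSet (P : BoundingSequence) : Cell → Set ℝ
  | .C b k => region .C b k 0 1
  | .E θ k j => region .E θ k (hullLevels P θ k j).1 (hullLevels P θ k j).2
  | .rest => restSet

theorem measurableSet_restSet : MeasurableSet restSet := by
  have h : MeasurableSet {s | (partOf s = .C ∨ partOf s = .E) ∧
      ∃ b, ⌊3 * relCoord s⌋ = third b} := by
    refine ((measurable_partOf (measurableSet_singleton .C)).union
      (measurable_partOf (measurableSet_singleton .E))).inter ?_
    have : MeasurableSet {i : ℤ | ∃ b, i = third b} := MeasurableSet.of_discrete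
    exact (measurable_third.comp measurable_relCoord) this
  exact measurableSet_Ico.inter h.compl

theorem measurableSet_cellSet (P : BoundingSequence) (z : ℕ+ → ℝ) (c : Cell) :
    MeasurableSet (cellSet P z c) := by
  cases c with
  | rest => exact measurableSet_restSet
  | _ => exact measurableSet_region _ _ _ _ _

theorem measurableSet_hullSet (P : BoundingSequence) (c : Cell) :
    MeasurableSet (hullSet P c) := by
  cases c with
  | rest => exact measurableSet_restSet
  | _ => exact measurableSet_region _ _ _ _ _

theorem hullSet_subset (P : BoundingSequence) (c : Cell) : hullSet P c ⊆ Set.Ico 0 1 := by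
  cases c <;> exact fun s hs => hs.1

theorem region_mono {X : GPart} {b : Bool} {k : ℕ+} {a c a' c' : ℝ} (ha : a' ≤ a)
    (hc : c ≤ c') : region X b k a c ⊆ region X b k a' c' :=
  fun _ hs => ⟨hs.1, hs.2.1, hs.2.2.1, hs.2.2.2.1, ha.trans hs.2.2.2.2.1,
    hs.2.2.2.2.2.trans_le hc⟩

theorem cellSet_subset_hullSet {P : BoundingSequence} {z : ℕ+ → ℝ} (hz : z ∈ cube)
    (hf : Feasible P z) (c : Cell) : cellSet P z c ⊆ hullSet P c := by
  cases c with
  | E θ k j =>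
    have h := threshold_mem_bounds hz hf θ k
    fin_cases j
    · exact subset_rfl
    · exact region_mono le_rfl h.2
    · exact region_mono h.1 le_rfl
    · exact subset_rfl
  | _ => exact subset_rfl

theorem iUnion_cellSet {P : BoundingSequence} {z : ℕ+ → ℝ} (hz : z ∈ cube)
    (hf : Feasible P z) : ⋃ c, cellSet P z c = Set.Ico 0 1 := by
  refine Set.Subset.antisymm (Set.iUnion_subset fun c =>
    (cellSet_subset_hullSet hz hf c).trans (hullSet_subset P c)) fun s hs => ?_
  rw [Set.mem_iUnion]
  by_cases h : (partOf s = .C ∨ partOf s = .E) ∧ ∃ b, ⌊3 * relCoord s⌋ = third b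
  · obtain ⟨h | h, b, hb⟩ := h
    · exact ⟨.C b (coord (3 * relCoord s)), hs, h, hb, rfl, level_mem _⟩
    · have hl := level_mem (relCoord s)
      set k := coord (3 * relCoord s)
      have key : ∀ j : Fin 4, (cellLevels P z b k j).1 ≤ level (relCoord s) →
          level (relCoord s) < (cellLevels P z b k j).2 → ∃ c, s ∈ cellSet P z c :=
        fun j h1 h2 => ⟨.E b k j, hs, h, hb, rfl, h1, h2⟩
      by_cases h1 : level (relCoord s) < lowerBound P b k
      · exact key 0 hl.1 h1
      by_cases h2 : level (relCoord s) < MvPolynomial.eval z (threshold P b k)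
      · exact key 1 (not_lt.mp h1) h2
      by_cases h3 : level (relCoord s) < upperBound P b k
      · exact key 2 (not_lt.mp h2) h3
      · exact key 3 (not_lt.mp h3) hl.2
  · exact ⟨.rest, hs, h⟩

/-- Part, third and class are determined by the point, and the four ranges of levels are consecutive
half-open intervals because the threshold lies between the bounds. -/
theorem pairwise_disjoint_cellSet {P : BoundingSequence} {z : ℕ+ → ℝ} (hz : z ∈ cube)
    (hf : Feasible P z) {c c' : Cell} {s : ℝ} (h : s ∈ cellSet P z c)
    (h' : s ∈ cellSet P z c') : c = c' := by
  cases c with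
  | C b k =>
    cases c' with
    | C b' k' =>
      obtain rfl := h.2.2.2.1.symm.trans h'.2.2.2.1
      obtain rfl := third_inj.mp (h.2.2.1.symm.trans h'.2.2.1)
      rfl
    | E θ k' j => exact absurd (h.2.1.symm.trans h'.2.1) (by simp)
    | rest => exact absurd ⟨Or.inl h.2.1, _, h.2.2.1⟩ h'.2
  | E θ k j =>
    cases c' with
    | C b' k' => exact absurd (h.2.1.symm.trans h'.2.1) (by simp)
    | E θ' k' j' =>
      obtain rfl := h.2.2.2.1.symm.trans h'.2.2.2.1
      obtain rfl := third_inj.mp (h.2.2.1.symm.trans h'.2.2.1)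
      congr 1
      have hb := threshold_mem_bounds hz hf θ k
      have h1 := h.2.2.2.2
      have h2 := h'.2.2.2.2
      obtain ⟨hb1, hb2⟩ := hb
      fin_cases j <;> fin_cases j' <;> first
        | rfl
        | (exfalso
           simp [cellLevels] at h1 h2
           linarith [h1.1, h1.2, h2.1, h2.2])
    | rest => exact absurd ⟨Or.inr h.2.1, _, h.2.2.1⟩ h'.2
  | rest =>
    cases c' with
    | C b' k' => exact absurd ⟨Or.inl h'.2.1, _, h'.2.2.1⟩ h.2
    | E θ k' j => exact absurd ⟨Or.inr h'.2.1, _, h'.2.2.1⟩ h.2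
    | rest => rfl

/-! ### The values of `W_P(z)` at special pairs -/

/-- The pairs of cells on which the values of `W_P(z)` encode `z^{M_k}` or `p_k(z)`. -/
def isSpecial : Cell → Cell → Bool
  | .C _ _, .C _ _ => true
  | .C _ _, .E _ _ _ => true
  | .E _ _ _, .C _ _ => true
  | _, _ => false

/-- The polynomial giving the value of `W_P(z)` on a special pair of cells. -/
def pairPoly : Cell → Cell → MvPolynomial ℕ+ ℝ
  | .C b k, .C b' k' => if k = k' then
      if b = b' then MvPolynomial.monomial (M k) 1 else 1 - MvPolynomial.monomial (M k) 1 else 0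
  | .C b k, .E _ k' j => if k = k' ∧ b = decide (2 ≤ j) then 1 else 0
  | .E _ k' j, .C b k => if k = k' ∧ b = decide (2 ≤ j) then 1 else 0
  | _, _ => 0

theorem eval_monomial_M (z : ℕ+ → ℝ) (A : ℕ+ →₀ ℕ) :
    MvPolynomial.eval z (MvPolynomial.monomial A 1) = monomialValue A z := by
  rw [MvPolynomial.eval_monomial, one_mul, monomialValue]

/-- Levels with `j ≥ 2` are those above the threshold, and these are joined to the second third of
`C`; lower levels are joined to the first third. Once the cells follow the threshold, the tile is
constant on them. -/
theorem tileCE_eq_pairPoly {P : BoundingSequence} {z : ℕ+ → ℝ} (hz : z ∈ cube)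
    (hf : Feasible P z) {s t : ℝ} {b θ : Bool} {k k' : ℕ+} {j : Fin 4}
    (hs : s ∈ cellSet P z (.C b k)) (ht : t ∈ cellSet P z (.E θ k' j))
    (hg : Generic P z (relCoord t)) :
    tileCE P z (relCoord s) (relCoord t) =
      MvPolynomial.eval z (pairPoly (.C b k) (.E θ k' j)) := by
  classical
  obtain ⟨hb1, hb2⟩ := threshold_mem_bounds hz hf θ k'
  have hlt := ht.2.2.2.2
  have hne := hg.ne_threshold θ
  rw [tileCE_eq P hz hs.2.2.1 ht.2.2.1 hg.ne_zero, hs.2.2.2.1, ht.2.2.2.1]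
  rw [ht.2.2.2.1] at hne
  simp only [pairPoly]
  rw [apply_ite (MvPolynomial.eval z), map_one, map_zero]
  refine if_congr (and_congr_right fun _ => ?_) rfl rfl
  obtain ⟨h1, h2⟩ := hlt
  generalize hτ : MvPolynomial.eval z (threshold P θ k') = τ at *
  rcases lt_or_gt_of_ne hne with h | h
  · have hj : decide (2 ≤ j) = false := by
      fin_cases j <;> simp [cellLevels, hτ] at h1 h2 ⊢ <;> linarith
    rw [hj]
    simp [h.le, h.not_ge]
  · have hj : decide (2 ≤ j) = true := by
      fin_cases j <;> simp [cellLevels, hτ] at h1 h2 ⊢ <;> linarith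
    rw [hj]
    simp [h.le, h.not_ge]

theorem WP_special (U : (ℝ → ℝ → ℝ) → ℝ → ℝ → ℝ) {P : BoundingSequence} {z : ℕ+ → ℝ}
    (hz : z ∈ cube) (hf : Feasible P z) {c c' : Cell} (hc : isSpecial c c' = true) {s t : ℝ}
    (hs : s ∈ cellSet P z c) (ht : t ∈ cellSet P z c') (hgs : Generic P z (relCoord s))
    (hgt : Generic P z (relCoord t)) :
    WP U P z s t = MvPolynomial.eval z (pairPoly c c') := by
  unfold WP
  cases c with
  | C b k =>
    cases c' with
    | C b' k' =>
      rw [hs.2.1, ht.2.1]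
      refine (if_pos le_rfl).trans ?_
      change tileCC z _ _ = _
      unfold tileCC
      rw [hs.2.2.1, hs.2.2.2.1, ht.2.2.1, ht.2.2.2.1]
      simp only [pairPoly]
      by_cases hk : k = k'
      · subst hk
        cases b <;> cases b' <;> simp [third, eval_monomial_M]
      · simp [hk]
    | E θ k' j =>
      rw [hs.2.1, ht.2.1]
      refine (if_pos (by norm_num [GPart.left])).trans ?_
      exact tileCE_eq_pairPoly hz hf hs ht hgt
    | rest => cases hc
  | E θ k j =>
    cases c' with
    | C b k' =>
      rw [hs.2.1, ht.2.1]
      refine (if_neg (by norm_num [GPart.left])).trans ?_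
      exact tileCE_eq_pairPoly hz hf ht hs hgs
    | E θ' k' j' => cases hc
    | rest => cases hc
  | rest => cases c' <;> cases hc

/-- Hulls rather than cells appear here because points will be moved across the threshold inside
their hulls. -/
theorem not_specialAt {P : BoundingSequence} {c c' : Cell} (hc : ¬ isSpecial c c' = true)
    {s t : ℝ} (hs : s ∈ hullSet P c) (ht : t ∈ hullSet P c') :
    ¬ SpecialAt (partOf s) (partOf t) (relCoord s) (relCoord t) := by
  rintro ⟨h1, h2, h3⟩
  have hs' : c ≠ .rest := by
    rintro rfl
    refine hs.2 ⟨?_, h2⟩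
    rcases h1 with ⟨h, -⟩ | ⟨h, -⟩
    · exact Or.inl h
    · exact Or.inr h
  have ht' : c' ≠ .rest := by
    rintro rfl
    refine ht.2 ⟨?_, h3⟩
    rcases h1 with ⟨-, h⟩ | ⟨-, h⟩
    · exact h
    · exact Or.inl h
  cases c with
  | C b k => cases c' <;> simp [isSpecial] at hc ht'
  | E θ k j =>
    cases c' with
    | C b' k' => simp [isSpecial] at hc
    | E θ' k' j' =>
      rw [hs.2.1, ht.2.1] at h1
      simp at h1
    | rest => exact ht' rfl
  | rest => exact hs' rfl

/-! ### Collapsing coordinates of a product measure -/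

open scoped NNReal ENNReal

theorem pi_nnreal_smul {n : ℕ} (r : Fin n → ℝ≥0) (μ : Fin n → Measure ℝ)
    [∀ i, IsFiniteMeasure (μ i)] :
    Measure.pi (fun i => r i • μ i) = (∏ i, r i) • Measure.pi μ := by
  refine Measure.pi_eq fun s _ => ?_
  rw [Measure.smul_apply, Measure.pi_pi]
  simp only [Measure.smul_apply, ENNReal.smul_def, smul_eq_mul, Finset.prod_mul_distrib]
  push_cast
  rfl

/-- If the maps `κ i` do not change the values of `F` and turn the measures `μ i` into
multiples of the measures `ν i`, then the integrals of `F` are proportional. -/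
theorem integral_pi_collapse {n : ℕ} (μ ν : Fin n → Measure ℝ) [∀ i, IsFiniteMeasure (μ i)]
    [∀ i, IsFiniteMeasure (ν i)] (κ : Fin n → ℝ → ℝ) (hκ : ∀ i, Measurable (κ i))
    (r : Fin n → ℝ≥0) (hr : ∀ i, (μ i).map (κ i) = r i • (ν i).map (κ i))
    {F : (Fin n → ℝ) → ℝ} (hF : Measurable F)
    (hμ : ∀ᵐ x ∂Measure.pi μ, F x = F fun i => κ i (x i))
    (hν : ∀ᵐ x ∂Measure.pi ν, F x = F fun i => κ i (x i)) :
    ∫ x, F x ∂Measure.pi μ = (∏ i, (r i : ℝ)) * ∫ x, F x ∂Measure.pi ν := by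
  have hm : Measurable fun (x : Fin n → ℝ) i => κ i (x i) :=
    measurable_pi_lambda _ fun i => (hκ i).comp (measurable_pi_apply i)
  have hmap : ∀ (ρ : Fin n → Measure ℝ) [∀ i, IsFiniteMeasure (ρ i)],
      (Measure.pi ρ).map (fun x i => κ i (x i)) = Measure.pi fun i => (ρ i).map (κ i) :=
    fun ρ _ => Measure.pi_map_pi fun i => (hκ i).aemeasurable
  -- Replacing `F` by its composition with the maps turns both integrals into integrals of `F`
  -- against products of pushforwards, which differ by the product of the factors `r i`.
  rw [integral_congr_ae hμ, integral_congr_ae hν,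
    ← integral_map hm.aemeasurable hF.aestronglyMeasurable,
    ← integral_map hm.aemeasurable hF.aestronglyMeasurable, hmap, hmap]
  simp only [hr]
  rw [pi_nnreal_smul, integral_smul_nnreal_measure, NNReal.smul_def, smul_eq_mul]
  push_cast
  rfl

theorem ae_pi_of_ae {n : ℕ} {μ : Fin n → Measure ℝ} [∀ i, IsFiniteMeasure (μ i)]
    {p : Fin n → ℝ → Prop} (hp : ∀ i, ∀ᵐ s ∂μ i, p i s) :
    ∀ᵐ x ∂Measure.pi μ, ∀ i, p i (x i) :=
  ae_all_iff.mpr fun i => (Measure.tendsto_eval_ae_ae (μ := μ) (i := i)).eventually (hp i)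

/-! ### Exceptional points -/

/-- The points at which a threshold is attained. -/
def exceptional (P : BoundingSequence) (z : ℕ+ → ℝ) : Set ℝ :=
  {s | s ∈ Set.Ico (0 : ℝ) 1 ∧ ¬ Generic P z (relCoord s)}

theorem countable_exceptional (P : BoundingSequence) (z : ℕ+ → ℝ) :
    (exceptional P z).Countable := by
  refine Set.Countable.mono (s₂ := ⋃ X : GPart, X.iota '' {y | ¬ Generic P z y}) ?_
    (Set.countable_iUnion fun X => (countable_not_generic P z).image _)
  rintro s ⟨h1, h2⟩
  exact Set.mem_iUnion.mpr ⟨partOf s, relCoord s, h2, (relCoord_mem h1).2⟩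

theorem ae_generic (P : BoundingSequence) (z : ℕ+ → ℝ) {S : Set ℝ} (hS : MeasurableSet S)
    (h01 : S ⊆ Set.Ico 0 1) :
    ∀ᵐ s ∂volume.restrict S, s ∈ S ∧ Generic P z (relCoord s) := by
  filter_upwards [(countable_exceptional P z).ae_notMem (volume.restrict S),
    ae_restrict_mem hS] with s h1 h2
  exact ⟨h2, not_not.mp fun h => h1 ⟨h01 h2, h⟩⟩

/-! ### The relative length of a cell -/

/-- The polynomial that gives the ratio of the measures of a cell and of its hull. -/
def ratioPoly (P : BoundingSequence) : Cell → MvPolynomial ℕ+ ℝ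
  | .E θ k j => ![1,
      MvPolynomial.C (upperBound P θ k - lowerBound P θ k)⁻¹ *
        (threshold P θ k - MvPolynomial.C (lowerBound P θ k)),
      MvPolynomial.C (upperBound P θ k - lowerBound P θ k)⁻¹ *
        (MvPolynomial.C (upperBound P θ k) - threshold P θ k), 1] j
  | _ => 1

/-- The cells inside whose hulls points may be moved. -/
def isMiddle : Cell → Prop
  | .E _ _ j => j = 1 ∨ j = 2
  | _ => False

theorem cell_of_not_isMiddle (P : BoundingSequence) (z : ℕ+ → ℝ) {c : Cell}
    (hc : ¬ isMiddle c) : cellSet P z c = hullSet P c ∧ ratioPoly P c = 1 := by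
  cases c with
  | E θ k j =>
    fin_cases j
    · exact ⟨rfl, rfl⟩
    · exact absurd (Or.inl rfl) hc
    · exact absurd (Or.inr rfl) hc
    · exact ⟨rfl, rfl⟩
  | _ => exact ⟨rfl, rfl⟩

theorem ratioPoly_nonneg {P : BoundingSequence} {z : ℕ+ → ℝ} (hz : z ∈ cube)
    (hf : Feasible P z) (c : Cell) : 0 ≤ MvPolynomial.eval z (ratioPoly P c) := by
  cases c with
  | E θ k j =>
    obtain ⟨h1, h2⟩ := threshold_mem_bounds hz hf θ k
    have h3 : 0 ≤ (upperBound P θ k - lowerBound P θ k)⁻¹ :=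
      inv_nonneg.mpr (sub_nonneg.mpr (h1.trans h2))
    fin_cases j <;> simp [ratioPoly]
    · exact mul_nonneg h3 (sub_nonneg.mpr h1)
    · exact mul_nonneg h3 (sub_nonneg.mpr h2)
  | _ => simp [ratioPoly]

/-- Lengths are affine in the level, so the threshold divides the hull in a ratio affine in the
threshold, hence polynomial in `z`. -/
theorem volume_cellSet {P : BoundingSequence} {z : ℕ+ → ℝ} (hz : z ∈ cube)
    (hf : Feasible P z) (c : Cell) :
    volume.real (cellSet P z c) =
      MvPolynomial.eval z (ratioPoly P c) * volume.real (hullSet P c) := by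
  by_cases hc : isMiddle c
  · cases c with
    | E θ k j =>
      obtain ⟨h1, h2⟩ := threshold_mem_bounds hz hf θ k
      have h3 := lowerBound_nonneg P θ k
      have h4 := upperBound_le_one P θ k
      have hhull := volume_region (Or.inr rfl) θ k h3 (h1.trans h2) h4
      have hlow := volume_region (Or.inr rfl) θ k h3 h1 (h2.trans h4)
      have hup := volume_region (Or.inr rfl) θ k (h3.trans h1) h2 h4
      -- If the bounds coincide, the inverse is 0 by convention; the formula survives because the
      -- threshold then equals both bounds and the cell is empty too.
      have key : ∀ a : ℝ, (upperBound P θ k = lowerBound P θ k → a = 0) →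
          a / (75 * 2 ^ (k : ℕ)) = (upperBound P θ k - lowerBound P θ k)⁻¹ * a *
            ((upperBound P θ k - lowerBound P θ k) / (75 * 2 ^ (k : ℕ))) := by
        intro a ha
        by_cases h : upperBound P θ k = lowerBound P θ k
        · simp [ha h]
        · have := sub_ne_zero.mpr h
          field_simp
      rcases hc with rfl | rfl
      · refine hlow.trans ?_
        refine Eq.trans ?_ (congrArg (_ * ·) hhull).symm
        rw [key _ fun h => by linarith]
        simp [ratioPoly]
      · refine hup.trans ?_
        refine Eq.trans ?_ (congrArg (_ * ·) hhull).symm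
        rw [key _ fun h => by linarith]
        simp [ratioPoly]
    | _ => cases hc
  · obtain ⟨h1, h2⟩ := cell_of_not_isMiddle P z hc
    rw [h1, h2, map_one, one_mul]

/-- The hull is half-open, so strictness at the upper bound is automatic, and genericity supplies it
at the lower bound. -/
theorem sameClass_of_mem_hullSet {P : BoundingSequence} {z : ℕ+ → ℝ} {c : Cell}
    (hc : isMiddle c) {s s' : ℝ} (hs : s ∈ hullSet P c) (hs' : s' ∈ hullSet P c)
    (hg : Generic P z (relCoord s)) (hg' : Generic P z (relCoord s')) :
    partOf s = .E ∧ partOf s' = .E ∧ SameClass P (relCoord s) (relCoord s') := by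
  cases c with
  | E θ k j =>
    have hbounds : hullLevels P θ k j = (lowerBound P θ k, upperBound P θ k) := by
      rcases hc with rfl | rfl <;> rfl
    simp only [hullSet, hbounds] at hs hs'
    have key : ∀ t, t ∈ region .E θ k (lowerBound P θ k) (upperBound P θ k) →
        Generic P z (relCoord t) → ⌊3 * relCoord t⌋ = 0 →
        level (relCoord t) ∈ Set.Ioo (P.l k) (P.u k) := by
      intro t ht hgt h0
      have hθ : θ = false := third_inj.mp (ht.2.2.1.symm.trans h0)
      subst hθ
      have h1 := hgt.ne_l
      rw [ht.2.2.2.1] at h1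
      exact ⟨lt_of_le_of_ne ht.2.2.2.2.1 (Ne.symm h1), ht.2.2.2.2.2⟩
    refine ⟨hs.2.1, hs'.2.1, hs.2.2.1.trans hs'.2.2.1.symm, hs.2.2.2.1.trans hs'.2.2.2.1.symm,
      ?_, ?_⟩
    · intro h0
      rw [hs.2.2.2.1]
      exact key s hs hg h0
    · intro h0
      rw [hs.2.2.2.1]
      exact key s' hs' hg' (hs'.2.2.1.trans (hs.2.2.1.symm.trans h0))
  | _ => cases hc

instance (P : BoundingSequence) (c : Cell) :
    IsFiniteMeasure (volume.restrict (hullSet P c)) :=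
  isFiniteMeasure_of_le (volume.restrict (Set.Ico 0 1))
    (Measure.restrict_mono (hullSet_subset P c) le_rfl)

/-- There is a map collapsing the middle cells that relates a cell to its hull. -/
theorem exists_collapse {P : BoundingSequence} {z : ℕ+ → ℝ} (hz : z ∈ cube)
    (hf : Feasible P z) (c : Cell) : ∃ κ : ℝ → ℝ, Measurable κ ∧
      (volume.restrict (cellSet P z c)).map κ =
        Real.toNNReal (MvPolynomial.eval z (ratioPoly P c)) •
          (volume.restrict (hullSet P c)).map κ ∧
      ∀ s ∈ hullSet P c, Generic P 0 (relCoord s) → κ s ∈ hullSet P c ∧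
        Generic P 0 (relCoord (κ s)) ∧ (κ s = s ∨ isMiddle c) := by
  by_cases hc : isMiddle c
  · by_cases hex : ∃ p ∈ hullSet P c, Generic P 0 (relCoord p)
    · obtain ⟨p, hp, hgp⟩ := hex
      -- A constant map sends both measures to multiples of a point mass, so only the total lengths
      -- of the cell and of its hull matter.
      refine ⟨fun _ => p, measurable_const, ?_, fun s _ _ => ⟨hp, hgp, Or.inr hc⟩⟩
      have hfin : ∀ S : Set ℝ, S ⊆ Set.Ico 0 1 → volume S ≠ ⊤ := fun S hS =>
        ((measure_mono hS).trans_lt (by simp)).ne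
      have hvol : volume (cellSet P z c) =
          (Real.toNNReal (MvPolynomial.eval z (ratioPoly P c)) : ℝ≥0∞) *
            volume (hullSet P c) := by
        have h := volume_cellSet hz hf c
        have h1 := hfin _ ((cellSet_subset_hullSet hz hf c).trans (hullSet_subset P c))
        have h2 := hfin _ (hullSet_subset P c)
        rw [← ENNReal.toReal_eq_toReal_iff' h1 (ENNReal.mul_ne_top ENNReal.coe_ne_top h2),
          ENNReal.toReal_mul, ENNReal.coe_toReal,
          Real.coe_toNNReal _ (ratioPoly_nonneg hz hf c)]
        exact h
      rw [Measure.map_const, Measure.map_const, Measure.restrict_apply_univ,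
        Measure.restrict_apply_univ, hvol]
      exact mul_smul _ _ _
    -- Without a generic point the hull is countable, hence null, and the identity serves.
    · have hzero : volume.restrict (hullSet P c) = 0 := by
        rw [Measure.restrict_eq_zero]
        have hsub : hullSet P c ⊆ exceptional P 0 := fun s hs =>
          ⟨hullSet_subset P c hs, fun hg => hex ⟨s, hs, hg⟩⟩
        exact ((countable_exceptional P 0).mono hsub).measure_zero volume
      have hzero' : volume.restrict (cellSet P z c) = 0 := by
        rw [Measure.restrict_eq_zero] at hzero ⊢
        exact measure_mono_null (cellSet_subset_hullSet hz hf c) hzero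
      exact ⟨id, measurable_id, by simp [hzero, hzero'], fun s hs hg => ⟨hs, hg, Or.inl rfl⟩⟩
  · obtain ⟨h1, h2⟩ := cell_of_not_isMiddle P z hc
    exact ⟨id, measurable_id, by simp [h1, h2], fun s hs hg => ⟨hs, hg, Or.inl rfl⟩⟩

/-! ### The contribution of a configuration of cells -/

open Classical in
/-- The factor of the integrand of `τ(H, W)` for the pair `i, j`, if `w` is the value of `W`. -/
def edgeValue {n : ℕ} (H : SimpleGraph (Fin n)) (i j : Fin n) (w : ℝ) : ℝ :=
  if H.Adj i j then w else 1 - w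

/-- The product of the factors that do not depend on `z`. -/
def freeFactor {n : ℕ} (H : SimpleGraph (Fin n)) (h : Fin n → Cell) (W : ℝ → ℝ → ℝ)
    (x : Fin n → ℝ) : ℝ :=
  ∏ e : Fin n × Fin n with e.1 < e.2,
    if isSpecial (h e.1) (h e.2) then 1 else edgeValue H e.1 e.2 (W (x e.1) (x e.2))

open Classical in
/-- The product of the factors that depend on `z`. -/
def specialPoly {n : ℕ} (H : SimpleGraph (Fin n)) (h : Fin n → Cell) : MvPolynomial ℕ+ ℝ :=
  ∏ e : Fin n × Fin n with e.1 < e.2,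
    if isSpecial (h e.1) (h e.2) then
      if H.Adj e.1 e.2 then pairPoly (h e.1) (h e.2) else 1 - pairPoly (h e.1) (h e.2)
    else 1

/-- The integral of the factors that do not depend on `z`. -/
def freeIntegral {n : ℕ} (H : SimpleGraph (Fin n)) (U : (ℝ → ℝ → ℝ) → ℝ → ℝ → ℝ)
    (P : BoundingSequence) (h : Fin n → Cell) : ℝ :=
  ∫ x in Set.univ.pi fun i => hullSet P (h i), freeFactor H h (WP U P 0) x

/-- The contribution of a configuration of cells to `τ(H, W_P(z))`, up to a constant
factor. -/
def shapePoly {n : ℕ} (H : SimpleGraph (Fin n)) (P : BoundingSequence) (h : Fin n → Cell) :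
    MvPolynomial ℕ+ ℝ :=
  (∏ i, ratioPoly P (h i)) * specialPoly H h

/-- The contribution of a configuration of cells to `τ(H, W_P(z))`. -/
def contribution {n : ℕ} (H : SimpleGraph (Fin n)) (U : (ℝ → ℝ → ℝ) → ℝ → ℝ → ℝ)
    (P : BoundingSequence) (h : Fin n → Cell) : MvPolynomial ℕ+ ℝ :=
  MvPolynomial.C (freeIntegral H U P h) * shapePoly H P h

theorem edgeValue_mem {n : ℕ} (H : SimpleGraph (Fin n)) (i j : Fin n) {w : ℝ}
    (hw : w ∈ Set.Icc (0 : ℝ) 1) : edgeValue H i j w ∈ Set.Icc (0 : ℝ) 1 := by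
  unfold edgeValue
  split_ifs
  · exact hw
  · exact ⟨sub_nonneg.mpr hw.2, sub_le_self _ hw.1⟩

theorem measurable_edgeValue {n : ℕ} (H : SimpleGraph (Fin n)) (i j : Fin n) :
    Measurable (edgeValue H i j) := by
  unfold edgeValue
  exact Measurable.ite (MeasurableSet.const _) measurable_id (measurable_const.sub measurable_id)

theorem measurable_edge {n : ℕ} (H : SimpleGraph (Fin n)) {W : ℝ → ℝ → ℝ}
    (hW : IsPlaneGraphon W) (i j : Fin n) :
    Measurable fun x : Fin n → ℝ => edgeValue H i j (W (x i) (x j)) := by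
  have h : Measurable fun x : Fin n → ℝ => (x i, x j) :=
    (measurable_pi_apply i).prodMk (measurable_pi_apply j)
  exact (measurable_edgeValue H i j).comp (hW.meas.comp h)

theorem measurable_freeFactor {n : ℕ} (H : SimpleGraph (Fin n)) (h : Fin n → Cell)
    {W : ℝ → ℝ → ℝ} (hW : IsPlaneGraphon W) : Measurable (freeFactor H h W) := by
  unfold freeFactor
  refine Finset.measurable_prod _ fun e _ => ?_
  split_ifs
  · exact measurable_const
  · exact measurable_edge H hW _ _

theorem freeFactor_mem {n : ℕ} (H : SimpleGraph (Fin n)) (h : Fin n → Cell)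
    {W : ℝ → ℝ → ℝ} (hW : IsPlaneGraphon W) (x : Fin n → ℝ) :
    freeFactor H h W x ∈ Set.Icc (0 : ℝ) 1 := by
  have key : ∀ e : Fin n × Fin n, (if isSpecial (h e.1) (h e.2) then 1 else
      edgeValue H e.1 e.2 (W (x e.1) (x e.2))) ∈ Set.Icc (0 : ℝ) 1 := by
    intro e
    split_ifs
    · exact ⟨zero_le_one, le_rfl⟩
    · exact edgeValue_mem H _ _ (hW.mem _ _)
  exact ⟨Finset.prod_nonneg fun e _ => (key e).1,
    Finset.prod_le_one (fun e _ => (key e).1) fun e _ => (key e).2⟩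

/-- The factors retained belong to non-special pairs, and these do not see the level of a generic
point inside a middle hull. -/
theorem freeFactor_congr {n : ℕ} (H : SimpleGraph (Fin n)) {U : (ℝ → ℝ → ℝ) → ℝ → ℝ → ℝ}
    {P : BoundingSequence} (hU : IsPlaneGraphon (U (WF P))) (h : Fin n → Cell)
    {x x' : Fin n → ℝ} (hx : ∀ i, x i ∈ hullSet P (h i) ∧ Generic P 0 (relCoord (x i)))
    (hx' : ∀ i, x' i ∈ hullSet P (h i) ∧ Generic P 0 (relCoord (x' i)) ∧
      (x' i = x i ∨ isMiddle (h i))) :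
    freeFactor H h (WP U P 0) x = freeFactor H h (WP U P 0) x' := by
  have hz0 : (0 : ℕ+ → ℝ) ∈ cube := fun _ => ⟨le_rfl, zero_le_one⟩
  have hsymm := (isPlaneGraphon_WP hU hz0).symm
  have hstep : ∀ (i : Fin n) (c : Cell) (t : ℝ), t ∈ hullSet P c →
      ¬ isSpecial (h i) c = true → WP U P 0 (x i) t = WP U P 0 (x' i) t := by
    intro i c t ht hc
    obtain ⟨h1, h2, h3 | h3⟩ := hx' i
    · rw [h3]
    · obtain ⟨h4, h5, h6⟩ := sameClass_of_mem_hullSet h3 (hx i).1 h1 (hx i).2 h2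
      exact WP_congr_left U hz0 h4 h5 h6 (hx i).2 h2 (not_specialAt hc (hx i).1 ht)
  have hspec : ∀ c c' : Cell, isSpecial c c' = isSpecial c' c := by
    intro c c'
    cases c <;> cases c' <;> rfl
  refine Finset.prod_congr rfl fun e _ => ?_
  by_cases hs : isSpecial (h e.1) (h e.2) = true
  · rw [if_pos hs, if_pos hs]
  -- The endpoints are moved one at a time, with symmetry of the graphon used for the second.
  · rw [if_neg hs, if_neg hs, hstep e.1 _ _ (hx e.2).1 hs, hsymm _ (x e.2),
      hstep e.2 _ _ (hx' e.1).1 (by rwa [hspec]), hsymm]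

theorem pi_restrict_eq {n : ℕ} (S : Fin n → Set ℝ) :
    (volume : Measure (Fin n → ℝ)).restrict (Set.univ.pi S) =
      Measure.pi fun i => volume.restrict (S i) :=
  Measure.restrict_pi_pi _ _

theorem integral_freeFactor {n : ℕ} (H : SimpleGraph (Fin n))
    {U : (ℝ → ℝ → ℝ) → ℝ → ℝ → ℝ} {P : BoundingSequence} (hU : IsPlaneGraphon (U (WF P)))
    {z : ℕ+ → ℝ} (hz : z ∈ cube) (hf : Feasible P z) (h : Fin n → Cell) :
    ∫ x in Set.univ.pi fun i => cellSet P z (h i), freeFactor H h (WP U P 0) x =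
      (∏ i, MvPolynomial.eval z (ratioPoly P (h i))) * freeIntegral H U P h := by
  have hz0 : (0 : ℕ+ → ℝ) ∈ cube := fun _ => ⟨le_rfl, zero_le_one⟩
  choose κ hκ1 hκ2 hκ3 using fun i => exists_collapse hz hf (h i)
  have hfin : ∀ i, IsFiniteMeasure (volume.restrict (cellSet P z (h i))) := fun i =>
    isFiniteMeasure_of_le (volume.restrict (hullSet P (h i)))
      (Measure.restrict_mono (cellSet_subset_hullSet hz hf (h i)) le_rfl)
  -- Stated for arbitrary subsets of the hulls, since it is applied both to the cells and to the
  -- hulls themselves.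
  have hae : ∀ S : Fin n → Set ℝ, (∀ i, MeasurableSet (S i)) → (∀ i, S i ⊆ hullSet P (h i)) →
      (∀ i, IsFiniteMeasure (volume.restrict (S i))) →
      ∀ᵐ x ∂Measure.pi fun i => volume.restrict (S i), freeFactor H h (WP U P 0) x =
        freeFactor H h (WP U P 0) fun i => κ i (x i) := by
    intro S hS hSh hSf
    have hall : ∀ᵐ x ∂Measure.pi fun i => volume.restrict (S i),
        ∀ i, x i ∈ S i ∧ Generic P 0 (relCoord (x i)) :=
      ae_pi_of_ae fun i =>
        (ae_generic P 0 (hS i) ((hSh i).trans (hullSet_subset P (h i))))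
    filter_upwards [hall] with x hx
    exact freeFactor_congr H hU h (fun i => ⟨hSh i (hx i).1, (hx i).2⟩)
      fun i => hκ3 i _ (hSh i (hx i).1) (hx i).2
  unfold freeIntegral
  rw [pi_restrict_eq, pi_restrict_eq, integral_pi_collapse _ _ κ hκ1 _ hκ2
    (measurable_freeFactor H h (isPlaneGraphon_WP hU hz0))
    (hae _ (fun i => measurableSet_cellSet P z (h i))
      (fun i => cellSet_subset_hullSet hz hf (h i)) hfin)
    (hae _ (fun i => measurableSet_hullSet P (h i)) (fun i => subset_rfl) fun i => inferInstance)]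
  congr 1
  exact Finset.prod_congr rfl fun i _ => Real.coe_toNNReal _ (ratioPoly_nonneg hz hf _)

/-- On a box of cells the special factors are constants, values of polynomials at `z`, and the
others may be evaluated at 0 instead of `z`. Genericity is needed for both parameters. -/
theorem integrand_eq {n : ℕ} (H : SimpleGraph (Fin n)) (U : (ℝ → ℝ → ℝ) → ℝ → ℝ → ℝ)
    {P : BoundingSequence} {z : ℕ+ → ℝ} (hz : z ∈ cube)
    (hf : Feasible P z) (h : Fin n → Cell) {x : Fin n → ℝ}
    (hx : ∀ i, x i ∈ cellSet P z (h i))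
    (hg : ∀ i, Generic P z (relCoord (x i)) ∧ Generic P 0 (relCoord (x i))) :
    ∏ e : Fin n × Fin n with e.1 < e.2, edgeValue H e.1 e.2 (WP U P z (x e.1) (x e.2)) =
      MvPolynomial.eval z (specialPoly H h) * freeFactor H h (WP U P 0) x := by
  have hz0 : (0 : ℕ+ → ℝ) ∈ cube := fun _ => ⟨le_rfl, zero_le_one⟩
  unfold specialPoly freeFactor
  rw [map_prod, ← Finset.prod_mul_distrib]
  refine Finset.prod_congr rfl fun e _ => ?_
  by_cases hs : isSpecial (h e.1) (h e.2) = true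
  · rw [if_pos hs, if_pos hs, mul_one,
      WP_special U hz hf hs (hx e.1) (hx e.2) (hg e.1).1 (hg e.2).1]
    unfold edgeValue
    split_ifs
    · rfl
    · rw [map_sub, map_one]
  · have hsub := fun i => cellSet_subset_hullSet hz hf (h i) (hx i)
    rw [if_neg hs, if_neg hs, map_one, one_mul,
      WP_indep U P hz hz0 (hg e.1) (hg e.2) (not_specialAt hs (hsub _) (hsub _))]

theorem integral_cells {n : ℕ} (H : SimpleGraph (Fin n))
    {U : (ℝ → ℝ → ℝ) → ℝ → ℝ → ℝ} {P : BoundingSequence} (hU : IsPlaneGraphon (U (WF P)))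
    {z : ℕ+ → ℝ} (hz : z ∈ cube) (hf : Feasible P z) (h : Fin n → Cell) :
    ∫ x in Set.univ.pi fun i => cellSet P z (h i),
      ∏ e : Fin n × Fin n with e.1 < e.2, edgeValue H e.1 e.2 (WP U P z (x e.1) (x e.2)) =
      MvPolynomial.eval z (contribution H U P h) := by
  have hfin : ∀ i, IsFiniteMeasure (volume.restrict (cellSet P z (h i))) := fun i =>
    isFiniteMeasure_of_le (volume.restrict (hullSet P (h i)))
      (Measure.restrict_mono (cellSet_subset_hullSet hz hf (h i)) le_rfl)
  have hae : ∀ᵐ x ∂(volume : Measure (Fin n → ℝ)).restrict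
      (Set.univ.pi fun i => cellSet P z (h i)),
      ∏ e : Fin n × Fin n with e.1 < e.2, edgeValue H e.1 e.2 (WP U P z (x e.1) (x e.2)) =
      MvPolynomial.eval z (specialPoly H h) * freeFactor H h (WP U P 0) x := by
    rw [pi_restrict_eq]
    have hall : ∀ z', ∀ᵐ x ∂Measure.pi fun i => volume.restrict (cellSet P z (h i)),
        ∀ i, x i ∈ cellSet P z (h i) ∧ Generic P z' (relCoord (x i)) := fun z' =>
      ae_pi_of_ae fun i =>
        (ae_generic P z' (measurableSet_cellSet P z (h i))
          ((cellSet_subset_hullSet hz hf (h i)).trans (hullSet_subset P (h i))))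
    filter_upwards [hall z, hall 0] with x h1 h2
    exact integrand_eq H U hz hf h (fun i => (h1 i).1) fun i => ⟨(h1 i).2, (h2 i).2⟩
  rw [integral_congr_ae hae, integral_const_mul, integral_freeFactor H hU hz hf]
  simp only [contribution, shapePoly, map_mul, map_prod, MvPolynomial.eval_C]
  ring

/-- For fixed feasible `z` the boxes of cells partition the cube, and countable additivity of the
integral turns the density into the sum of the contributions. -/
theorem hasSum_contribution {n : ℕ} (H : SimpleGraph (Fin n))
    {U : (ℝ → ℝ → ℝ) → ℝ → ℝ → ℝ} {P : BoundingSequence} (hU : IsPlaneGraphon (U (WF P)))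
    {z : ℕ+ → ℝ} (hz : z ∈ cube) (hf : Feasible P z) :
    HasSum (fun h : Fin n → Cell => MvPolynomial.eval z (contribution H U P h))
      (tau H (WP U P z)) := by
  have hW := isPlaneGraphon_WP hU hz
  have hunion : ⋃ h : Fin n → Cell, (Set.univ.pi fun i => cellSet P z (h i)) =
      Set.univ.pi fun _ => Set.Ico (0 : ℝ) 1 := by
    rw [Set.iUnion_univ_pi]
    simp only [iUnion_cellSet hz hf]
  have hfinite : IsFiniteMeasure ((volume : Measure (Fin n → ℝ)).restrict
      (Set.univ.pi fun _ => Set.Ico (0 : ℝ) 1)) := by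
    rw [pi_restrict_eq]
    infer_instance
  have hint : IntegrableOn (fun x : Fin n → ℝ =>
      ∏ e : Fin n × Fin n with e.1 < e.2, edgeValue H e.1 e.2 (WP U P z (x e.1) (x e.2)))
      (Set.univ.pi fun _ => Set.Ico (0 : ℝ) 1) := by
    have hm : Measurable fun x : Fin n → ℝ =>
        ∏ e : Fin n × Fin n with e.1 < e.2, edgeValue H e.1 e.2 (WP U P z (x e.1) (x e.2)) :=
      Finset.measurable_prod _ fun e _ => measurable_edge H hW _ _
    refine Integrable.of_bound hm.aestronglyMeasurable 1 (Filter.Eventually.of_forall fun x => ?_)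
    have hmem := fun e : Fin n × Fin n => edgeValue_mem H e.1 e.2 (hW.mem (x e.1) (x e.2))
    rw [Real.norm_eq_abs, abs_of_nonneg (Finset.prod_nonneg fun e _ => (hmem e).1)]
    exact Finset.prod_le_one (fun e _ => (hmem e).1) fun e _ => (hmem e).2
  have hsum := hasSum_integral_iUnion (μ := (volume : Measure (Fin n → ℝ)))
    (s := fun h : Fin n → Cell => Set.univ.pi fun i => cellSet P z (h i))
    (fun h => MeasurableSet.univ_pi fun i => measurableSet_cellSet P z (h i))
    (by
      intro h h' hne
      refine Set.disjoint_left.mpr fun x hx hx' => hne (funext fun i => ?_)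
      exact pairwise_disjoint_cellSet hz hf (hx i trivial) (hx' i trivial))
    (by rw [hunion]; exact hint)
  rw [hunion] at hsum
  simp only [integral_cells H hU hz hf] at hsum
  exact hsum

/-! ### A weighted norm of polynomials -/

/-- The sum of the absolute values of the coefficients, that of `z^A` weighted by
`ρ ^ Σ(A)`. -/
def wnorm (ρ : ℝ) (q : MvPolynomial ℕ+ ℝ) : ℝ :=
  ∑ m ∈ q.support, |MvPolynomial.coeff m q| * ρ ^ weight m

theorem wnorm_eq_sum (ρ : ℝ) {q : MvPolynomial ℕ+ ℝ} {s : Finset (ℕ+ →₀ ℕ)}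
    (hs : q.support ⊆ s) : wnorm ρ q = ∑ m ∈ s, |MvPolynomial.coeff m q| * ρ ^ weight m := by
  refine Finset.sum_subset hs fun m _ hm => ?_
  rw [MvPolynomial.notMem_support_iff.mp hm, abs_zero, zero_mul]

theorem wnorm_nonneg {ρ : ℝ} (hρ : 0 ≤ ρ) (q : MvPolynomial ℕ+ ℝ) : 0 ≤ wnorm ρ q :=
  Finset.sum_nonneg fun _ _ => mul_nonneg (abs_nonneg _) (pow_nonneg hρ _)

theorem wnorm_add_le {ρ : ℝ} (hρ : 0 ≤ ρ) (p q : MvPolynomial ℕ+ ℝ) :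
    wnorm ρ (p + q) ≤ wnorm ρ p + wnorm ρ q := by
  classical
  rw [wnorm_eq_sum ρ MvPolynomial.support_add, wnorm_eq_sum ρ Finset.subset_union_left,
    wnorm_eq_sum (q := q) ρ Finset.subset_union_right, ← Finset.sum_add_distrib]
  refine Finset.sum_le_sum fun m _ => ?_
  rw [MvPolynomial.coeff_add, ← add_mul]
  exact mul_le_mul_of_nonneg_right (abs_add_le _ _) (pow_nonneg hρ _)

theorem wnorm_neg (ρ : ℝ) (q : MvPolynomial ℕ+ ℝ) : wnorm ρ (-q) = wnorm ρ q := by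
  simp [wnorm]

theorem wnorm_sub_le {ρ : ℝ} (hρ : 0 ≤ ρ) (p q : MvPolynomial ℕ+ ℝ) :
    wnorm ρ (p - q) ≤ wnorm ρ p + wnorm ρ q := by
  rw [sub_eq_add_neg, ← wnorm_neg ρ q]
  exact wnorm_add_le hρ p (-q)

theorem wnorm_zero (ρ : ℝ) : wnorm ρ 0 = 0 := by
  simp [wnorm]

theorem wnorm_monomial (ρ : ℝ) (m : ℕ+ →₀ ℕ) (a : ℝ) :
    wnorm ρ (MvPolynomial.monomial m a) = |a| * ρ ^ weight m := by
  rw [wnorm_eq_sum ρ MvPolynomial.support_monomial_subset, Finset.sum_singleton,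
    MvPolynomial.coeff_monomial, if_pos rfl]

theorem wnorm_C (ρ : ℝ) (a : ℝ) : wnorm ρ (MvPolynomial.C a) = |a| := by
  have : weight 0 = 0 := by simp [weight]
  rw [← MvPolynomial.monomial_zero', wnorm_monomial, this, pow_zero, mul_one]

theorem wnorm_one (ρ : ℝ) : wnorm ρ 1 = 1 := by
  rw [← MvPolynomial.C_1, wnorm_C, abs_one]

theorem wnorm_sum_le {ρ : ℝ} (hρ : 0 ≤ ρ) {ι : Type*} (s : Finset ι)
    (f : ι → MvPolynomial ℕ+ ℝ) : wnorm ρ (∑ i ∈ s, f i) ≤ ∑ i ∈ s, wnorm ρ (f i) :=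
  Finset.le_sum_of_subadditive _ (wnorm_zero ρ).le (wnorm_add_le hρ) s f

/-- Expand both factors into monomials and use that the sum of a multiset is additive, which makes
the weight multiplicative. -/
theorem wnorm_mul_le {ρ : ℝ} (hρ : 0 ≤ ρ) (p q : MvPolynomial ℕ+ ℝ) :
    wnorm ρ (p * q) ≤ wnorm ρ p * wnorm ρ q := by
  have h : p * q = ∑ m ∈ p.support, ∑ m' ∈ q.support,
      MvPolynomial.monomial (m + m') (MvPolynomial.coeff m p * MvPolynomial.coeff m' q) := by
    conv_lhs => rw [p.as_sum, q.as_sum]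
    rw [Finset.sum_mul_sum]
    simp only [MvPolynomial.monomial_mul]
  rw [h]
  refine (wnorm_sum_le hρ _ _).trans ?_
  unfold wnorm
  rw [Finset.sum_mul_sum]
  refine Finset.sum_le_sum fun m _ => (wnorm_sum_le hρ _ _).trans (le_of_eq ?_)
  refine Finset.sum_congr rfl fun m' _ => ?_
  rw [wnorm_monomial, abs_mul, weight_add, pow_add]
  ring

theorem wnorm_prod_le {ρ : ℝ} (hρ : 0 ≤ ρ) {ι : Type*} (s : Finset ι)
    (f : ι → MvPolynomial ℕ+ ℝ) : wnorm ρ (∏ i ∈ s, f i) ≤ ∏ i ∈ s, wnorm ρ (f i) := by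
  classical
  induction s using Finset.induction_on with
  | empty => simp [wnorm_one]
  | insert i s hi ih =>
    rw [Finset.prod_insert hi, Finset.prod_insert hi]
    exact (wnorm_mul_le hρ _ _).trans (mul_le_mul_of_nonneg_left ih (wnorm_nonneg hρ _))

theorem abs_coeff_le_wnorm {ρ : ℝ} (hρ : 0 < ρ) (q : MvPolynomial ℕ+ ℝ) (m : ℕ+ →₀ ℕ) :
    |MvPolynomial.coeff m q| ≤ wnorm ρ q * (ρ⁻¹) ^ weight m := by
  have h : |MvPolynomial.coeff m q| * ρ ^ weight m ≤ wnorm ρ q := by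
    by_cases hm : m ∈ q.support
    · exact Finset.single_le_sum (f := fun m => |MvPolynomial.coeff m q| * ρ ^ weight m)
        (fun _ _ => mul_nonneg (abs_nonneg _) (pow_nonneg hρ.le _)) hm
    · rw [MvPolynomial.notMem_support_iff.mp hm, abs_zero, zero_mul]
      exact wnorm_nonneg hρ.le q
  rw [inv_pow, ← div_eq_mul_inv, le_div_iff₀ (pow_pos hρ _)]
  exact h

/-- The `j`-th multiset has sum below `j`, so its weight is at most `2^j`, while its coefficient is
at most `2^{-2j}` by `coeff_bound`. The terms are thus dominated by `2^{-j}`. -/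
theorem wnorm_p_le (P : BoundingSequence) (k : ℕ+) {ρ : ℝ} (hρ : 1 ≤ ρ) (hρ2 : ρ ≤ 2) :
    wnorm ρ (P.p k) ≤ 1 := by
  have hterm : ∀ m ∈ (P.p k).support, |MvPolynomial.coeff m (P.p k)| * ρ ^ weight m ≤
      (1 / 2 : ℝ) ^ (position m + 1) := by
    intro m _
    set j : ℕ+ := Nat.succPNat (position m)
    have hj : (j : ℕ) = position m + 1 := rfl
    have hM : M j = m := position_injective (by rw [position_M]; simp [j])
    have h1 := P.coeff_le k j
    rw [hM] at h1
    have h2 : ρ ^ weight m ≤ 2 ^ (j : ℕ) := by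
      calc ρ ^ weight m ≤ ρ ^ (j : ℕ) :=
            pow_le_pow_right₀ hρ ((weight_le_position m).trans (by omega))
        _ ≤ 2 ^ (j : ℕ) := pow_le_pow_left₀ (by linarith) hρ2 _
    have h3 := coeff_bound j j.pos
    have h5 : (2 : ℝ) ^ (2 * (j : ℕ)) = 2 ^ (j : ℕ) * 2 ^ (j : ℕ) := by
      rw [two_mul, pow_add]
    rw [← hj, one_div, inv_pow, ← one_div, le_div_iff₀ (by positivity)]
    calc |MvPolynomial.coeff m (P.p k)| * ρ ^ weight m * 2 ^ (j : ℕ)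
        ≤ (((2 : ℝ) ^ (2 ^ (j : ℕ)))⁻¹ / 9) * 2 ^ (j : ℕ) * 2 ^ (j : ℕ) := by gcongr
      _ = (2 : ℝ) ^ (2 * (j : ℕ)) * ((2 : ℝ) ^ (2 ^ (j : ℕ)))⁻¹ / 9 := by rw [h5]; ring
      _ ≤ 1 / 9 := by gcongr
      _ ≤ 1 := by norm_num
  calc wnorm ρ (P.p k) ≤ ∑ m ∈ (P.p k).support, (1 / 2 : ℝ) ^ (position m + 1) :=
        Finset.sum_le_sum hterm
    _ = ∑ r ∈ (P.p k).support.image position, (1 / 2 : ℝ) ^ (r + 1) :=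
        (Finset.sum_image (f := fun r : ℕ => (1 / 2 : ℝ) ^ (r + 1)) position_injective.injOn).symm
    _ ≤ ∑' r : ℕ, (1 / 2 : ℝ) ^ (r + 1) := by
        refine Summable.sum_le_tsum _ (fun _ _ => by positivity) ?_
        simp only [pow_succ]
        exact summable_geometric_two.mul_right _
    _ = 1 := by
        simp only [pow_succ]
        rw [tsum_mul_right, tsum_geometric_two]
        norm_num

theorem wnorm_threshold_le (P : BoundingSequence) (θ : Bool) (k : ℕ+) {ρ : ℝ} (hρ : 1 ≤ ρ)
    (hρ2 : ρ ≤ 2) : wnorm ρ (threshold P θ k) ≤ 2 := by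
  have h := wnorm_p_le P k hρ hρ2
  cases θ
  · exact h.trans (by norm_num)
  · refine (wnorm_sub_le (by linarith) 1 (P.p k)).trans ?_
    rw [wnorm_one]
    linarith

/-! ### Bounds for the contributions of the configurations -/

/-- The index of the dyadic class of a cell. -/
def cellIndex : Cell → ℕ
  | .C _ k => k
  | .E _ k _ => k
  | .rest => 0

/-- The factor `(u - l)⁻¹` in the ratio may be arbitrarily large, but the length of the hull
contains `u - l`. The bound is therefore uniform in the bounding sequence; what is left has norm at
most 3, far below 75. -/
theorem volume_mul_wnorm_le (P : BoundingSequence) {ρ : ℝ} (hρ : 1 ≤ ρ) (hρ2 : ρ ≤ 2)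
    (c : Cell) :
    volume.real (hullSet P c) * wnorm ρ (ratioPoly P c) ≤ ((2 : ℝ) ^ cellIndex c)⁻¹ := by
  have hρ0 : 0 ≤ ρ := by linarith
  have key : ∀ (k : ℕ+) (a : ℝ), a ≤ 75 → a / (75 * 2 ^ (k : ℕ)) ≤ ((2 : ℝ) ^ (k : ℕ))⁻¹ := by
    intro k a ha
    rw [div_le_iff₀ (by positivity)]
    field_simp
    linarith
  cases c with
  | C b k =>
    have h1 : volume.real (hullSet P (.C b k)) = (1 - 0) / (75 * 2 ^ (k : ℕ)) :=
      volume_region (Or.inl rfl) b k le_rfl zero_le_one le_rfl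
    have h2 : wnorm ρ (ratioPoly P (.C b k)) = 1 := wnorm_one ρ
    rw [h1, h2, mul_one]
    exact key k _ (by norm_num)
  | E θ k j =>
    have hlo := lowerBound_nonneg P θ k
    have hlohi := lowerBound_le_upperBound P θ k
    have hhi := upperBound_le_one P θ k
    have hthr := wnorm_threshold_le P θ k hρ hρ2
    have hC : ∀ a : ℝ, 0 ≤ a → a ≤ 1 → wnorm ρ (MvPolynomial.C a) ≤ 1 := fun a h0 h1 => by
      rw [wnorm_C, abs_of_nonneg h0]; exact h1
    have h1 : wnorm ρ (threshold P θ k - MvPolynomial.C (lowerBound P θ k)) ≤ 3 :=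
      (wnorm_sub_le hρ0 _ _).trans (by linarith [hC _ hlo (hlohi.trans hhi)])
    have h2 : wnorm ρ (MvPolynomial.C (upperBound P θ k) - threshold P θ k) ≤ 3 :=
      (wnorm_sub_le hρ0 _ _).trans (by linarith [hC _ (hlo.trans hlohi) hhi])
    have hmid : ∀ q : MvPolynomial ℕ+ ℝ, wnorm ρ q ≤ 3 →
        (upperBound P θ k - lowerBound P θ k) / (75 * 2 ^ (k : ℕ)) *
          wnorm ρ (MvPolynomial.C (upperBound P θ k - lowerBound P θ k)⁻¹ * q) ≤
          ((2 : ℝ) ^ (k : ℕ))⁻¹ := by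
      intro q hq
      have h3 := wnorm_mul_le hρ0 (MvPolynomial.C (upperBound P θ k - lowerBound P θ k)⁻¹) q
      set d := upperBound P θ k - lowerBound P θ k with hd
      have hd0 : 0 ≤ d := sub_nonneg.mpr hlohi
      rw [wnorm_C, abs_of_nonneg (inv_nonneg.mpr hd0)] at h3
      have hq0 := wnorm_nonneg hρ0 q
      have hdd : d * d⁻¹ ≤ 1 := mul_inv_le_one
      calc d / (75 * 2 ^ (k : ℕ)) * wnorm ρ (MvPolynomial.C d⁻¹ * q)
          ≤ d / (75 * 2 ^ (k : ℕ)) * (d⁻¹ * wnorm ρ q) := by gcongr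
        _ = (d * d⁻¹) * wnorm ρ q / (75 * 2 ^ (k : ℕ)) := by ring
        _ ≤ 1 * 3 / (75 * 2 ^ (k : ℕ)) := by gcongr
        _ ≤ _ := key k _ (by norm_num)
    fin_cases j
    · have h3 : volume.real (hullSet P (.E θ k 0)) = (lowerBound P θ k - 0) / (75 * 2 ^ (k : ℕ)) :=
        volume_region (Or.inr rfl) θ k le_rfl hlo (hlohi.trans hhi)
      have h4 : wnorm ρ (ratioPoly P (.E θ k 0)) = 1 := wnorm_one ρ
      change volume.real (hullSet P (.E θ k 0)) * wnorm ρ (ratioPoly P (.E θ k 0)) ≤ _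
      rw [h3, h4, mul_one]
      exact key k _ (by linarith)
    · have h3 : volume.real (hullSet P (.E θ k 1)) = _ :=
        volume_region (Or.inr rfl) θ k hlo hlohi hhi
      change volume.real (hullSet P (.E θ k 1)) * wnorm ρ (ratioPoly P (.E θ k 1)) ≤ _
      rw [h3]
      exact hmid _ h1
    · have h3 : volume.real (hullSet P (.E θ k 2)) = _ :=
        volume_region (Or.inr rfl) θ k hlo hlohi hhi
      change volume.real (hullSet P (.E θ k 2)) * wnorm ρ (ratioPoly P (.E θ k 2)) ≤ _
      rw [h3]
      exact hmid _ h2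
    · have h3 : volume.real (hullSet P (.E θ k 3)) = (1 - upperBound P θ k) / (75 * 2 ^ (k : ℕ)) :=
        volume_region (Or.inr rfl) θ k (hlo.trans hlohi) hhi le_rfl
      have h4 : wnorm ρ (ratioPoly P (.E θ k 3)) = 1 := wnorm_one ρ
      change volume.real (hullSet P (.E θ k 3)) * wnorm ρ (ratioPoly P (.E θ k 3)) ≤ _
      rw [h3, h4, mul_one]
      exact key k _ (by linarith)
  | rest =>
    have h2 : wnorm ρ (ratioPoly P .rest) = 1 := wnorm_one ρ
    rw [h2, mul_one]
    refine (measureReal_mono (hullSet_subset P .rest) (by simp)).trans ?_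
    simp [cellIndex]

/-- The largest case is `1 - z^{M_k}`, where the sum of `M_k` is less than `k`. Since a nonzero
value requires equal classes, the cost can be charged to the first cell alone. -/
theorem wnorm_pairPoly_le {ρ : ℝ} (hρ : 1 ≤ ρ) (c c' : Cell) :
    wnorm ρ (pairPoly c c') ≤ 1 + ρ ^ cellIndex c := by
  have hρ0 : 0 ≤ ρ := by linarith
  have hpos : ∀ k : ℕ, 0 ≤ ρ ^ k := fun k => pow_nonneg hρ0 k
  have h0 : wnorm ρ 0 ≤ 1 + ρ ^ cellIndex c := by
    rw [wnorm_zero]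
    linarith [hpos (cellIndex c)]
  have h1 : wnorm ρ 1 ≤ 1 + ρ ^ cellIndex c := by
    rw [wnorm_one]
    linarith [hpos (cellIndex c)]
  have hm : ∀ k : ℕ+, wnorm ρ (MvPolynomial.monomial (M k) 1) ≤ ρ ^ (k : ℕ) := by
    intro k
    rw [wnorm_monomial, abs_one, one_mul]
    exact pow_le_pow_right₀ hρ (weight_M_lt k).le
  cases c with
  | C b k =>
    cases c' with
    | C b' k' =>
      simp only [pairPoly]
      split_ifs
      · exact (hm k).trans (by simp [cellIndex])
      · refine (wnorm_sub_le hρ0 _ _).trans ?_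
        rw [wnorm_one]
        exact add_le_add le_rfl (hm k)
      · exact h0
    | E θ k' j =>
      simp only [pairPoly]
      split_ifs
      · exact h1
      · exact h0
    | rest => exact h0
  | E θ k j =>
    cases c' with
    | C b' k' =>
      simp only [pairPoly]
      split_ifs
      · exact h1
      · exact h0
    | _ => exact h0
  | rest => cases c' <;> exact h0

theorem wnorm_specialPoly_le {n : ℕ} (H : SimpleGraph (Fin n)) {ρ : ℝ} (hρ : 1 ≤ ρ)
    (h : Fin n → Cell) :
    wnorm ρ (specialPoly H h) ≤ ∏ i, (3 * ρ ^ cellIndex (h i)) ^ n := by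
  classical
  have hρ0 : 0 ≤ ρ := by linarith
  have hone : ∀ i, 1 ≤ 3 * ρ ^ cellIndex (h i) := fun i => by
    have := one_le_pow₀ hρ (n := cellIndex (h i))
    linarith
  have hterm : ∀ e : Fin n × Fin n, wnorm ρ (if isSpecial (h e.1) (h e.2) then
      if H.Adj e.1 e.2 then pairPoly (h e.1) (h e.2) else 1 - pairPoly (h e.1) (h e.2)
      else 1) ≤ 3 * ρ ^ cellIndex (h e.1) := by
    intro e
    have h1 := wnorm_pairPoly_le hρ (h e.1) (h e.2)
    have h2 := one_le_pow₀ hρ (n := cellIndex (h e.1))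
    split_ifs
    · linarith
    · refine (wnorm_sub_le hρ0 _ _).trans ?_
      rw [wnorm_one]
      linarith
    · rw [wnorm_one]
      linarith
  unfold specialPoly
  calc _ ≤ ∏ e : Fin n × Fin n with e.1 < e.2, wnorm ρ (if isSpecial (h e.1) (h e.2) then
      if H.Adj e.1 e.2 then pairPoly (h e.1) (h e.2) else 1 - pairPoly (h e.1) (h e.2)
      else 1) := by
        convert wnorm_prod_le hρ0 _ _
    _ ≤ ∏ e : Fin n × Fin n with e.1 < e.2, 3 * ρ ^ cellIndex (h e.1) :=
        Finset.prod_le_prod (fun e _ => wnorm_nonneg hρ0 _) fun e _ => hterm e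
    -- All factors are at least 1, so the product may be enlarged to all ordered pairs; each vertex
    -- is then the first one exactly `n` times.
    _ ≤ ∏ e : Fin n × Fin n, 3 * ρ ^ cellIndex (h e.1) :=
        Finset.prod_le_prod_of_subset_of_one_le (Finset.filter_subset _ _)
          (fun e _ => zero_le_one.trans (hone e.1)) fun e _ _ => hone e.1
    _ = ∏ i, (3 * ρ ^ cellIndex (h i)) ^ n := by
        rw [Fintype.prod_prod_type]
        simp

theorem abs_freeIntegral_le {n : ℕ} (H : SimpleGraph (Fin n))
    {U : (ℝ → ℝ → ℝ) → ℝ → ℝ → ℝ} {P : BoundingSequence} (hU : IsPlaneGraphon (U (WF P)))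
    (h : Fin n → Cell) :
    |freeIntegral H U P h| ≤ ∏ i, volume.real (hullSet P (h i)) := by
  have hz0 : (0 : ℕ+ → ℝ) ∈ cube := fun _ => ⟨le_rfl, zero_le_one⟩
  have hW := isPlaneGraphon_WP hU hz0
  have hfin : ∀ i, volume (hullSet P (h i)) < ⊤ := fun i =>
    (measure_mono (hullSet_subset P (h i))).trans_lt (by simp)
  have hvol : (volume : Measure (Fin n → ℝ)) (Set.univ.pi fun i => hullSet P (h i)) =
      ∏ i, volume (hullSet P (h i)) := volume_pi_pi _
  have hb := norm_setIntegral_le_of_norm_le_const (μ := (volume : Measure (Fin n → ℝ)))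
    (s := Set.univ.pi fun i => hullSet P (h i)) (f := freeFactor H h (WP U P 0)) (C := 1)
    (by rw [hvol]; exact ENNReal.prod_lt_top fun i _ => hfin i)
    (fun x _ => by
      have := freeFactor_mem H h hW x
      rw [Real.norm_eq_abs, abs_of_nonneg this.1]
      exact this.2)
  rw [one_mul, Measure.real, hvol, ENNReal.toReal_prod] at hb
  exact hb

theorem wnorm_contribution_le {n : ℕ} (H : SimpleGraph (Fin n))
    {U : (ℝ → ℝ → ℝ) → ℝ → ℝ → ℝ} {P : BoundingSequence} (hU : IsPlaneGraphon (U (WF P)))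
    {ρ : ℝ} (hρ : 1 ≤ ρ) (hρ2 : ρ ^ (n + 1) = 2) (h : Fin n → Cell) :
    wnorm ρ (contribution H U P h) ≤ ∏ i, 3 ^ n * (ρ⁻¹) ^ cellIndex (h i) := by
  have hρ0 : 0 < ρ := by linarith
  have hle2 : ρ ≤ 2 := by
    rw [← hρ2]
    exact le_self_pow₀ hρ (by omega)
  have hvol0 : ∀ i, 0 ≤ volume.real (hullSet P (h i)) := fun i => measureReal_nonneg
  have h1 := abs_freeIntegral_le H hU h
  have h2 := wnorm_prod_le hρ0.le Finset.univ fun i => ratioPoly P (h i)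
  have h3 := wnorm_specialPoly_le H hρ h
  unfold contribution shapePoly
  calc _ ≤ wnorm ρ (MvPolynomial.C (freeIntegral H U P h)) *
        wnorm ρ ((∏ i, ratioPoly P (h i)) * specialPoly H h) := wnorm_mul_le hρ0.le _ _
    _ ≤ (∏ i, volume.real (hullSet P (h i))) * ((∏ i, wnorm ρ (ratioPoly P (h i))) *
          ∏ i, (3 * ρ ^ cellIndex (h i)) ^ n) := by
        rw [wnorm_C]
        refine mul_le_mul h1 ((wnorm_mul_le hρ0.le _ _).trans ?_) (wnorm_nonneg hρ0.le _)
          (Finset.prod_nonneg fun i _ => hvol0 i)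
        exact mul_le_mul h2 h3 (wnorm_nonneg hρ0.le _)
          (Finset.prod_nonneg fun i _ => wnorm_nonneg hρ0.le _)
    _ = ∏ i, volume.real (hullSet P (h i)) * wnorm ρ (ratioPoly P (h i)) *
          (3 * ρ ^ cellIndex (h i)) ^ n := by
        rw [← Finset.prod_mul_distrib, ← Finset.prod_mul_distrib]
        exact Finset.prod_congr rfl fun i _ => by ring
    _ ≤ ∏ i, ((2 : ℝ) ^ cellIndex (h i))⁻¹ * (3 * ρ ^ cellIndex (h i)) ^ n := by
        refine Finset.prod_le_prod (fun i _ => mul_nonneg (mul_nonneg (hvol0 i)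
          (wnorm_nonneg hρ0.le _)) (by positivity)) fun i _ => ?_
        exact mul_le_mul_of_nonneg_right (volume_mul_wnorm_le P hρ hle2 _) (by positivity)
    -- Since `2 = ρ ^ (n + 1)`, the gain `2^{-k}` outweighs the cost `ρ^{nk}` by one factor `ρ^k`.
    _ = ∏ i, 3 ^ n * (ρ⁻¹) ^ cellIndex (h i) := by
        refine Finset.prod_congr rfl fun i _ => ?_
        generalize cellIndex (h i) = k
        rw [← hρ2, mul_pow, inv_pow, ← pow_mul, ← pow_mul,
          show (n + 1) * k = k * n + k by ring, pow_add]
        field_simp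

/-! ### Summability over the configurations -/

/-- Only boundedly many cells share an index, so this is a geometric series with finite
multiplicity. -/
theorem summable_cell {r : ℝ} (hr0 : 0 ≤ r) (hr1 : r < 1) :
    Summable fun c : Cell => r ^ cellIndex c := by
  let f : Cell → (Fin 3 × Bool × Fin 4) × ℕ := fun c =>
    match c with
    | .C b k => ((0, b, 0), k)
    | .E θ k j => ((1, θ, j), k)
    | .rest => ((2, false, 0), 0)
  have hf : Function.Injective f := by
    rintro (_ | _ | _) (_ | _ | _) h <;> simp_all [f]
  have hs : Summable fun x : (Fin 3 × Bool × Fin 4) × ℕ => (1 : ℝ) * r ^ x.2 :=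
    Summable.mul_of_nonneg (f := fun _ : Fin 3 × Bool × Fin 4 => (1 : ℝ)) (Summable.of_finite)
      (summable_geometric_of_lt_one hr0 hr1) (fun _ => zero_le_one) fun _ => pow_nonneg hr0 _
  refine (hs.comp_injective hf).congr fun c => ?_
  cases c <;> simp [f, cellIndex]

/-- A finite set of configurations lies in the box over the finite set of values taken, where the
sum of products factorises. -/
theorem sum_prod_le {n : ℕ} {ι : Type*} {g : ι → ℝ} (hg0 : ∀ c, 0 ≤ g c) (hg : Summable g)
    (s : Finset (Fin n → ι)) : ∑ h ∈ s, ∏ i, g (h i) ≤ (∑' c, g c) ^ n := by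
  classical
  set t : Finset ι := s.biUnion fun h => Finset.univ.image h
  have hsub : s ⊆ Fintype.piFinset fun _ => t := by
    intro h hh
    rw [Fintype.mem_piFinset]
    exact fun i => Finset.mem_biUnion.mpr ⟨h, hh, Finset.mem_image_of_mem _ (Finset.mem_univ i)⟩
  calc ∑ h ∈ s, ∏ i, g (h i) ≤ ∑ h ∈ Fintype.piFinset fun _ : Fin n => t, ∏ i, g (h i) :=
        Finset.sum_le_sum_of_subset_of_nonneg hsub fun _ _ _ =>
          Finset.prod_nonneg fun _ _ => hg0 _
    _ = ∏ _i : Fin n, ∑ c ∈ t, g c := (Finset.prod_univ_sum (fun _ => t) fun _ c => g c).symm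
    _ = (∑ c ∈ t, g c) ^ n := by simp
    _ ≤ (∑' c, g c) ^ n :=
        pow_le_pow_left₀ (Finset.sum_nonneg fun c _ => hg0 c)
          (hg.sum_le_tsum t fun c _ => hg0 c) n

theorem summable_prod {n : ℕ} {ι : Type*} {g : ι → ℝ} (hg0 : ∀ c, 0 ≤ g c) (hg : Summable g) :
    Summable fun h : Fin n → ι => ∏ i, g (h i) :=
  summable_of_sum_le (fun _ => Finset.prod_nonneg fun _ _ => hg0 _) (sum_prod_le hg0 hg)

/-! ### Continuity in the bounding sequence -/

theorem exists_bound_on_cube (q : MvPolynomial ℕ+ ℝ) : ∃ B : ℝ, 0 ≤ B ∧ ∀ z ∈ cube,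
    |MvPolynomial.eval z q| ≤ B ∧ ∀ n, |MvPolynomial.eval z (MvPolynomial.pderiv n q)| ≤ B := by
  classical
  induction q using MvPolynomial.induction_on with
  | C a => exact ⟨|a|, abs_nonneg a, fun z _ => by simp⟩
  | add p q hp hq =>
    obtain ⟨B, hB, hp⟩ := hp
    obtain ⟨B', hB', hq⟩ := hq
    refine ⟨B + B', by positivity, fun z hz => ⟨?_, fun n => ?_⟩⟩
    · rw [map_add]
      exact (abs_add_le _ _).trans (add_le_add (hp z hz).1 (hq z hz).1)
    · rw [map_add, map_add]
      exact (abs_add_le _ _).trans (add_le_add ((hp z hz).2 n) ((hq z hz).2 n))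
  | mul_X p i hp =>
    obtain ⟨B, hB, hp⟩ := hp
    have key : ∀ a b : ℝ, |a| ≤ B → |b| ≤ 1 → |a * b| ≤ B := by
      intro a b ha hb
      rw [abs_mul]
      calc |a| * |b| ≤ B * 1 := mul_le_mul ha hb (abs_nonneg _) hB
        _ = B := mul_one B
    refine ⟨B + B, by positivity, fun z hz => ?_⟩
    have hzi : |z i| ≤ 1 := by
      rw [abs_of_nonneg (hz i).1]
      exact (hz i).2
    refine ⟨?_, fun n => ?_⟩
    · rw [map_mul, MvPolynomial.eval_X]
      linarith [key _ _ (hp z hz).1 hzi]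
    · rw [Derivation.leibniz, smul_eq_mul, smul_eq_mul, map_add, map_mul, map_mul,
        MvPolynomial.eval_X]
      refine (abs_add_le _ _).trans (add_le_add (key _ _ (hp z hz).1 ?_) ?_)
      · rw [MvPolynomial.pderiv_X]
        by_cases h : n = i
        · subst h; simp
        · simp [Ne.symm h]
      · rw [mul_comm]
        exact key _ _ ((hp z hz).2 n) hzi

/-- Exchange the factors one at a time; the factors not being exchanged have absolute value at most
1. -/
theorem abs_prod_sub_prod_le {ι : Type*} (s : Finset ι) {a b : ι → ℝ}
    (ha : ∀ i, a i ∈ Set.Icc (0 : ℝ) 1) (hb : ∀ i, b i ∈ Set.Icc (0 : ℝ) 1) :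
    |∏ i ∈ s, a i - ∏ i ∈ s, b i| ≤ ∑ i ∈ s, |a i - b i| := by
  classical
  induction s using Finset.induction_on with
  | empty => simp
  | insert i s hi ih =>
    rw [Finset.prod_insert hi, Finset.prod_insert hi, Finset.sum_insert hi]
    have h1 : |∏ j ∈ s, a j| ≤ 1 := by
      rw [abs_of_nonneg (Finset.prod_nonneg fun j _ => (ha j).1)]
      exact Finset.prod_le_one (fun j _ => (ha j).1) fun j _ => (ha j).2
    have h2 : |b i| ≤ 1 := by
      rw [abs_of_nonneg (hb i).1]
      exact (hb i).2
    calc |a i * ∏ j ∈ s, a j - b i * ∏ j ∈ s, b j|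
        = |(a i - b i) * ∏ j ∈ s, a j + b i * (∏ j ∈ s, a j - ∏ j ∈ s, b j)| := by ring_nf
      _ ≤ |a i - b i| * |∏ j ∈ s, a j| + |b i| * |∏ j ∈ s, a j - ∏ j ∈ s, b j| := by
          rw [← abs_mul, ← abs_mul]
          exact abs_add_le _ _
      _ ≤ |a i - b i| * 1 + 1 * ∑ j ∈ s, |a j - b j| := by gcongr
      _ = _ := by ring

theorem abs_edgeValue_sub {n : ℕ} (H : SimpleGraph (Fin n)) (i j : Fin n) (w w' : ℝ) :
    |edgeValue H i j w - edgeValue H i j w'| = |w - w'| := by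
  unfold edgeValue
  split_ifs
  · rfl
  · rw [sub_sub_sub_cancel_left, abs_sub_comm]

theorem abs_freeFactor_sub_le {n : ℕ} (H : SimpleGraph (Fin n)) (h : Fin n → Cell)
    {W W' : ℝ → ℝ → ℝ} (hW : IsPlaneGraphon W) (hW' : IsPlaneGraphon W') (x : Fin n → ℝ) :
    |freeFactor H h W x - freeFactor H h W' x| ≤
      ∑ e : Fin n × Fin n with e.1 < e.2, |W (x e.1) (x e.2) - W' (x e.1) (x e.2)| := by
  have h1 : (1 : ℝ) ∈ Set.Icc (0 : ℝ) 1 := ⟨zero_le_one, le_rfl⟩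
  unfold freeFactor
  refine (abs_prod_sub_prod_le _ (fun e => ?_) (fun e => ?_)).trans
    (Finset.sum_le_sum fun e _ => ?_)
  · split_ifs
    · exact h1
    · exact edgeValue_mem H _ _ (hW.mem _ _)
  · split_ifs
    · exact h1
    · exact edgeValue_mem H _ _ (hW'.mem _ _)
  · split_ifs
    · rw [sub_self, abs_zero]
      exact abs_nonneg _
    · exact (abs_edgeValue_sub H _ _ _ _).le

instance : IsProbabilityMeasure (volume.restrict (Set.Ico (0 : ℝ) 1)) :=
  ⟨by simp⟩

/-- Integrating a function of two distinct coordinates over the unit cube. -/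
theorem integral_two_coordinates {n : ℕ} {i j : Fin n} (hij : i ≠ j) {g : ℝ × ℝ → ℝ}
    (hg : Measurable g) :
    ∫ x in Set.univ.pi fun _ : Fin n => Set.Ico (0 : ℝ) 1, g (x i, x j) =
      ∫ s in Set.Ico (0 : ℝ) 1 ×ˢ Set.Ico (0 : ℝ) 1, g s := by
  set μ : Measure ℝ := volume.restrict (Set.Ico (0 : ℝ) 1)
  -- The coordinates are independent under the product measure, so two distinct ones have the
  -- product of their marginals as joint law.
  have hind := ProbabilityTheory.iIndepFun_pi (μ := fun _ : Fin n => μ)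
    (X := fun _ : Fin n => (id : ℝ → ℝ)) fun _ => aemeasurable_id
  have hmap := (ProbabilityTheory.indepFun_iff_map_prod_eq_prod_map_map
    (measurable_pi_apply i).aemeasurable (measurable_pi_apply j).aemeasurable).mp
    (hind.indepFun hij)
  have heval : ∀ i : Fin n, (Measure.pi fun _ : Fin n => μ).map (fun x => x i) = μ := fun i =>
    (measurePreserving_eval (fun _ : Fin n => μ) i).map_eq
  have hmap' : (Measure.pi fun _ : Fin n => μ).map (fun x => (x i, x j)) = μ.prod μ := by
    refine Eq.trans hmap ?_
    have h1 := heval i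
    have h2 := heval j
    rw [h1, h2]
  rw [pi_restrict_eq, Measure.volume_eq_prod, ← Measure.prod_restrict]
  change _ = ∫ s, g s ∂(μ.prod μ)
  rw [← hmap', integral_map ((measurable_pi_apply i).prodMk (measurable_pi_apply j)).aemeasurable
    hg.aestronglyMeasurable]

theorem abs_sub_le_one {a b : ℝ} (ha : a ∈ Set.Icc (0 : ℝ) 1) (hb : b ∈ Set.Icc (0 : ℝ) 1) :
    |a - b| ≤ 1 := by
  rw [abs_le]
  constructor <;> linarith [ha.1, ha.2, hb.1, hb.2]

/-- A real supremum dominates its terms only when the family is bounded above; here 1 is a bound. -/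
theorem integral_le_l1Dist {U : (ℝ → ℝ → ℝ) → ℝ → ℝ → ℝ} {P P' : BoundingSequence}
    (hU : IsPlaneGraphon (U (WF P))) (hU' : IsPlaneGraphon (U (WF P'))) {z : ℕ+ → ℝ}
    (hz : z ∈ cube) :
    ∫ s in Set.Ico (0 : ℝ) 1 ×ˢ Set.Ico (0 : ℝ) 1, |WP U P z s.1 s.2 - WP U P' z s.1 s.2| ≤
      l1Dist U P P' := by
  have hvol : (volume : Measure (ℝ × ℝ)) (Set.Ico (0 : ℝ) 1 ×ˢ Set.Ico (0 : ℝ) 1) = 1 := by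
    rw [Measure.volume_eq_prod, Measure.prod_prod]
    simp
  have hbdd : BddAbove (Set.range fun z : cube =>
      ∫ s in Set.Ico (0 : ℝ) 1 ×ˢ Set.Ico (0 : ℝ) 1,
        |WP U P z s.1 s.2 - WP U P' z s.1 s.2|) := by
    refine ⟨1, ?_⟩
    rintro _ ⟨z, rfl⟩
    have h := norm_setIntegral_le_of_norm_le_const (μ := (volume : Measure (ℝ × ℝ)))
      (s := Set.Ico (0 : ℝ) 1 ×ˢ Set.Ico (0 : ℝ) 1)
      (f := fun s => |WP U P z s.1 s.2 - WP U P' z s.1 s.2|) (C := 1) (by rw [hvol]; simp)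
      fun s _ => by
        rw [Real.norm_eq_abs, abs_abs]
        exact abs_sub_le_one ((isPlaneGraphon_WP hU z.2).mem _ _)
          ((isPlaneGraphon_WP hU' z.2).mem _ _)
    rw [Measure.real, hvol, ENNReal.toReal_one, one_mul] at h
    exact (Real.le_norm_self _).trans h
  exact le_ciSup hbdd ⟨z, hz⟩

/-- With the same hulls, the two products of edge factors differ by at most the sum of the edgewise
differences. Over the whole cube each of these integrates to the `L_1`-difference of the graphons at
`z = 0`. -/
theorem abs_freeIntegral_sub_le {n : ℕ} (H : SimpleGraph (Fin n))
    {U : (ℝ → ℝ → ℝ) → ℝ → ℝ → ℝ} {P P' : BoundingSequence} (hU : IsPlaneGraphon (U (WF P)))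
    (hU' : IsPlaneGraphon (U (WF P'))) (h : Fin n → Cell)
    (hh : ∀ i, hullSet P (h i) = hullSet P' (h i)) :
    |freeIntegral H U P h - freeIntegral H U P' h| ≤ (n * n) * l1Dist U P P' := by
  have hz0 : (0 : ℕ+ → ℝ) ∈ cube := fun _ => ⟨le_rfl, zero_le_one⟩
  have hW := isPlaneGraphon_WP hU hz0
  have hW' := isPlaneGraphon_WP hU' hz0
  have hl1 := integral_le_l1Dist hU hU' hz0
  have hl0 : 0 ≤ l1Dist U P P' := (integral_nonneg fun s => abs_nonneg _).trans hl1
  set S : Set (Fin n → ℝ) := Set.univ.pi fun i => hullSet P (h i) with hS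
  set T : Set (Fin n → ℝ) := Set.univ.pi fun _ => Set.Ico (0 : ℝ) 1 with hT
  have hST : S ⊆ T := Set.pi_mono fun i _ => hullSet_subset P (h i)
  have hfinT : IsFiniteMeasure ((volume : Measure (Fin n → ℝ)).restrict T) := by
    rw [hT, pi_restrict_eq]
    infer_instance
  have hfinS : IsFiniteMeasure ((volume : Measure (Fin n → ℝ)).restrict S) :=
    isFiniteMeasure_of_le _ (Measure.restrict_mono hST le_rfl)
  have hint : ∀ {W : ℝ → ℝ → ℝ}, IsPlaneGraphon W → IntegrableOn (freeFactor H h W) S :=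
    fun hW => Integrable.of_bound (measurable_freeFactor H h hW).aestronglyMeasurable 1
      (Filter.Eventually.of_forall fun x => by
        have := freeFactor_mem H h hW x
        rw [Real.norm_eq_abs, abs_of_nonneg this.1]
        exact this.2)
  have hgm : Measurable fun s : ℝ × ℝ => |WP U P 0 s.1 s.2 - WP U P' 0 s.1 s.2| :=
    (hW.meas.sub hW'.meas).abs
  have hterm : ∀ e : Fin n × Fin n, IntegrableOn (fun x : Fin n → ℝ =>
      |WP U P 0 (x e.1) (x e.2) - WP U P' 0 (x e.1) (x e.2)|) T := by
    intro e
    have hpair : Measurable fun x : Fin n → ℝ => (x e.1, x e.2) :=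
      (measurable_pi_apply e.1).prodMk (measurable_pi_apply e.2)
    refine Integrable.of_bound (hgm.comp hpair).aestronglyMeasurable 1
      (Filter.Eventually.of_forall fun x => ?_)
    rw [Real.norm_eq_abs, abs_abs]
    exact abs_sub_le_one (hW.mem _ _) (hW'.mem _ _)
  have hsumint : IntegrableOn (fun x : Fin n → ℝ => ∑ e : Fin n × Fin n with e.1 < e.2,
      |WP U P 0 (x e.1) (x e.2) - WP U P' 0 (x e.1) (x e.2)|) T :=
    integrable_finsetSum _ fun e _ => hterm e
  have heq : freeIntegral H U P' h = ∫ x in S, freeFactor H h (WP U P' 0) x := by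
    unfold freeIntegral
    simp only [hS, hh]
  rw [heq]
  change |(∫ x in S, freeFactor H h (WP U P 0) x) - _| ≤ _
  rw [← integral_sub (hint hW) (hint hW')]
  calc |∫ x in S, (freeFactor H h (WP U P 0) x - freeFactor H h (WP U P' 0) x)|
      ≤ ∫ x in S, |freeFactor H h (WP U P 0) x - freeFactor H h (WP U P' 0) x| :=
        abs_integral_le_integral_abs
    _ ≤ ∫ x in S, ∑ e : Fin n × Fin n with e.1 < e.2,
          |WP U P 0 (x e.1) (x e.2) - WP U P' 0 (x e.1) (x e.2)| :=
        integral_mono ((hint hW).sub (hint hW')).abs (hsumint.mono_set hST)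
          fun x => abs_freeFactor_sub_le H h hW hW' x
    -- The integrand is nonnegative, so the box of hulls may be enlarged to the unit cube, where
    -- two-coordinate marginals are available.
    _ ≤ ∫ x in T, ∑ e : Fin n × Fin n with e.1 < e.2,
          |WP U P 0 (x e.1) (x e.2) - WP U P' 0 (x e.1) (x e.2)| :=
        setIntegral_mono_set hsumint (Filter.Eventually.of_forall fun x =>
          Finset.sum_nonneg fun e _ => abs_nonneg _) hST.eventuallyLE
    _ = ∑ e : Fin n × Fin n with e.1 < e.2, ∫ x in T,
          |WP U P 0 (x e.1) (x e.2) - WP U P' 0 (x e.1) (x e.2)| :=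
        integral_finsetSum _ fun e _ => hterm e
    _ ≤ ∑ e : Fin n × Fin n with e.1 < e.2, l1Dist U P P' := by
        refine Finset.sum_le_sum fun e he => ?_
        have hne : e.1 ≠ e.2 := (Finset.mem_filter.mp he).2.ne
        exact (integral_two_coordinates hne hgm).le.trans hl1
    _ ≤ ∑ _e : Fin n × Fin n, l1Dist U P P' :=
        Finset.sum_le_sum_of_subset_of_nonneg (Finset.filter_subset _ _) fun _ _ _ => hl0
    _ = (n * n) * l1Dist U P P' := by simp

theorem AgreeUpTo.cell {k : ℕ} {P P' : BoundingSequence} (h : AgreeUpTo k P P') {c : Cell}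
    (hc : cellIndex c ≤ k) : hullSet P c = hullSet P' c ∧ ratioPoly P c = ratioPoly P' c := by
  cases c with
  | C b i => exact ⟨rfl, rfl⟩
  | E θ i j =>
    obtain ⟨hp, hl, hu⟩ := h i hc
    have h1 : lowerBound P θ i = lowerBound P' θ i := by unfold lowerBound; rw [hl]
    have h2 : upperBound P θ i = upperBound P' θ i := by unfold upperBound; rw [hu]
    have h3 : threshold P θ i = threshold P' θ i := by unfold threshold; rw [hp]
    constructor
    · simp only [hullSet, hullLevels, h1, h2]
    · simp only [ratioPoly, h1, h2, h3]
  | rest => exact ⟨rfl, rfl⟩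

/-- The contributions depend continuously on the bounding sequence. -/
theorem contribution_epsClose {n : ℕ} (H : SimpleGraph (Fin n))
    {U : (ℝ → ℝ → ℝ) → ℝ → ℝ → ℝ} (hU : ∀ P, IsPlaneGraphon (U (WF P)))
    (P : BoundingSequence) (h : Fin n → Cell) {ε : ℝ} (hε : 0 < ε) :
    ∃ k : ℕ, ∃ δ : ℝ, 0 < δ ∧ ∀ P', AgreeUpTo k P P' → l1Dist U P P' ≤ δ →
      EpsClose ε (contribution H U P h) (contribution H U P' h) := by
  obtain ⟨B, hB, hbound⟩ := exists_bound_on_cube (shapePoly H P h)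
  -- The sum of the indices dominates each of them, so agreement up to it fixes all hulls and
  -- ratios. The added ones keep the denominator positive when `n` or `B` vanishes.
  refine ⟨∑ i, cellIndex (h i), ε / ((n * n + 1) * (B + 1)), by positivity,
    fun P' hP' hdist => ?_⟩
  have hcell := fun i => hP'.cell (c := h i)
    (Finset.single_le_sum (f := fun i => cellIndex (h i)) (fun _ _ => Nat.zero_le _)
      (Finset.mem_univ i))
  have hshape : shapePoly H P' h = shapePoly H P h := by
    unfold shapePoly
    simp only [(hcell _).2]
  have hJ : |freeIntegral H U P h - freeIntegral H U P' h| * (B + 1) ≤ ε := by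
    have h1 := abs_freeIntegral_sub_le H (hU P) (hU P') h fun i => (hcell i).1
    rw [le_div_iff₀ (by positivity)] at hdist
    have hl0 : 0 ≤ l1Dist U P P' := (integral_nonneg fun s => abs_nonneg _).trans
      (integral_le_l1Dist (hU P) (hU P') (z := 0) fun _ => ⟨le_rfl, zero_le_one⟩)
    calc |freeIntegral H U P h - freeIntegral H U P' h| * (B + 1)
        ≤ ((n * n) * l1Dist U P P') * (B + 1) := by gcongr
      _ ≤ ((n * n + 1) * l1Dist U P P') * (B + 1) := by gcongr; linarith
      _ = l1Dist U P P' * ((n * n + 1) * (B + 1)) := by ring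
      _ ≤ ε := hdist
  have hfinal : ∀ b : ℝ, |b| ≤ B →
      |freeIntegral H U P h * b - freeIntegral H U P' h * b| ≤ ε := by
    intro b hb
    rw [← sub_mul, abs_mul]
    refine le_trans ?_ hJ
    gcongr
    linarith
  intro z hz
  unfold contribution
  rw [hshape]
  refine ⟨?_, fun m => ?_⟩
  · simp only [map_mul, MvPolynomial.eval_C]
    exact hfinal _ (hbound z hz).1
  · simp only [MvPolynomial.pderiv_C_mul, map_mul, MvPolynomial.eval_C]
    exact hfinal _ ((hbound z hz).2 m)

end GraphonFamily

end

/-! ### The choice of constants and the conclusion. -/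

open GraphonFamily in
theorem mainTheorem5 (n : ℕ) (H : SimpleGraph (Fin n)) :
    ∃ (ℋ : Type) (_ : Countable ℋ) (c : ℝ) (β : ℋ → ℕ+ → ℝ),
      0 < c ∧ c < 1 ∧
      (∀ i, Summable fun h => β h i) ∧
      (∀ᶠ i in Filter.cofinite, ∑' h, β h i ≤ c ^ GraphonFamily.weight (GraphonFamily.M i)) ∧
      ∀ U : (ℝ → ℝ → ℝ) → ℝ → ℝ → ℝ, GraphonFamily.IsUniversalEmbedding U →
        ∃ q : GraphonFamily.BoundingSequence → ℋ → MvPolynomial ℕ+ ℝ,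
          (∀ P, ∀ z ∈ GraphonFamily.cube, GraphonFamily.Feasible P z →
            HasSum (fun h => MvPolynomial.eval z (q P h))
              (GraphonFamily.tau H (GraphonFamily.WP U P z))) ∧
          (∀ P h i, |MvPolynomial.coeff (GraphonFamily.M i) (q P h)| ≤ β h i) ∧
          (∀ P h, ∀ ε : ℝ, 0 < ε → ∃ k : ℕ, ∃ δ : ℝ, 0 < δ ∧
            ∀ P', GraphonFamily.AgreeUpTo k P P' → GraphonFamily.l1Dist U P P' ≤ δ →
              GraphonFamily.EpsClose ε (q P h) (q P' h)) := by
  -- The norm uses `ρ = σ ^ 2` with `ρ ^ (n + 1) = 2`. One factor `σ` is held in reserve to absorb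
  -- the total `K` over all configurations, leaving `c = σ⁻¹`.
  set σ : ℝ := (2 : ℝ) ^ (((2 * (n + 1) : ℕ) : ℝ)⁻¹) with hσ
  have hσ2 : σ ^ (2 * (n + 1)) = 2 := Real.rpow_inv_natCast_pow (by norm_num) (by omega)
  have hσ1 : 1 < σ := Real.one_lt_rpow (by norm_num) (by positivity)
  have hσ0 : 0 < σ := by linarith
  set ρ : ℝ := σ ^ 2 with hρ
  have hρ1 : 1 < ρ := one_lt_pow₀ hσ1 (by norm_num)
  have hρ0 : 0 < ρ := by linarith
  have hρ2 : ρ ^ (n + 1) = 2 := by rw [hρ, ← pow_mul, hσ2]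
  set g : Cell → ℝ := fun c => 3 ^ n * (ρ⁻¹) ^ cellIndex c with hg
  have hg0 : ∀ c, 0 ≤ g c := fun c => by positivity
  have hgs : Summable g :=
    (summable_cell (inv_nonneg.mpr hρ0.le) (inv_lt_one_of_one_lt₀ hρ1)).mul_left _
  have hprod := summable_prod (n := n) hg0 hgs
  set K : ℝ := ∑' h : Fin n → Cell, ∏ i, g (h i) with hK
  refine ⟨Fin n → Cell, inferInstance, σ⁻¹, fun h i => (∏ j, g (h j)) * (ρ⁻¹) ^ weight (M i),
    inv_pos.mpr hσ0, inv_lt_one_of_one_lt₀ hσ1, fun i => hprod.mul_right _, ?_, ?_⟩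
  -- Once the sum of `M_i` exceeds `w`, its power of `σ` is larger than `K`; only finitely many
  -- multisets have sum at most `w`.
  · obtain ⟨w, hw⟩ := pow_unbounded_of_one_lt K hσ1
    have hMinj : Function.Injective M := fun i j hij => by
      have h1 := position_M i
      rw [hij, position_M] at h1
      exact PNat.natPred_injective h1.symm
    have hfin : {i : ℕ+ | weight (M i) ≤ w}.Finite :=
      (finite_weight_le w).preimage hMinj.injOn
    filter_upwards [hfin.compl_mem_cofinite] with i hi
    have hi' : w ≤ weight (M i) := (not_le.mp (show ¬ weight (M i) ≤ w from hi)).le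
    rw [tsum_mul_right]
    calc K * (ρ⁻¹) ^ weight (M i) ≤ σ ^ weight (M i) * (ρ⁻¹) ^ weight (M i) := by
          gcongr
          exact hw.le.trans (pow_le_pow_right₀ hσ1.le hi')
      _ = (σ⁻¹) ^ weight (M i) := by
          rw [← mul_pow, hρ]
          congr 1
          field_simp
  · intro U hU
    have hU' : ∀ P, IsPlaneGraphon (truncate U (WF P)) := fun P =>
      isPlaneGraphon_truncate (hU _ (isGraphon_WF P)).1
    -- Neither densities nor `L_1`-distances notice the truncation, so the polynomials built from it
    -- serve for `U`.
    refine ⟨fun P h => contribution H (truncate U) P h, ?_, ?_, ?_⟩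
    · intro P z hz hf
      rw [← tau_truncate]
      exact hasSum_contribution H (hU' P) hz hf
    · intro P h i
      refine (abs_coeff_le_wnorm hρ0 _ _).trans ?_
      exact mul_le_mul_of_nonneg_right (wnorm_contribution_le H (hU' P) hρ1.le hρ2 h)
        (by positivity)
    · intro P h ε hε
      obtain ⟨k, δ, hδ, hk⟩ := contribution_epsClose H hU' P h hε
      refine ⟨k, δ, hδ, fun P' hP' hd => hk P' hP' ?_⟩
      rw [l1Dist_truncate]
      exact hd
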